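/- **Setting.** Let $T\ge 1$, let $\omega$ be a primitive $T$-th root of unity, and let $\zeta_1,\dots,\zeta_N\in\mathbb C^\times$ have pairwise disjoint orbits under multiplication by $\omega$. Let $\mathfrak g$ be a complex matrix Lie algebra on which $(x,y)\mapsto\mathrm{Tr}(xy)$ is nondegenerate, $\sigma$ a Lie algebra automorphism of $\mathfrak g$ with $\sigma^T=\mathrm{id}$ preserving $\mathrm{Tr}(xy)$, $\mathfrak g^{(k)}=\{x:\sigma x=\omega^kx\}$, and $G$ the connected matrix group generated by $\exp\mathfrak g$, to which $\sigma$ is assumed to integrate (the integrated automorphism is again written $\sigma$). Put $S=\{0,1,\dots,N,\infty\}$, $\zeta_0=0$, $\lambda_r=\lambda-\zeta_r$ ($r\ne\infty$), $\lambda_\infty=1/\lambda$, $D'=\{0,\infty\}\cup\{\omega^k\zeta_r\}$. Let $\mathcal F^\Gamma$ (resp. $\Omega^\Gamma$) be the $\mathfrak g$-valued rational functions of $\lambda$ regular outside $D'$ with $\sigma(f(\lambda))=f(\omega\lambda)$ (resp. $\sigma(g(\lambda))=\omega g(\omega\lambda)$), and $\iota_\lambda$ the map sending a rational function to the tuple of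 its Laurent expansions $\iota_{\lambda_r}$ at the points labelled by $r\in S$. For $k=0,1$ let $\widetilde{\mathfrak g}^{(k)}_D$ be the space of tuples $(X_r)_{r\in S}$, $X_r\in\mathfrak g((\lambda_r))$, with $\sigma(X_0(\lambda_0))=\omega^kX_0(\omega\lambda_0)$ and $\sigma (X_\infty(\lambda_\infty))=\omega^kX_\infty(\omega^{-1}\lambda_\infty)$, and $\widetilde{\mathfrak g}^{(k)}_{D+}$ the subspace of tuples of Taylor series without constant term at $\infty$; thus $\widetilde{\mathfrak g}_D^{(0)}=\widetilde{\mathfrak g}_{D+}^{(0)}\dotplus\iota_\lambda\mathcal F^\Gamma$ and $\widetilde{\mathfrak g}_D^{(1)}=\widetilde{\mathfrak g}_{D+}^{(1)}\dotplus\iota_\lambda\Omega^\Gamma$. The pairing of $Y\in\widetilde{\mathfrak g}^{(1)}_D$ with $X\in\widetilde{\mathfrak g}^{(0)}_D$ is $$\langle Y,X\rangle=T\sum_{r=1}^N\operatorname{Res}_{\lambda_r=0}\mathrm{Tr}(Y_rX_r)\,d\lambda+\sum_{r\in\{0,\infty\}}\operatorname{Res}_{\lambda_r=0}\mathrm{Tr}(Y_rX_r)\,d\lambda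 .$$ For $p\ge1$, $r\in S$, put $H_{p,r}(Y)=\operatorname{Res}_{\lambda_r=0}\big(\ell_{p,r}\mathrm{Tr}(Y_r^{p+1})\big)d\lambda$ with $\ell_{p,r}=\iota_{\lambda_r}\frac{\lambda^p}{p+1}$ for $r\in\{0,\infty\}$ and $\ell_{p,r}=\iota_{\lambda_r}\frac{T\lambda^p}{p+1}$ otherwise; its gradient $\nabla H_{p,r}(Y)\in\widetilde{\mathfrak g}^{(0)}_D$ is taken with respect to the pairing. Let $\widetilde G_{D+}$ be the group of tuples $\varphi_+=(\varphi_{r+})_{r\in S}$ of $G$-valued Taylor series $\varphi_{r+}=\sum_n\phi_r^{(n)}\lambda_r^n$, with $\sigma(\varphi_{0+}(\lambda_0))=\varphi_{0+}(\omega\lambda_0)$, $\sigma(\varphi_{\infty+}(\lambda_\infty))=\varphi_{\infty+}(\omega^{-1}\lambda_\infty)$ and $\phi_\infty^{(0)}=1$. Fix $$\Lambda=\frac{\Lambda_0^{(0)}}{\lambda}+\frac{\Lambda_0^{(1)}}{\lambda^2}+\frac1T\sum_{r=1}^N\sum_{k=0}^{T-1}\frac{\sigma^k\Lambda_r}{\lambda-\omega^k\zeta_r}+\Lambda_\infty,$$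 where $\Lambda_0^{(0)}\in\mathfrak g^{(0)}$, $\Lambda_0^{(1)}\in\mathfrak g^{(-1)}$, $\Lambda_r\in\mathfrak g$, $\Lambda_\infty\in\mathfrak g^{(1)}$. The fields are $\phi_s=\phi_s^{(0)}\in G$ ($1\le s\le N$), $\phi_0^{(0)}\in G$ with $\sigma\phi_0^{(0)}=\phi_0^{(0)}$, and $\phi_0^{(1)}$ with $\phi_0^{(1)}\phi_0^{(0)\,-1}\in\mathfrak g^{(1)}$. Put $A_s=\phi_s\Lambda_s\phi_s^{-1}$, $A_0^{(1)}=\phi_0^{(0)}\Lambda_0^{(1)}\phi_0^{(0)\,-1}$, $A_0^{(0)}=\phi_0^{(0)}\Lambda_0^{(0)}\phi_0^{(0)\,-1}+[\phi_0^{(1)}\phi_0^{(0)\,-1},A_0^{(1)}]$, and let $L$ be obtained from $\Lambda$ by replacing $\Lambda_0^{(0)},\Lambda_0^{(1)},\Lambda_r$ with $A_0^{(0)},A_0^{(1)},A_r$ and keeping $\Lambda_\infty$. Fields depend smoothly on real times $t^{p,r}$, $(p,r)\in I$, in an open set $U\subseteq\mathbb R^I$, where $I\subset\mathbb Z_{\ge1}\times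 S$ is any finite set. **Theorem.** 1. For every $\varphi_+\in\widetilde G_{D+}$, the unique element of $\Omega^\Gamma$ whose expansion is the projection of $\varphi_+(\iota_\lambda\Lambda)\varphi_+^{-1}$ to $\iota_\lambda\Omega^\Gamma$ along $\widetilde{\mathfrak g}^{(1)}_{D+}$ is $L$, formed from the components $\phi_s^{(0)},\phi_0^{(0)},\phi_0^{(1)}$ of $\varphi_+$. Put $$\mathscr L_{p,r}=\sum_{s=1}^N\mathrm{Tr}\big(A_s\,\partial_{t^{p,r}}\phi_s\,\phi_s^{-1}\big)+\mathrm{Tr}\big(A_0^{(0)}\,\partial_{t^{p,r}}\phi_0^{(0)}\,\phi_0^{(0)\,-1}\big)-H_{p,r}(\iota_\lambda L).$$ There is a function $F$ on $\widetilde G_{D+}$, differentiable along every smooth field $\varphi_+(t)$, such that the geometric Lagrangian coefficients on the coadjoint orbit satisfy $$\langle\iota_\lambda L,\ \partial_{t^{p,r}}\varphi_+\,\varphi_+^{-1}+u_-\rangle-H_{p,r}(\iota_\lambda L)=\mathscr L_{p,r}+\partial_{t^{p,r}}\big(F(\varphi_+)\big)$$ for all $(p,r)\in I$ and every $u_-\in\iota_\lambda\mathcal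 F^\Gamma$; that is, up to a total differential the geometric Lagrangian one-form is $\mathscr L=\sum\mathscr L_{p,r}\,dt^{p,r}$. 2. $\mathscr L$ satisfies the corner equations: $\partial\mathscr L_{p,r}/\partial(\partial_{t^{q,s}}\phi)=0$ for $(q,s)\neq(p,r)$, and $\partial\mathscr L_{p,r}/\partial(\partial_{t^{p,r}}\phi)=\partial\mathscr L_{q,s}/\partial(\partial_{t^{q,s}}\phi)$, where $\phi=(\phi_1,\dots,\phi_N,\phi_0^{(0)},\phi_0^{(1)})$. 3. For all $p\ge1$ and $r\in S$ there is a unique $h_r^{(p)}\in\mathcal F^\Gamma$ with $\nabla H_{p,r}(\iota_\lambda L)-\iota_\lambda h_r^{(p)}\in\widetilde{\mathfrak g}^{(0)}_{D+}$, and a smooth field on $U$ satisfies the standard Euler–Lagrange equations of $\mathscr L_{p,r}$ if and only if it satisfies the Lax equation $$\partial_{t^{p,r}}L=-[h_r^{(p)},L].$$ 4. Along every smooth field the coefficients $\mathscr L_{p,r}$ are differentiable in the times, and if the field satisfies the Lax equations for $(p,r)$ and $(q,s)$, then $$\partial_{t^{q,s}}\mathscr L_{p,r}-\partial_{t^{p,r}}\mathscr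 L_{q,s}=0 .$$ -/

import Mathlib

open scoped Matrix.Norms.Operator PowerSeries

attribute [local instance] LieRing.ofAssociativeRing

namespace CyclotomicGaudin

/-- Complex square matrices; they carry the operator norm coming from the sup norm. -/
abbrev Mat (m : ℕ) := Matrix (Fin m) (Fin m) ℂ

/-- The index set `S = {0, 1, …, N, ∞}` of marked points. -/
inductive Pt (N : ℕ) where
  | zero : Pt N
  | pt : Fin N → Pt N
  | infty : Pt N
  deriving DecidableEq

/-- The connected matrix Lie group of a matrix Lie algebra: the group generated by the
exponentials of its elements. -/
def matrixGroup {m : ℕ} (𝔤 : LieSubalgebra ℂ (Mat m)) : Subgroup (GL (Fin m) ℂ) :=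
  Subgroup.closure {g | ∃ X ∈ 𝔤, (g : Mat m) = NormedSpace.exp X}

/-- The fixed data of the cyclotomic Gaudin model: the root of unity, the marked points, the
matrix Lie algebra `𝔤` with its automorphism `σ` (and the automorphism `σG` of the group which
integrates `σ`), and the non-dynamical element `Λ`. -/
structure GaudinData (m N T : ℕ) where
  T_pos : 0 < T
  ω : ℂ
  primitive : IsPrimitiveRoot ω T
  ζ : Fin N → ℂ
  ζ_ne_zero : ∀ r, ζ r ≠ 0
  ζ_disjoint : ∀ r s, r ≠ s → ∀ k l : ℕ, ω ^ k * ζ r ≠ ω ^ l * ζ s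
  𝔤 : LieSubalgebra ℂ (Mat m)
  trace_nondegenerate : ∀ X ∈ 𝔤, (∀ Y ∈ 𝔤, Matrix.trace (X * Y) = 0) → X = 0
  σ : 𝔤 ≃ₗ⁅ℂ⁆ 𝔤
  σ_iterate : ∀ X, σ^[T] X = X
  σ_trace : ∀ X Y : 𝔤,
    Matrix.trace ((σ X : Mat m) * (σ Y : Mat m)) = Matrix.trace ((X : Mat m) * (Y : Mat m))
  σG : matrixGroup 𝔤 →* matrixGroup 𝔤
  σG_exp : ∀ (X : 𝔤) (g : matrixGroup 𝔤), ((g : GL (Fin m) ℂ) : Mat m) = NormedSpace.exp (X : Mat m) →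
    ((σG g : GL (Fin m) ℂ) : Mat m) = NormedSpace.exp (σ X : Mat m)
  Λ₀₀ : Mat m
  Λ₀₁ : Mat m
  Λ : Fin N → Mat m
  Λinf : Mat m
  Λ₀₀_mem : ∃ h : Λ₀₀ ∈ 𝔤, (σ ⟨Λ₀₀, h⟩ : Mat m) = Λ₀₀
  Λ₀₁_mem : ∃ h : Λ₀₁ ∈ 𝔤, (σ ⟨Λ₀₁, h⟩ : Mat m) = ω⁻¹ • Λ₀₁
  Λ_mem : ∀ r, Λ r ∈ 𝔤
  Λinf_mem : ∃ h : Λinf ∈ 𝔤, (σ ⟨Λinf, h⟩ : Mat m) = ω • Λinf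

/-! ### Laurent series and rational functions with values in matrices -/

/-- Tuples of matrix-valued Laurent series, one in each local parameter
`λ₀ = λ`, `λ_r = λ - ζ_r`, `λ_∞ = 1/λ`. -/
abbrev Tuple (m N : ℕ) := Pt N → Matrix (Fin m) (Fin m) (LaurentSeries ℂ)

/-- Matrix-valued rational functions of `λ`. -/
abbrev RatMat (m : ℕ) := Matrix (Fin m) (Fin m) (RatFunc ℂ)

/-- Coefficient of the `j`-th power of the local parameter. -/
def lcoeff {m : ℕ} (X : Matrix (Fin m) (Fin m) (LaurentSeries ℂ)) (j : ℤ) : Mat m :=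
  X.map fun x => x.coeff j

/-- Coefficient of the `j`-th power of the variable in a matrix of power series. -/
noncomputable def pcoeff {m : ℕ} (X : Matrix (Fin m) (Fin m) ℂ⟦X⟧) (j : ℕ) : Mat m :=
  X.map fun x => PowerSeries.coeff j x

/-- Power series regarded as Laurent series. -/
noncomputable def toLaurent {m : ℕ} (X : Matrix (Fin m) (Fin m) ℂ⟦X⟧) :
    Matrix (Fin m) (Fin m) (LaurentSeries ℂ) :=
  X.map fun x => HahnSeries.ofPowerSeries ℤ ℂ x

/-- Value of a matrix-valued rational function at a complex number. -/
noncomputable def evalAt {m : ℕ} (z : ℂ) (f : RatMat m) : Mat m :=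
  f.map fun x => RatFunc.eval (RingHom.id ℂ) z x

namespace GaudinData

variable {m N T : ℕ} (D : GaudinData m N T)

/-- The eigenspace `𝔤^{(k)}` of `σ`, with `k` read modulo `T`. -/
def grade (k : ℤ) : Set (Mat m) :=
  {X | ∃ h : X ∈ D.𝔤, (D.σ ⟨X, h⟩ : Mat m) = D.ω ^ k • X}

open Classical in
/-- `σ^k` on matrices belonging to `𝔤` (it is only applied to these). -/
noncomputable def sigmaPow (k : ℕ) (X : Mat m) : Mat m :=
  if h : X ∈ D.𝔤 then (D.σ^[k] ⟨X, h⟩ : D.𝔤) else 0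

/-- The Laurent expansion of the function `λ` in each local parameter. -/
noncomputable def coord : Pt N → LaurentSeries ℂ
  | .zero => HahnSeries.single 1 1
  | .pt r => HahnSeries.C (D.ζ r) + HahnSeries.single 1 1
  | .infty => HahnSeries.single (-1) 1

/-- The map `ι_λ`: the tuple of Laurent expansions of a rational function at all marked points. -/
noncomputable def expand (f : RatMat m) : Tuple m N :=
  fun r => f.map fun x => RatFunc.eval HahnSeries.C (D.coord r) x

/-- The finite points of `D'`: the origin and the orbits of the `ζ_r`. -/
def finitePoles : Set ℂ := {z | z = 0 ∨ ∃ (r : Fin N) (k : ℕ), z = D.ω ^ k * D.ζ r}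

/-- `𝔤`-valued rational functions, regular outside `D'`, with `σ (f(λ)) = ω^k f(ω λ)`:
equivariant functions for `k = 0`, equivariant one-forms for `k = 1`. -/
def IsEquivariant (k : ℤ) (f : RatMat m) : Prop :=
  ∀ z, z ∉ D.finitePoles → (∀ a b, (f a b).denom.eval z ≠ 0) ∧
    ∃ h : evalAt z f ∈ D.𝔤, (D.σ ⟨evalAt z f, h⟩ : Mat m) = D.ω ^ k • evalAt (D.ω * z) f

/-- The spaces of tuples of `𝔤`-valued Laurent series whose components at the origin and at
infinity are twisted: `σ (X₀(λ₀)) = ω^k X₀(ω λ₀)` and `σ (X_∞(λ_∞)) = ω^k X_∞(ω⁻¹ λ_∞)`, written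
out on coefficients.  The value `k = 0` gives the Lie algebra, `k = 1` the model of its dual. -/
def IsLoop (k : ℤ) (X : Tuple m N) : Prop :=
  (∀ j, lcoeff (X .zero) j ∈ D.grade (k + j)) ∧
  (∀ r j, lcoeff (X (.pt r)) j ∈ D.𝔤) ∧
  (∀ j, lcoeff (X .infty) j ∈ D.grade (k - j))

/-- The subspaces of tuples of Taylor series, without constant term at infinity. -/
def IsLoopPlus (k : ℤ) (X : Tuple m N) : Prop :=
  D.IsLoop k X ∧ (∀ j < 0, lcoeff (X .zero) j = 0) ∧ (∀ r, ∀ j < 0, lcoeff (X (.pt r)) j = 0) ∧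
    (∀ j < 1, lcoeff (X .infty) j = 0)

end GaudinData

/-- The residue at a marked point of the one-form `F dλ`, with `F` a series in the local parameter;
at infinity `dλ = - λ_∞⁻² dλ_∞`. -/
def resAt {N : ℕ} : Pt N → LaurentSeries ℂ → ℂ
  | .infty, F => -F.coeff 1
  | _, F => F.coeff (-1)

/-- The weight of a marked point in the pairing: `T` at the points `ζ_r`, and `1` at the origin
and at infinity. -/
def weight {N : ℕ} (T : ℕ) : Pt N → ℂ
  | .pt _ => T
  | _ => 1

/-- The bilinear pairing `⟨Y, X⟩ = T ∑_r Res_{λ_r = 0} Tr (Y_r X_r) dλ`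
`+ ∑_{r = 0, ∞} Res_{λ_r = 0} Tr (Y_r X_r) dλ` between the dual model and the Lie algebra. -/
noncomputable def pairing {m N : ℕ} (T : ℕ) (Y X : Tuple m N) : ℂ :=
  T * ∑ r : Fin N, resAt (.pt r) (Matrix.trace (Y (.pt r) * X (.pt r)))
    + resAt (N := N) .zero (Matrix.trace (Y .zero * X .zero))
    + resAt (N := N) .infty (Matrix.trace (Y .infty * X .infty))

namespace GaudinData

variable {m N T : ℕ} (D : GaudinData m N T)

/-- The invariant functions `H_{p,r}(Y) = Res_{λ_r = 0} (ℓ_{p,r} Tr (Y_r^{p+1})) dλ`, where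
`ℓ_{p,r}` is the expansion of `λ^p/(p+1)` at the origin and at infinity, and of `T λ^p/(p+1)` at
the points `ζ_r`. -/
noncomputable def hamiltonian (p : ℕ) (r : Pt N) (Y : Tuple m N) : ℂ :=
  resAt r (HahnSeries.C (weight T r / (p + 1)) * D.coord r ^ p * Matrix.trace (Y r ^ (p + 1)))

/-- `X` is the gradient of `H` at `Y` with respect to the pairing. -/
def IsGradient (H : Tuple m N → ℂ) (Y X : Tuple m N) : Prop :=
  D.IsLoop 0 X ∧ ∀ η, D.IsLoop 1 η →
    HasDerivAt (fun ε : ℂ => H (Y + ε • η)) (pairing T η X) 0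

/-- `g` is the equivariant one-form whose expansion is the projection of `Y` onto the expansions
of equivariant one-forms along the positive part. -/
def IsMinusPart (Y : Tuple m N) (g : RatMat m) : Prop :=
  D.IsEquivariant 1 g ∧ D.IsLoopPlus 1 (Y - D.expand g)

/-- The rational function with the pole structure of the Lax matrix:
`B₀/λ + B₁/λ² + (1/T) ∑_r ∑_k σ^k B_r / (λ - ω^k ζ_r) + B_∞`. -/
noncomputable def ratLax (B₀ B₁ : Mat m) (B : Fin N → Mat m) (Binf : Mat m) : RatMat m :=
  (RatFunc.X : RatFunc ℂ)⁻¹ • B₀.map RatFunc.C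
    + ((RatFunc.X : RatFunc ℂ) ^ 2)⁻¹ • B₁.map RatFunc.C
    + RatFunc.C (1 / (T : ℂ)) • ∑ r : Fin N, ∑ k ∈ Finset.range T,
        (RatFunc.X - RatFunc.C (D.ω ^ k * D.ζ r))⁻¹ • (D.sigmaPow k (B r)).map RatFunc.C
    + Binf.map RatFunc.C

/-- The non-dynamical element `Λ(λ)`. -/
noncomputable def ratLambda : RatMat m := D.ratLax D.Λ₀₀ D.Λ₀₁ D.Λ D.Λinf

end GaudinData

/-! ### The fields, the Lax matrix and the Lagrangian coefficients -/

/-- The field components `(φ_s)_{1 ≤ s ≤ N}`, `φ₀^{(0)}`, `φ₀^{(1)}`. -/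
abbrev Config (m N : ℕ) := (Fin N → Mat m) × Mat m × Mat m

namespace GaudinData

variable {m N T : ℕ} (D : GaudinData m N T)

/-- Admissible field values: `φ_s ∈ G`, `φ₀^{(0)} ∈ G` fixed by `σ`, and
`φ₀^{(1)} (φ₀^{(0)})⁻¹ ∈ 𝔤^{(1)}` (that is, `σ φ₀^{(1)} = ω φ₀^{(1)}`). -/
def IsConfig (q : Config m N) : Prop :=
  (∀ s, ∃ g : matrixGroup D.𝔤, ((g : GL (Fin m) ℂ) : Mat m) = q.1 s) ∧
  (∃ g : matrixGroup D.𝔤, D.σG g = g ∧ ((g : GL (Fin m) ℂ) : Mat m) = q.2.1) ∧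
  q.2.2 * q.2.1⁻¹ ∈ D.grade 1

/-- Tangent vectors at `q` to the manifold of admissible field values; the last condition is
that the derivative of `φ₀^{(1)} (φ₀^{(0)})⁻¹` belongs to `𝔤^{(1)}`. -/
def IsTangent (q v : Config m N) : Prop :=
  (∀ s, v.1 s * (q.1 s)⁻¹ ∈ D.𝔤) ∧
  v.2.1 * q.2.1⁻¹ ∈ D.grade 0 ∧
  v.2.2 * q.2.1⁻¹ - q.2.2 * q.2.1⁻¹ * v.2.1 * q.2.1⁻¹ ∈ D.grade 1

/-- Smooth maps on an open set with values in the manifold of admissible field values. -/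
def IsSmoothField {E : Type} [NormedAddCommGroup E] [NormedSpace ℝ E] (U : Set E)
    (φ : E → Config m N) : Prop :=
  ContDiffOn ℝ ((⊤ : ℕ∞) : WithTop ℕ∞) φ U ∧ ∀ x ∈ U, D.IsConfig (φ x) ∧ ∀ w, D.IsTangent (φ x) (fderiv ℝ φ x w)

/-- `A₀^{(1)}`. -/
noncomputable def A₀₁ (q : Config m N) : Mat m := q.2.1 * D.Λ₀₁ * q.2.1⁻¹

/-- `A₀^{(0)}`. -/
noncomputable def A₀₀ (q : Config m N) : Mat m :=
  q.2.1 * D.Λ₀₀ * q.2.1⁻¹ + ⁅q.2.2 * q.2.1⁻¹, q.2.1 * D.Λ₀₁ * q.2.1⁻¹⁆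

/-- `A_s`. -/
noncomputable def A (q : Config m N) (s : Fin N) : Mat m := q.1 s * D.Λ s * (q.1 s)⁻¹

/-- The Lax matrix `L(λ)`. -/
noncomputable def lax (q : Config m N) : RatMat m :=
  D.ratLax (D.A₀₀ q) (D.A₀₁ q) (D.A q) D.Λinf

end GaudinData

/-- The partial derivative with respect to the time labelled by `i`. -/
noncomputable def pd {N : ℕ} {I : Finset (ℕ × Pt N)} {V : Type} [NormedAddCommGroup V]
    [NormedSpace ℝ V] (i : I) (F : (I → ℝ) → V) (t : I → ℝ) : V :=
  fderiv ℝ F t (Pi.single i 1)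

/-- The collection of all first time derivatives of a field. -/
noncomputable def jet {m N : ℕ} {I : Finset (ℕ × Pt N)} (φ : (I → ℝ) → Config m N) (t : I → ℝ) :
    I → Config m N :=
  fun j => pd j φ t

namespace GaudinData

variable {m N T : ℕ} (D : GaudinData m N T) {I : Finset (ℕ × Pt N)}

/-- The Lagrangian coefficient `ℒ_{p,r}`, for `i = (p, r)`, as a function of the field `q` and of
its velocities `v j = ∂_{t^j} q`. -/
noncomputable def lagrangian (i : I) (q : Config m N) (v : I → Config m N) : ℂ :=
  ∑ s : Fin N, Matrix.trace (D.A q s * ((v i).1 s * (q.1 s)⁻¹))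
    + Matrix.trace (D.A₀₀ q * ((v i).2.1 * q.2.1⁻¹))
    - D.hamiltonian i.1.1 i.1.2 (D.expand (D.lax q))

/-- The derivative `∂ℒ_i / ∂q_{t^j}` at `(q, v)`, applied to `w`. -/
noncomputable def velocityDeriv (i j : I) (q : Config m N) (v : I → Config m N)
    (w : Config m N) : ℂ :=
  fderiv ℝ (fun v' => D.lagrangian i q v') v (Pi.single j w)

/-- The corner equations of the multitime Euler–Lagrange equations, off shell: `ℒ_i` does not
depend on the velocities `q_{t^j}` with `j ≠ i`, and the momenta `∂ℒ_i / ∂q_{t^i}` coincide. -/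
def CornerEquations (I : Finset (ℕ × Pt N)) : Prop :=
  ∀ q, D.IsConfig q → ∀ v : I → Config m N, (∀ j, D.IsTangent q (v j)) →
    (∀ i : I, DifferentiableAt ℝ (fun v' => D.lagrangian i q v') v) ∧
    (∀ i j : I, i ≠ j → ∀ w, D.IsTangent q w → D.velocityDeriv i j q v w = 0) ∧
    (∀ i j : I, ∀ w, D.IsTangent q w → D.velocityDeriv i i q v w = D.velocityDeriv j j q v w)

/-- The standard Euler–Lagrange equation of `ℒ_i` for the field `φ` on `U`,
`∂ℒ_i/∂q - ∂_{t^i} (∂ℒ_i/∂q_{t^i}) = 0`, contracted with every infinitesimal variation `δφ`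
within the manifold of admissible values:
`δℒ_i - ∂_{t^i} ((∂ℒ_i/∂q_{t^i}) · δφ) = 0`. -/
def EulerLagrange (i : I) (U : Set (I → ℝ)) (φ : (I → ℝ) → Config m N) : Prop :=
  ∀ Φ : ℝ × (I → ℝ) → Config m N, D.IsSmoothField (Set.univ ×ˢ U) Φ →
    (∀ t ∈ U, Φ (0, t) = φ t) → ∀ t ∈ U,
      deriv (fun ε : ℝ => D.lagrangian i (Φ (ε, t)) (jet (fun t' => Φ (ε, t')) t)) 0
        = pd i (fun t' => D.velocityDeriv i i (φ t') (jet φ t')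
            (deriv (fun ε : ℝ => Φ (ε, t')) 0)) t

/-- `h` is the equivariant function in the decomposition `∇H_{p,r}(ι_λ L) = N + ι_λ h` of the
gradient into a tuple of Taylor series and the expansion of an equivariant function. -/
def IsLaxGenerator (p : ℕ) (r : Pt N) (q : Config m N) (h : RatMat m) : Prop :=
  D.IsEquivariant 0 h ∧ ∃ X, D.IsGradient (D.hamiltonian p r) (D.expand (D.lax q)) X ∧
    D.IsLoopPlus 0 (X - D.expand h)

/-- The Lax equation `∂_{t^{p,r}} L = -[h, L]` for the field `φ` on `U`, as an identity of rational
functions of `λ`, expressed at every `λ = z` away from the poles. -/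
def LaxEquation (i : I) (U : Set (I → ℝ)) (φ : (I → ℝ) → Config m N) : Prop :=
  ∀ t ∈ U, ∃ h, D.IsLaxGenerator i.1.1 i.1.2 (φ t) h ∧ ∀ z, z ∉ D.finitePoles →
    pd i (fun t' => evalAt z (D.lax (φ t'))) t = -⁅evalAt z h, evalAt z (D.lax (φ t))⁆

end GaudinData

/-! ### The loop group and the geometric Lagrangian one-form -/

/-- Tuples of Taylor series in the local parameters. -/
abbrev TaylorTuple (m N : ℕ) := Pt N → Matrix (Fin m) (Fin m) ℂ⟦X⟧

/-- The logarithmic derivative `φ'(x) φ(x)⁻¹` of a matrix-valued Taylor series. -/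
noncomputable def loopLogDeriv {m : ℕ} (φ : Matrix (Fin m) (Fin m) ℂ⟦X⟧) :
    Matrix (Fin m) (Fin m) ℂ⟦X⟧ :=
  (φ.map fun x => PowerSeries.derivative ℂ x) * φ⁻¹

/-- The coadjoint action by componentwise conjugation. -/
noncomputable def coadjoint {m N : ℕ} (φ : TaylorTuple m N) (Y : Tuple m N) : Tuple m N :=
  fun r => toLaurent (φ r) * Y r * toLaurent (φ r)⁻¹

/-- The components of `φ₊` that enter the Lax matrix. -/
noncomputable def components {m N : ℕ} (φ : TaylorTuple m N) : Config m N :=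
  (fun s => pcoeff (φ (.pt s)) 0, pcoeff (φ .zero) 0, pcoeff (φ .zero) 1)

/-- The tuple `∂_{t^i} φ₊ φ₊⁻¹`, the time derivative being taken coefficient by coefficient. -/
noncomputable def rightVelocity {m N : ℕ} {I : Finset (ℕ × Pt N)} (i : I)
    (φ : (I → ℝ) → TaylorTuple m N) (t : I → ℝ) : Tuple m N :=
  fun r => toLaurent
    ((Matrix.of fun a b => PowerSeries.mk fun k =>
      pd i (fun t' => PowerSeries.coeff k (φ t' r a b)) t) * (φ t r)⁻¹)

namespace GaudinData

variable {m N T : ℕ} (D : GaudinData m N T) {I : Finset (ℕ × Pt N)}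

/-- The group of the Lie algebra of tuples of Taylor series: tuples of `G`-valued Taylor series
(the constant term lies in `G` and the logarithmic derivative is `𝔤`-valued), with
`σ (φ₀(λ₀)) = φ₀(ω λ₀)` at the origin, `σ (φ_∞(λ_∞)) = φ_∞(ω⁻¹ λ_∞)` and constant term `1` at
infinity.  The two equivariance conditions are expressed through the constant term and the
logarithmic derivative. -/
def IsLoopGroupPlus (φ : TaylorTuple m N) : Prop :=
  ((∃ g : matrixGroup D.𝔤, D.σG g = g ∧ ((g : GL (Fin m) ℂ) : Mat m) = pcoeff (φ .zero) 0) ∧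
    ∀ j : ℕ, pcoeff (loopLogDeriv (φ .zero)) j ∈ D.grade (j + 1)) ∧
  (∀ r, (∃ g : matrixGroup D.𝔤, ((g : GL (Fin m) ℂ) : Mat m) = pcoeff (φ (.pt r)) 0) ∧
    ∀ j : ℕ, pcoeff (loopLogDeriv (φ (.pt r))) j ∈ D.𝔤) ∧
  (pcoeff (φ .infty) 0 = 1 ∧ ∀ j : ℕ, pcoeff (loopLogDeriv (φ .infty)) j ∈ D.grade (-(j + 1)))

/-- The coefficient `⟨ι_λ L, ∂_{t^i} φ ·_R φ⁻¹⟩ - H_i(ι_λ L)` of the geometric Lagrangian one-form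
of the coadjoint orbit of `Λ`.  The argument `f` is the component of the velocity along the
expansions of equivariant functions. -/
noncomputable def geometricLagrangian (i : I) (φ : (I → ℝ) → TaylorTuple m N) (f : RatMat m)
    (t : I → ℝ) (L : RatMat m) : ℂ :=
  pairing T (D.expand L) (rightVelocity i φ t + D.expand f)
    - D.hamiltonian i.1.1 i.1.2 (D.expand L)

end GaudinData

end CyclotomicGaudin

open CyclotomicGaudin

namespace CyclotomicGaudin

/-! ### Coefficients of matrices of Laurent series -/

/-! The dynamics lives on the residues `(A₀₀, A₀₁, A_s)` of the Lax matrix. A field enters the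
kinetic part of the Lagrangian coefficients through the one-form θ = ∑ Tr(A_s dφ_s φ_s⁻¹) + Tr(A₀₀
dφ₀ φ₀⁻¹), the same for every time, so that ℒ_{p,r} = θ(∂_{p,r}) - H_{p,r}. This gives the corner
equations at once.

The velocity of a field defines an element of a truncated Lie algebra, `angular`, and the residues
move by its coadjoint action `lieRes` (`fderiv_residues`). By the Maurer–Cartan equation dθ is the
Kirillov–Kostant form on residues (`exterior_momentum`). Hence the Euler–Lagrange expression of
ℒ_{p,r}, contracted with a variation, is the pairing of that variation with the defect ∂B - ad*_N B,
where N = ∇H - ι h is the Taylor part of the gradient (`eulerLagrange_at`). Every truncated element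
is realised by a variation (`exists_variation`) and the pairing is nondegenerate
(`IsResidues.eq_zero`), so Euler–Lagrange means ∂B = ad*_N B.

This agrees with the Lax equation for two reasons. The gradient of an invariant function commutes
with L, so -[h, L] and [N, L] have the same expansion; and an equivariant rational function is
determined by its polar parts (`IsEquivariant.eq_zero`), so it suffices to compare residues
(`lax_iff_lieRes`).

Closure: on solutions dθ(∂_j, ∂_i) equals ∂_j H_i, and ∂_j H_i = ⟨[N_j, L], ∇H_i⟩ = ⟨N_j, [L, ∇H_i]⟩
= 0, so every term vanishes.

For the orbit statements, conjugation by a Taylor loop preserves the twisted loop spaces because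
φBφ⁻¹ solves a formal linear differential equation with coefficients in the right eigenspaces.
Reading off the lowest coefficients gives L. In the geometric Lagrangian the u₋ term drops by the
residue theorem (`pairing_expand_expand`), and what exceeds ℒ_{p,r} is the differential of
`potential`, built from the first-order coefficients at 0 and ∞. -/

abbrev LMat (m : ℕ) := Matrix (Fin m) (Fin m) (LaurentSeries ℂ)

/-- Replaces the sum over pairs of support points by a sum over an integer interval depending only
on lower bounds of the supports. All later coefficient computations use this form. -/
theorem coeff_mul_of_bdd (x y : LaurentSeries ℂ) {a b : ℤ} (hx : ∀ j < a, x.coeff j = 0)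
    (hy : ∀ j < b, y.coeff j = 0) (n : ℤ) :
    (x * y).coeff n = ∑ i ∈ Finset.Icc a (n - b), x.coeff i * y.coeff (n - i) := by
  rw [HahnSeries.coeff_mul]
  have h1 : ∑ ij ∈ Finset.antidiagonal x.isPWO_support y.isPWO_support n,
      x.coeff ij.1 * y.coeff ij.2 =
      ∑ i ∈ (Finset.antidiagonal x.isPWO_support y.isPWO_support n).image Prod.fst,
        x.coeff i * y.coeff (n - i) := by
    rw [Finset.sum_image]
    · refine Finset.sum_congr rfl fun ij hij => ?_
      rw [Finset.mem_antidiagonal] at hij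
      rw [← hij.2.2, add_sub_cancel_left]
    · intro u hu v hv huv
      simp only [Finset.mem_coe, Finset.mem_antidiagonal] at hu hv
      ext
      · exact huv
      · have := hu.2.2.trans hv.2.2.symm
        rw [huv] at this
        exact add_left_cancel this
  rw [h1]
  refine Finset.sum_subset ?_ ?_
  · intro i hi
    simp only [Finset.mem_image, Finset.mem_antidiagonal, HahnSeries.mem_support] at hi
    obtain ⟨⟨u, v⟩, ⟨hu, hv, huv⟩, rfl⟩ := hi
    simp only [Finset.mem_Icc]
    simp only at hu hv huv
    constructor
    · by_contra h
      exact hu (hx _ (not_le.1 h))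
    · have : b ≤ v := by
        by_contra h
        exact hv (hy _ (not_le.1 h))
      omega
  · intro i _ hi
    by_contra h
    apply hi
    simp only [Finset.mem_image, Finset.mem_antidiagonal, HahnSeries.mem_support]
    exact ⟨(i, n - i), ⟨left_ne_zero_of_mul h, right_ne_zero_of_mul h, by simp⟩, rfl⟩

theorem coeff_sum' {ι : Type*} (s : Finset ι) (f : ι → LaurentSeries ℂ) (j : ℤ) :
    (∑ i ∈ s, f i).coeff j = ∑ i ∈ s, (f i).coeff j :=
  map_sum (HahnSeries.coeff.linearMap (Γ := ℤ) (V := ℂ) (R := ℂ) j) f s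

theorem exists_coeff_eq_zero_of_lt (x : LaurentSeries ℂ) : ∃ a : ℤ, ∀ j < a, x.coeff j = 0 :=
  ⟨x.order, fun _ hj => HahnSeries.coeff_eq_zero_of_lt_order hj⟩

section lcoeff

variable {m : ℕ}

@[simp] theorem lcoeff_apply (X : LMat m) (j : ℤ) (a b) : lcoeff X j a b = (X a b).coeff j := rfl

@[simp] theorem lcoeff_zero (j : ℤ) : lcoeff (0 : LMat m) j = 0 := by ext; simp
@[simp] theorem lcoeff_add (X Y : LMat m) (j : ℤ) : lcoeff (X + Y) j = lcoeff X j + lcoeff Y j := by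
  ext; simp
@[simp] theorem lcoeff_sub (X Y : LMat m) (j : ℤ) : lcoeff (X - Y) j = lcoeff X j - lcoeff Y j := by
  ext; simp
@[simp] theorem lcoeff_sum {ι : Type*} (s : Finset ι) (X : ι → LMat m) (j : ℤ) :
    lcoeff (∑ i ∈ s, X i) j = ∑ i ∈ s, lcoeff (X i) j := by
  ext; simp [Matrix.sum_apply]

theorem lcoeff_ext {X Y : LMat m} (h : ∀ j, lcoeff X j = lcoeff Y j) : X = Y := by
  ext a b j
  exact congr_fun (congr_fun (h j) a) b

theorem exists_lcoeff_eq_zero (X : LMat m) : ∃ a : ℤ, ∀ j < a, lcoeff X j = 0 := by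
  choose f hf using fun p : Fin m × Fin m => exists_coeff_eq_zero_of_lt (X p.1 p.2)
  obtain ⟨a, ha⟩ := (Set.finite_range f).bddBelow
  refine ⟨a, fun j hj => ?_⟩
  ext u v
  exact hf (u, v) j (hj.trans_le (ha ⟨(u, v), rfl⟩))

theorem lcoeff_mul {X Y : LMat m} {a b : ℤ} (hX : ∀ j < a, lcoeff X j = 0)
    (hY : ∀ j < b, lcoeff Y j = 0) (n : ℤ) :
    lcoeff (X * Y) n = ∑ i ∈ Finset.Icc a (n - b), lcoeff X i * lcoeff Y (n - i) := by
  ext u v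
  simp only [lcoeff_apply, Matrix.mul_apply, coeff_sum', Matrix.sum_apply]
  rw [Finset.sum_comm]
  refine Finset.sum_congr rfl fun k _ => ?_
  exact coeff_mul_of_bdd _ _ (fun j hj => congr_fun (congr_fun (hX j hj) u) k)
    (fun j hj => congr_fun (congr_fun (hY j hj) k) v) n

theorem lcoeff_lie {X Y : LMat m} {a b : ℤ} (hX : ∀ j < a, lcoeff X j = 0)
    (hY : ∀ j < b, lcoeff Y j = 0) (n : ℤ) :
    lcoeff (X * Y - Y * X) n = ∑ i ∈ Finset.Icc a (n - b), ⁅lcoeff X i, lcoeff Y (n - i)⁆ := by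
  rw [lcoeff_sub, lcoeff_mul hX hY, lcoeff_mul hY hX]
  simp only [Ring.lie_def, Finset.sum_sub_distrib]
  congr 1
  -- The reflection i ↦ n - i carries the summation range of `Y * X` onto that of `X * Y`.
  refine Finset.sum_nbij' (fun i => n - i) (fun i => n - i) ?_ ?_ ?_ ?_ ?_ <;>
    simp <;> intros <;> omega

theorem coeff_trace (X : LMat m) (j : ℤ) :
    (Matrix.trace X).coeff j = Matrix.trace (lcoeff X j) := by
  simp [Matrix.trace]

/-- The Laurent series with given coefficients. -/
noncomputable def ofCoeff (c : ℤ → Mat m) (hc : ∃ a, ∀ j < a, c j = 0) : LMat m :=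
  Matrix.of fun u v => HahnSeries.ofSuppBddBelow (fun j => c j u v) (by
    obtain ⟨a, ha⟩ := hc
    refine ⟨a, fun j hj => ?_⟩
    by_contra h
    exact hj (by simp [ha j (not_le.1 h)]))

@[simp] theorem lcoeff_ofCoeff (c : ℤ → Mat m) (hc) (j : ℤ) : lcoeff (ofCoeff c hc) j = c j := by
  ext u v
  simp [ofCoeff]

/-- The monomial `B xʲ`. -/
noncomputable def lmono (j : ℤ) (B : Mat m) : LMat m := B.map (HahnSeries.single j)

theorem lcoeff_lmono (j i : ℤ) (B : Mat m) : lcoeff (lmono j B) i = if i = j then B else 0 := by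
  ext u v
  simp [lmono, HahnSeries.coeff_single]
  split_ifs <;> simp

theorem lcoeff_mul_lmono (X : LMat m) (j n : ℤ) (B : Mat m) :
    lcoeff (X * lmono j B) n = lcoeff X (n - j) * B := by
  ext u v
  simp only [lcoeff_apply, Matrix.mul_apply, coeff_sum', lmono, Matrix.map_apply]
  refine Finset.sum_congr rfl fun k _ => ?_
  have := HahnSeries.coeff_mul_single_add (r := B k v) (x := X u k) (a := n - j) (b := j)
  rwa [sub_add_cancel] at this

theorem lcoeff_toLaurent_nat (X : Matrix (Fin m) (Fin m) ℂ⟦X⟧) (j : ℕ) :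
    lcoeff (toLaurent X) j = pcoeff X j := by
  ext u v
  simp [toLaurent, pcoeff]

theorem lcoeff_toLaurent_neg (X : Matrix (Fin m) (Fin m) ℂ⟦X⟧) {j : ℤ} (hj : j < 0) :
    lcoeff (toLaurent X) j = 0 := by
  ext u v
  simp only [toLaurent, lcoeff_apply, Matrix.map_apply, Matrix.zero_apply]
  have := PowerSeries.coeff_coe (R := ℂ) (X u v) j
  rw [if_pos hj] at this
  exact this

theorem toLaurent_mul (X Y : Matrix (Fin m) (Fin m) ℂ⟦X⟧) :
    toLaurent (X * Y) = toLaurent X * toLaurent Y := by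
  simp only [toLaurent]
  exact Matrix.map_mul (f := (HahnSeries.ofPowerSeries ℤ ℂ))

theorem toLaurent_one : toLaurent (1 : Matrix (Fin m) (Fin m) ℂ⟦X⟧) = 1 := by
  simp only [toLaurent]
  exact Matrix.map_one _ (map_zero _) (map_one _)

theorem eq_zero_of_lcoeff {X : LMat m} (h : ∀ j, lcoeff X j = 0) : X = 0 :=
  lcoeff_ext fun j => by rw [h j, lcoeff_zero]

end lcoeff

/-- The automorphism `x ↦ c x` of the field of Laurent series. -/
noncomputable def rescale (c : ℂ) (hc : c ≠ 0) : LaurentSeries ℂ →+* LaurentSeries ℂ where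
  toFun x := HahnSeries.ofSuppBddBelow (fun j => c ^ j * x.coeff j) (by
    obtain ⟨a, ha⟩ := exists_coeff_eq_zero_of_lt x
    refine ⟨a, fun j hj => ?_⟩
    by_contra h
    exact hj (by simp [ha j (not_le.1 h)]))
  map_zero' := by ext; simp
  map_one' := by
    ext j
    simp only [HahnSeries.coeff_ofSuppBddBelow, HahnSeries.coeff_one]
    split_ifs with h <;> simp [h]
  map_add' x y := by ext; simp [mul_add]
  map_mul' x y := by
    ext n
    obtain ⟨a, ha⟩ := exists_coeff_eq_zero_of_lt x
    obtain ⟨b, hb⟩ := exists_coeff_eq_zero_of_lt y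
    rw [coeff_mul_of_bdd (a := a) (b := b) _ _ (fun j hj => by simp [ha j hj])
      (fun j hj => by simp [hb j hj])]
    simp only [HahnSeries.coeff_ofSuppBddBelow]
    rw [coeff_mul_of_bdd x y ha hb, Finset.mul_sum]
    refine Finset.sum_congr rfl fun i _ => ?_
    have : c ^ n = c ^ i * c ^ (n - i) := by rw [← zpow_add₀ hc]; simp
    rw [this]; ring

theorem coeff_rescale (c : ℂ) (hc : c ≠ 0) (x : LaurentSeries ℂ) (j : ℤ) :
    (rescale c hc x).coeff j = c ^ j * x.coeff j := by
  simp [rescale]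

/-! ### Evaluation of rational functions -/

section Vanish

/-- The coefficients below `k` vanish. -/
def VanishBelow (k : ℤ) (x : LaurentSeries ℂ) : Prop := ∀ j < k, x.coeff j = 0

theorem VanishBelow.mul {k l : ℤ} {x y : LaurentSeries ℂ} (hx : VanishBelow k x)
    (hy : VanishBelow l y) : VanishBelow (k + l) (x * y) := fun j hj => by
  rw [coeff_mul_of_bdd x y hx hy, Finset.Icc_eq_empty (by omega), Finset.sum_empty]

theorem VanishBelow.coeff_mul {k l : ℤ} {x y : LaurentSeries ℂ} (hx : VanishBelow k x)
    (hy : VanishBelow l y) : (x * y).coeff (k + l) = x.coeff k * y.coeff l := by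
  rw [coeff_mul_of_bdd x y hx hy]
  simp

theorem vanishBelow_one : VanishBelow 0 (1 : LaurentSeries ℂ) := fun j hj => by
  rw [HahnSeries.coeff_one, if_neg hj.ne]

theorem VanishBelow.pow {k : ℤ} {x : LaurentSeries ℂ} (hx : VanishBelow k x) (n : ℕ) :
    VanishBelow (n * k) (x ^ n) := by
  induction n with
  | zero => simpa using vanishBelow_one
  | succ n ih =>
    rw [pow_succ]
    convert ih.mul hx using 1
    push_cast; ring

theorem vanishBelow_ofPowerSeries (p : ℂ⟦X⟧) : VanishBelow 0 (HahnSeries.ofPowerSeries ℤ ℂ p) :=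
  fun j hj => by
    have := PowerSeries.coeff_coe (R := ℂ) p j
    rwa [if_pos hj] at this

theorem coeff_zero_ofPowerSeries (p : ℂ⟦X⟧) :
    (HahnSeries.ofPowerSeries ℤ ℂ p).coeff 0 = PowerSeries.constantCoeff p := by
  have := PowerSeries.coeff_coe (R := ℂ) p 0
  simpa using this

end Vanish

/-! ### Evaluation at a transcendental element. -/

section Eval

open Polynomial

variable {K : Type} [Field K]

/-- Evaluation of rational functions at a transcendental element. -/
noncomputable def evHom (i : ℂ →+* K) (x : K) (hx : ∀ p : ℂ[X], p ≠ 0 → p.eval₂ i x ≠ 0) :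
    RatFunc ℂ →+* K :=
  RatFunc.liftRingHom (Polynomial.eval₂RingHom i x) (by
    intro p hp
    rw [Submonoid.mem_comap]
    exact mem_nonZeroDivisors_of_ne_zero (hx p (nonZeroDivisors.ne_zero hp)))

variable (i : ℂ →+* K) (x : K) (hx : ∀ p : ℂ[X], p ≠ 0 → p.eval₂ i x ≠ 0)

theorem evHom_algebraMap (p : ℂ[X]) :
    evHom i x hx (algebraMap ℂ[X] (RatFunc ℂ) p) = p.eval₂ i x := by
  rw [evHom, RatFunc.liftRingHom_algebraMap]
  rfl

theorem evHom_apply (f : RatFunc ℂ) : evHom i x hx f = RatFunc.eval i x f := by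
  conv_lhs => rw [← RatFunc.num_div_denom f]
  rw [map_div₀, evHom_algebraMap, evHom_algebraMap]
  rfl

@[simp] theorem evHom_C (c : ℂ) : evHom i x hx (RatFunc.C c) = i c := by
  rw [evHom_apply, RatFunc.eval_C]

@[simp] theorem evHom_X : evHom i x hx RatFunc.X = x := by
  rw [evHom_apply, RatFunc.eval_X]

/-- Used to identify the expansion of f(ωλ) with the rescaled expansion of f by checking constants
and λ only. -/
theorem ratFunc_hom_ext {f g : RatFunc ℂ →+* K} (hC : ∀ c, f (RatFunc.C c) = g (RatFunc.C c))
    (hX : f RatFunc.X = g RatFunc.X) : f = g := by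
  have h : f.comp (algebraMap ℂ[X] (RatFunc ℂ)) = g.comp (algebraMap ℂ[X] (RatFunc ℂ)) := by
    refine Polynomial.ringHom_ext (fun c => ?_) ?_
    · simpa using hC c
    · simpa using hX
  ext r
  have h' : ∀ p, f (algebraMap ℂ[X] (RatFunc ℂ) p) = g (algebraMap ℂ[X] (RatFunc ℂ) p) :=
    fun p => RingHom.congr_fun h p
  rw [← RatFunc.num_div_denom r, map_div₀, map_div₀, h', h']

/-- For a ≠ 0 distinct powers of the monomial lie in distinct degrees, so no coefficients of the
polynomial mix. The cases a = 1 and a = -1 serve the origin and infinity. -/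
theorem coeff_eval₂_single {a : ℤ} (ha : a ≠ 0) (p : ℂ[X]) (n : ℕ) :
    (p.eval₂ (HahnSeries.C (Γ := ℤ)) (HahnSeries.single a (1 : ℂ))).coeff (n * a) = p.coeff n := by
  rw [Polynomial.eval₂_eq_sum_range, HahnSeries.coeff_sum]
  have : ∀ k, ((HahnSeries.C (Γ := ℤ)) (p.coeff k) * HahnSeries.single a (1 : ℂ) ^ k).coeff (n * a)
      = if n = k then p.coeff k else 0 := by
    intro k
    rw [HahnSeries.single_pow, HahnSeries.C_mul_eq_smul, HahnSeries.coeff_smul,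
      HahnSeries.coeff_single]
    simp [ha]
  simp_rw [this]
  simp
  intro h
  exact (Polynomial.coeff_eq_zero_of_natDegree_lt (by omega)).symm

theorem eval₂_single_ne_zero {a : ℤ} (ha : a ≠ 0) (p : ℂ[X]) (hp : p ≠ 0) :
    p.eval₂ (HahnSeries.C (Γ := ℤ)) (HahnSeries.single a (1 : ℂ)) ≠ 0 := by
  intro h
  apply hp
  ext n
  rw [← coeff_eval₂_single ha, h]
  simp

theorem eval₂_C_add_single_ne_zero (c : ℂ) (p : ℂ[X]) (hp : p ≠ 0) :
    p.eval₂ (HahnSeries.C (Γ := ℤ)) (HahnSeries.C c + HahnSeries.single 1 (1 : ℂ)) ≠ 0 := by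
  have : p.eval₂ (HahnSeries.C (Γ := ℤ)) (HahnSeries.C c + HahnSeries.single 1 (1 : ℂ)) =
      (p.comp (Polynomial.C c + Polynomial.X)).eval₂ (HahnSeries.C (Γ := ℤ))
        (HahnSeries.single 1 (1 : ℂ)) := by
    rw [Polynomial.eval₂_comp]
    simp
  rw [this]
  apply eval₂_single_ne_zero one_ne_zero
  intro h
  rw [Polynomial.comp_eq_zero_iff] at h
  rcases h with h | ⟨_, h⟩
  · exact hp h
  · have := congr_arg (fun q => Polynomial.coeff q 1) h
    simp [Polynomial.coeff_C] at this

end Eval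

/-! ### Regularity and values of rational functions at a point. -/

section Reg

open Polynomial

/-- Regularity of a rational function at a point. -/
def Reg (z : ℂ) (f : RatFunc ℂ) : Prop := f.denom.eval z ≠ 0

/-- Value of a rational function at a point. -/
noncomputable def ev (z : ℂ) (f : RatFunc ℂ) : ℂ := RatFunc.eval (RingHom.id ℂ) z f

variable {z : ℂ} {f g : RatFunc ℂ}

theorem ev_eq (z : ℂ) (f : RatFunc ℂ) : ev z f = f.num.eval z / f.denom.eval z := rfl

theorem Reg.of_dvd {q : ℂ[X]} (h : f.denom ∣ q) (hq : q.eval z ≠ 0) : Reg z f := by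
  intro h0
  obtain ⟨r, rfl⟩ := h
  apply hq
  rw [eval_mul, h0, zero_mul]

theorem Reg.add (hf : Reg z f) (hg : Reg z g) : Reg z (f + g) :=
  Reg.of_dvd (RatFunc.denom_add_dvd f g) (by rw [eval_mul]; exact mul_ne_zero hf hg)

theorem Reg.mul (hf : Reg z f) (hg : Reg z g) : Reg z (f * g) :=
  Reg.of_dvd (RatFunc.denom_mul_dvd f g) (by rw [eval_mul]; exact mul_ne_zero hf hg)

theorem reg_algebraMap (z : ℂ) (p : ℂ[X]) : Reg z (algebraMap ℂ[X] (RatFunc ℂ) p) := by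
  simp [Reg]

theorem reg_C (z c : ℂ) : Reg z (RatFunc.C c) := by simp [Reg]
theorem reg_X (z : ℂ) : Reg z RatFunc.X := by simp [Reg]
theorem reg_zero (z : ℂ) : Reg z 0 := by simp [Reg]
theorem reg_one (z : ℂ) : Reg z 1 := by simp [Reg]

theorem Reg.neg (hf : Reg z f) : Reg z (-f) := by
  have := (reg_C z (-1)).mul hf
  simpa using this

theorem Reg.sub (hf : Reg z f) (hg : Reg z g) : Reg z (f - g) := by
  rw [sub_eq_add_neg]; exact hf.add hg.neg

theorem Reg.pow (hf : Reg z f) (n : ℕ) : Reg z (f ^ n) := by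
  induction n with
  | zero => simpa using reg_one z
  | succ n ih => rw [pow_succ]; exact ih.mul hf

theorem Reg.sum {ι : Type*} (s : Finset ι) {f : ι → RatFunc ℂ} (hf : ∀ i ∈ s, Reg z (f i)) :
    Reg z (∑ i ∈ s, f i) := by
  classical
  induction s using Finset.induction_on with
  | empty => simpa using reg_zero z
  | insert a s ha ih =>
    rw [Finset.sum_insert ha]
    exact (hf _ (by simp)).add (ih fun i hi => hf i (by simp [hi]))

theorem reg_inv_algebraMap {p : ℂ[X]} (hp : p.eval z ≠ 0) :
    Reg z (algebraMap ℂ[X] (RatFunc ℂ) p)⁻¹ := by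
  have := RatFunc.denom_div_dvd (1 : ℂ[X]) p
  rw [map_one, one_div] at this
  exact Reg.of_dvd this hp

theorem ev_add (hf : Reg z f) (hg : Reg z g) : ev z (f + g) = ev z f + ev z g :=
  RatFunc.eval_add (f := RingHom.id ℂ) (a := z) hf hg

theorem ev_mul (hf : Reg z f) (hg : Reg z g) : ev z (f * g) = ev z f * ev z g :=
  RatFunc.eval_mul (f := RingHom.id ℂ) (a := z) hf hg

@[simp] theorem ev_C (c : ℂ) : ev z (RatFunc.C c) = c := by simp [ev]
@[simp] theorem ev_X : ev z RatFunc.X = z := by simp [ev]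
@[simp] theorem ev_zero : ev z 0 = 0 := by simp [ev]
@[simp] theorem ev_one : ev z 1 = 1 := by simp [ev]
theorem ev_algebraMap (p : ℂ[X]) : ev z (algebraMap ℂ[X] (RatFunc ℂ) p) = p.eval z := by
  simp [ev_eq]

theorem ev_neg (hf : Reg z f) : ev z (-f) = -ev z f := by
  have := ev_mul (reg_C z (-1)) hf
  rw [ev_C] at this
  simpa only [map_neg, map_one, neg_mul, one_mul] using this

theorem ev_sub (hf : Reg z f) (hg : Reg z g) : ev z (f - g) = ev z f - ev z g := by
  rw [sub_eq_add_neg, ev_add hf hg.neg, ev_neg hg, sub_eq_add_neg]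

theorem ev_pow (hf : Reg z f) (n : ℕ) : ev z (f ^ n) = ev z f ^ n := by
  induction n with
  | zero => simp
  | succ n ih => rw [pow_succ, ev_mul (hf.pow n) hf, ih, pow_succ]

theorem ev_sum {ι : Type*} (s : Finset ι) {f : ι → RatFunc ℂ} (hf : ∀ i ∈ s, Reg z (f i)) :
    ev z (∑ i ∈ s, f i) = ∑ i ∈ s, ev z (f i) := by
  classical
  induction s using Finset.induction_on with
  | empty => simp
  | insert a s ha ih =>
    rw [Finset.sum_insert ha, Finset.sum_insert ha, ev_add (hf _ (by simp))
      (Reg.sum _ fun i hi => hf i (by simp [hi])), ih fun i hi => hf i (by simp [hi])]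

theorem ev_inv_algebraMap {p : ℂ[X]} (hp : p.eval z ≠ 0) :
    ev z (algebraMap ℂ[X] (RatFunc ℂ) p)⁻¹ = (p.eval z)⁻¹ := by
  have hp0 : algebraMap ℂ[X] (RatFunc ℂ) p ≠ 0 := by
    intro h
    rw [map_eq_zero_iff _ (RatFunc.algebraMap_injective ℂ)] at h
    exact hp (by simp [h])
  have := ev_mul (reg_algebraMap z p) (reg_inv_algebraMap hp)
  rw [mul_inv_cancel₀ hp0, ev_one, ev_algebraMap] at this
  exact eq_inv_of_mul_eq_one_right this.symm

theorem X_sub_C_eq (a : ℂ) : (RatFunc.X - RatFunc.C a : RatFunc ℂ) =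
    algebraMap ℂ[X] (RatFunc ℂ) (Polynomial.X - Polynomial.C a) := by simp

theorem reg_inv_X_sub_C {a : ℂ} (h : z ≠ a) : Reg z (RatFunc.X - RatFunc.C a)⁻¹ := by
  rw [X_sub_C_eq]
  exact reg_inv_algebraMap (by simpa [sub_eq_zero] using h)

theorem ev_inv_X_sub_C {a : ℂ} (h : z ≠ a) : ev z (RatFunc.X - RatFunc.C a)⁻¹ = (z - a)⁻¹ := by
  rw [X_sub_C_eq, ev_inv_algebraMap (by simpa [sub_eq_zero] using h)]
  simp

theorem reg_X_zpow (h : z ≠ 0) (n : ℤ) : Reg z ((RatFunc.X : RatFunc ℂ) ^ n) := by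
  obtain ⟨k, rfl | rfl⟩ := n.eq_nat_or_neg
  · rw [zpow_natCast]; exact (reg_X z).pow k
  · rw [zpow_neg, zpow_natCast, ← inv_pow]
    have := reg_inv_X_sub_C h
    rw [map_zero, sub_zero] at this
    exact this.pow k

theorem ev_X_zpow (h : z ≠ 0) (n : ℤ) : ev z ((RatFunc.X : RatFunc ℂ) ^ n) = z ^ n := by
  have h2 : ev z ((RatFunc.X : RatFunc ℂ))⁻¹ = z⁻¹ := by simpa using ev_inv_X_sub_C h
  obtain ⟨k, rfl | rfl⟩ := n.eq_nat_or_neg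
  · rw [zpow_natCast, ev_pow (reg_X z)]; simp
  · have := reg_inv_X_sub_C h
    rw [map_zero, sub_zero] at this
    rw [zpow_neg, zpow_natCast, ← inv_pow, ev_pow this, h2]
    simp

/-- The numerator would have infinitely many roots. This turns identities away from the poles into
identities of rational functions. -/
theorem eq_zero_of_ev {S : Set ℂ} (hS : S.Finite) (f : RatFunc ℂ) (hr : ∀ z ∉ S, Reg z f)
    (h : ∀ z ∉ S, ev z f = 0) : f = 0 := by
  rw [← RatFunc.num_eq_zero_iff]
  apply Polynomial.eq_zero_of_infinite_isRoot
  refine Set.Infinite.mono ?_ hS.infinite_compl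
  intro z hz
  have := h z hz
  rw [ev_eq, div_eq_zero_iff] at this
  exact this.resolve_right (hr z hz)

/-- A rational function without finite poles is a polynomial. -/
theorem exists_eq_algebraMap (f : RatFunc ℂ) (h : ∀ z, Reg z f) :
    ∃ p : ℂ[X], f = algebraMap ℂ[X] (RatFunc ℂ) p := by
  have h1 : f.denom.degree = 0 := by
    by_contra h0
    obtain ⟨z, hz⟩ := IsAlgClosed.exists_root f.denom h0
    exact h z hz
  have h2 : f.denom = 1 :=
    Polynomial.eq_one_of_monic_natDegree_zero (RatFunc.monic_denom f)
      (Polynomial.natDegree_eq_zero_iff_degree_le_zero.2 h1.le)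
  refine ⟨f.num, ?_⟩
  conv_lhs => rw [← RatFunc.num_div_denom f, h2, map_one, div_one]

/-- The substitution `λ ↦ ω λ`. -/
noncomputable def scaleHom (w : ℂ) (hw : w ≠ 0) : RatFunc ℂ →+* RatFunc ℂ :=
  evHom RatFunc.C (RatFunc.C w * RatFunc.X) (by
    intro p hp h
    have : p.eval₂ RatFunc.C (RatFunc.C w * RatFunc.X) =
        algebraMap ℂ[X] (RatFunc ℂ) (p.comp (C w * X)) := by
      rw [Polynomial.comp, Polynomial.hom_eval₂]
      simp [RatFunc.algebraMap_comp_C]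
    rw [this, map_eq_zero_iff _ (RatFunc.algebraMap_injective ℂ),
      Polynomial.comp_C_mul_X_eq_zero_iff (mem_nonZeroDivisors_of_ne_zero hw)] at h
    exact hp h)

theorem scaleHom_algebraMap (w : ℂ) (hw : w ≠ 0) (p : ℂ[X]) :
    scaleHom w hw (algebraMap ℂ[X] (RatFunc ℂ) p) =
      algebraMap ℂ[X] (RatFunc ℂ) (p.comp (C w * X)) := by
  rw [scaleHom, evHom_algebraMap, Polynomial.comp, Polynomial.hom_eval₂]
  simp [RatFunc.algebraMap_comp_C]

theorem scaleHom_reg_ev {w : ℂ} (hw : w ≠ 0) (hf : Reg (w * z) f) :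
    Reg z (scaleHom w hw f) ∧ ev z (scaleHom w hw f) = ev (w * z) f := by
  have h1 : scaleHom w hw f = algebraMap ℂ[X] (RatFunc ℂ) (f.num.comp (C w * X)) *
      (algebraMap ℂ[X] (RatFunc ℂ) (f.denom.comp (C w * X)))⁻¹ := by
    conv_lhs => rw [← RatFunc.num_div_denom f]
    rw [map_div₀, scaleHom_algebraMap, scaleHom_algebraMap, div_eq_mul_inv]
  have h2 : (f.denom.comp (C w * X)).eval z ≠ 0 := by
    simpa [Reg] using hf
  rw [h1]
  refine ⟨(reg_algebraMap _ _).mul (reg_inv_algebraMap h2), ?_⟩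
  rw [ev_mul (reg_algebraMap _ _) (reg_inv_algebraMap h2), ev_algebraMap, ev_inv_algebraMap h2,
    ev_eq, div_eq_mul_inv]
  simp

end Reg

/-! ### Laurent expansions at the marked points. -/

section expand

open Polynomial

namespace GaudinData

variable {m N T : ℕ} (D : GaudinData m N T)

theorem coord_transcendental (r : Pt N) (p : ℂ[X]) (hp : p ≠ 0) :
    p.eval₂ (HahnSeries.C (Γ := ℤ)) (D.coord r) ≠ 0 := by
  cases r with
  | zero => exact eval₂_single_ne_zero one_ne_zero p hp
  | pt r => exact eval₂_C_add_single_ne_zero _ p hp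
  | infty => exact eval₂_single_ne_zero (by norm_num) p hp

/-- Laurent expansion at a marked point, as a ring homomorphism. -/
noncomputable def expandHom (r : Pt N) : RatFunc ℂ →+* LaurentSeries ℂ :=
  evHom HahnSeries.C (D.coord r) (D.coord_transcendental r)

theorem expand_eq (f : RatMat m) (r : Pt N) : D.expand f r = f.map (D.expandHom r) := by
  refine Matrix.ext fun a b => ?_
  exact (evHom_apply (K := LaurentSeries ℂ) HahnSeries.C (D.coord r)
    (D.coord_transcendental r) _).symm

@[simp] theorem expandHom_C (r : Pt N) (c : ℂ) : D.expandHom r (RatFunc.C c) = HahnSeries.C c :=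
  evHom_C _ _ _ _

@[simp] theorem expandHom_X (r : Pt N) : D.expandHom r RatFunc.X = D.coord r :=
  evHom_X _ _ _

/-- The position of a finite marked point. -/
noncomputable def base : Pt N → ℂ
  | .pt r => D.ζ r
  | _ => 0

theorem coord_eq {r : Pt N} (hr : r ≠ .infty) :
    D.coord r = HahnSeries.C (D.base r) + HahnSeries.single 1 1 := by
  cases r with
  | zero => simp [coord, base]
  | pt r => rfl
  | infty => exact absurd rfl hr

/-- Links the analytic and the formal picture: the constant term of the expansion is the value at
the marked point, so vanishing of a denominator there can be read off from its series. -/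
theorem exists_expandHom_algebraMap {r : Pt N} (hr : r ≠ .infty) (p : ℂ[X]) :
    ∃ q : ℂ⟦X⟧, D.expandHom r (algebraMap ℂ[X] (RatFunc ℂ) p) = HahnSeries.ofPowerSeries ℤ ℂ q ∧
      PowerSeries.constantCoeff q = p.eval (D.base r) := by
  refine ⟨p.eval₂ (PowerSeries.C) (PowerSeries.C (D.base r) + PowerSeries.X), ?_, ?_⟩
  · rw [expandHom, evHom_algebraMap, Polynomial.hom_eval₂, map_add, HahnSeries.ofPowerSeries_C,
      HahnSeries.ofPowerSeries_X, D.coord_eq hr]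
    congr 1
    ext x : 1
    simp
  · rw [Polynomial.hom_eval₂]
    simp [Polynomial.eval, Polynomial.eval₂_eq_sum]

/-- If the denominator vanished at the point, its series would have no constant term; multiplied by
a Taylor series it gives the numerator, which would vanish too, against coprimality. -/
theorem reg_of_vanishBelow {r : Pt N} (hr : r ≠ .infty) (f : RatFunc ℂ)
    (h : VanishBelow 0 (D.expandHom r f)) : Reg (D.base r) f := by
  intro h0
  obtain ⟨q, hq, hq0⟩ := D.exists_expandHom_algebraMap hr f.denom
  obtain ⟨q', hq', hq0'⟩ := D.exists_expandHom_algebraMap hr f.num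
  have h1 : D.expandHom r f * HahnSeries.ofPowerSeries ℤ ℂ q = HahnSeries.ofPowerSeries ℤ ℂ q' := by
    rw [← hq, ← hq', ← map_mul]
    congr 1
    have := div_mul_cancel₀ (algebraMap ℂ[X] (RatFunc ℂ) f.num)
      (RatFunc.algebraMap_ne_zero f.denom_ne_zero)
    rwa [RatFunc.num_div_denom] at this
  have h2 := h.coeff_mul (vanishBelow_ofPowerSeries q)
  rw [add_zero, h1, coeff_zero_ofPowerSeries, coeff_zero_ofPowerSeries, hq0, h0, mul_zero,
    hq0'] at h2
  obtain ⟨u, v, huv⟩ := RatFunc.isCoprime_num_denom f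
  have := congr_arg (Polynomial.eval (D.base r)) huv
  simp [h0, h2] at this

theorem inv_ofPowerSeries {q : ℂ⟦X⟧} (hq : PowerSeries.constantCoeff q ≠ 0) :
    (HahnSeries.ofPowerSeries ℤ ℂ q)⁻¹ = HahnSeries.ofPowerSeries ℤ ℂ q⁻¹ := by
  apply inv_eq_of_mul_eq_one_right
  rw [← map_mul, PowerSeries.mul_inv_cancel _ hq, map_one]

theorem vanishBelow_of_reg {r : Pt N} (hr : r ≠ .infty) (f : RatFunc ℂ)
    (h : Reg (D.base r) f) : VanishBelow 0 (D.expandHom r f) := by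
  obtain ⟨q, hq, hq0⟩ := D.exists_expandHom_algebraMap hr f.denom
  obtain ⟨q', hq', hq0'⟩ := D.exists_expandHom_algebraMap hr f.num
  rw [← RatFunc.num_div_denom f, map_div₀, hq, hq', div_eq_mul_inv,
    inv_ofPowerSeries (by rw [hq0]; exact h), ← map_mul]
  exact vanishBelow_ofPowerSeries _

/-- The geometric series 1/(λ - a) = λ_∞ / (1 - a λ_∞). It shows that simple poles vanish to first
order at infinity with leading coefficient 1. -/
theorem coord_infty_sub_inv (a : ℂ) :
    (D.coord .infty - HahnSeries.C a)⁻¹ =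
      HahnSeries.single 1 1 * HahnSeries.ofPowerSeries ℤ ℂ (1 - PowerSeries.C a * PowerSeries.X)⁻¹ := by
  apply inv_eq_of_mul_eq_one_right
  have : D.coord .infty - HahnSeries.C a = HahnSeries.single (-1) 1 *
      HahnSeries.ofPowerSeries ℤ ℂ (1 - PowerSeries.C a * PowerSeries.X) := by
    have h : HahnSeries.ofPowerSeries ℤ ℂ (1 - PowerSeries.C a * PowerSeries.X) =
        1 - HahnSeries.C a * HahnSeries.single 1 1 := by
      rw [map_sub, map_mul, HahnSeries.ofPowerSeries_C, HahnSeries.ofPowerSeries_X, map_one]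
    rw [h, mul_sub, mul_left_comm, HahnSeries.single_mul_single]
    simp [coord]
  rw [this, mul_mul_mul_comm, HahnSeries.single_mul_single, ← map_mul,
    PowerSeries.mul_inv_cancel _ (by simp)]
  simp

theorem vanishBelow_single (j : ℤ) : VanishBelow j (HahnSeries.single j (1 : ℂ)) := fun i hi => by
  rw [HahnSeries.coeff_single, if_neg hi.ne]

theorem vanishBelow_infty (a : ℂ) :
    VanishBelow 1 (D.expandHom .infty (RatFunc.X - RatFunc.C a)⁻¹) := by
  rw [map_inv₀, map_sub, expandHom_X, expandHom_C, coord_infty_sub_inv]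
  simpa using (vanishBelow_single 1).mul (vanishBelow_ofPowerSeries _)

theorem coeff_infty (a : ℂ) :
    (D.expandHom .infty (RatFunc.X - RatFunc.C a)⁻¹).coeff 1 = 1 := by
  rw [map_inv₀, map_sub, expandHom_X, expandHom_C, coord_infty_sub_inv]
  have := (vanishBelow_single 1).coeff_mul
    (vanishBelow_ofPowerSeries (1 - PowerSeries.C a * PowerSeries.X)⁻¹)
  rw [coeff_zero_ofPowerSeries] at this
  simpa using this

/-- A rational function without finite poles and vanishing at infinity is zero. -/
theorem eq_zero_of_reg (f : RatFunc ℂ) (h : ∀ z, Reg z f)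
    (hinf : VanishBelow 1 (D.expandHom .infty f)) : f = 0 := by
  obtain ⟨p, rfl⟩ := exists_eq_algebraMap f h
  suffices p = 0 by simp [this]
  ext n
  -- The coefficient of λⁿ is the coefficient of degree -n at infinity, and -n < 1 for every n ≥ 0;
  -- thus the constant is killed as well.
  have h1 := coeff_eval₂_single (a := -1) (by norm_num) p n
  rw [expandHom, evHom_algebraMap] at hinf
  rw [← h1]
  exact hinf _ (by simp; omega)

theorem ω_ne_zero : D.ω ≠ 0 := D.primitive.ne_zero D.T_pos.ne'

theorem ω_pow_T : D.ω ^ T = 1 := D.primitive.pow_eq_one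

theorem expandHom_zero_scaleHom (f : RatFunc ℂ) :
    D.expandHom .zero (scaleHom D.ω D.ω_ne_zero f) =
      rescale D.ω D.ω_ne_zero (D.expandHom .zero f) := by
  have : (D.expandHom .zero).comp (scaleHom D.ω D.ω_ne_zero) =
      (rescale D.ω D.ω_ne_zero).comp (D.expandHom .zero) := by
    apply ratFunc_hom_ext
    · intro c
      ext j
      simp [scaleHom, coeff_rescale, HahnSeries.C_apply, HahnSeries.coeff_single]
      split_ifs with h <;> simp [h]
    · ext j
      simp [scaleHom, coeff_rescale, coord, HahnSeries.coeff_single]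
      split_ifs with h <;> simp [h]
  exact RingHom.congr_fun this f

/-- Since λ_∞ = 1/λ, the substitution λ ↦ ωλ acts on the local parameter by ω⁻¹. -/
theorem expandHom_infty_scaleHom (f : RatFunc ℂ) :
    D.expandHom .infty (scaleHom D.ω D.ω_ne_zero f) =
      rescale D.ω⁻¹ (inv_ne_zero D.ω_ne_zero) (D.expandHom .infty f) := by
  have : (D.expandHom .infty).comp (scaleHom D.ω D.ω_ne_zero) =
      (rescale D.ω⁻¹ (inv_ne_zero D.ω_ne_zero)).comp (D.expandHom .infty) := by
    apply ratFunc_hom_ext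
    · intro c
      ext j
      simp [scaleHom, coeff_rescale, HahnSeries.C_apply, HahnSeries.coeff_single]
      split_ifs with h <;> simp [h]
    · ext j
      simp [scaleHom, coeff_rescale, coord, HahnSeries.coeff_single]
      split_ifs with h <;> simp [h]
  exact RingHom.congr_fun this f

theorem finitePoles_finite : D.finitePoles.Finite := by
  have : D.finitePoles ⊆ insert 0 (⋃ r : Fin N, (fun k => D.ω ^ k * D.ζ r) '' (Finset.range T : Set ℕ)) := by
    rintro z (rfl | ⟨r, k, rfl⟩)
    · exact Set.mem_insert _ _
    · refine Set.mem_insert_of_mem _ (Set.mem_iUnion.2 ⟨r, k % T, ?_, ?_⟩)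
      · simpa using Nat.mod_lt _ D.T_pos
      · simp only
        rw [pow_mod_eq]
  exact ((Set.finite_iUnion fun r => (Finset.finite_toSet _).image _).insert 0).subset this
where pow_mod_eq {k : ℕ} : D.ω ^ (k % T) = D.ω ^ k := by
        conv_rhs => rw [← Nat.mod_add_div k T, pow_add, pow_mul, D.ω_pow_T, one_pow, mul_one]

theorem mul_mem_finitePoles {z : ℂ} (hz : z ∉ D.finitePoles) : D.ω * z ∉ D.finitePoles := by
  rintro (h | ⟨r, k, h⟩)
  · exact hz (Or.inl ((mul_eq_zero.1 h).resolve_left D.ω_ne_zero))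
  · refine hz (Or.inr ⟨r, k + (T - 1), ?_⟩)
    apply mul_left_cancel₀ D.ω_ne_zero
    rw [h, ← mul_assoc, ← pow_succ', add_assoc, Nat.sub_add_cancel D.T_pos, pow_add, D.ω_pow_T,
      mul_one]

theorem ne_zero_of_not_mem {z : ℂ} (hz : z ∉ D.finitePoles) : z ≠ 0 := fun h => hz (Or.inl h)

theorem ne_of_not_mem {z : ℂ} (hz : z ∉ D.finitePoles) (r : Fin N) (k : ℕ) :
    z ≠ D.ω ^ k * D.ζ r := fun h => hz (Or.inr ⟨r, k, h⟩)

/-- Among the T poles of one orbit, ζ_r itself is hit only by the exponent 0. Hence a sum over an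
orbit has a single singular term at a marked point. -/
theorem orbit_injective {r s : Fin N} {k : ℕ} (hk : k < T) (h : D.ζ s = D.ω ^ k * D.ζ r) :
    s = r ∧ k = 0 := by
  have h1 : s = r := by
    by_contra hne
    exact D.ζ_disjoint s r hne 0 k (by simpa using h)
  subst h1
  refine ⟨rfl, ?_⟩
  have h2 : D.ω ^ k = 1 := by
    have : D.ω ^ k * D.ζ s = 1 * D.ζ s := by rw [← h, one_mul]
    exact mul_right_cancel₀ (D.ζ_ne_zero s) this
  by_contra h0
  exact absurd (Nat.le_of_dvd (Nat.pos_of_ne_zero h0) ((D.primitive.pow_eq_one_iff_dvd k).1 h2))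
    (not_le.2 hk)

end GaudinData

end expand

/-! ### The grading of `𝔤` and the adjoint action -/

/-- Conjugation by an exponential as the exponential of the adjoint action. -/
theorem exp_conj_hasSum {𝔸 : Type} [NormedRing 𝔸] [NormedAlgebra ℂ 𝔸] [CompleteSpace 𝔸]
    (X Y : 𝔸) :
    HasSum (fun n : ℕ => (n.factorial⁻¹ : ℂ) • (fun Z : 𝔸 => Y * Z - Z * Y)^[n] X)
      (NormedSpace.exp Y * X * NormedSpace.exp (-Y)) := by
  let _ : NormedAlgebra ℚ (𝔸 →L[ℂ] 𝔸) := NormedAlgebra.restrictScalars ℚ ℂ _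
  let Lm : 𝔸 →L[ℂ] 𝔸 := ContinuousLinearMap.mul ℂ 𝔸 Y
  let Rm : 𝔸 →L[ℂ] 𝔸 := (ContinuousLinearMap.mul ℂ 𝔸).flip Y
  have hL : ∀ (n : ℕ) Z, (Lm ^ n) Z = Y ^ n * Z := by
    intro n Z
    induction n with
    | zero => simp
    | succ n ih =>
      rw [pow_succ', mul_apply_eq_comp, ih, pow_succ', mul_assoc]
      rfl
  have hR : ∀ (n : ℕ) Z, ((-Rm) ^ n) Z = Z * (-Y) ^ n := by
    intro n Z
    induction n with
    | zero => simp
    | succ n ih =>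
      rw [pow_succ', mul_apply_eq_comp, ih, pow_succ, ← mul_assoc]
      simp [Rm]
  have hLm : ∀ Z, (NormedSpace.exp Lm) Z = NormedSpace.exp Y * Z := by
    intro Z
    have h1 := (NormedSpace.exp_series_hasSum_exp' (𝕂 := ℂ) Lm).mapL
      (ContinuousLinearMap.apply ℂ 𝔸 Z)
    have h2 := (NormedSpace.exp_series_hasSum_exp' (𝕂 := ℂ) Y).mul_right Z
    refine HasSum.unique h1 ?_
    refine (congr_arg (fun f => HasSum f _) (funext fun n => ?_)).mpr h2
    simp [hL]
  have hRm : ∀ Z, (NormedSpace.exp (-Rm)) Z = Z * NormedSpace.exp (-Y) := by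
    intro Z
    have h1 := (NormedSpace.exp_series_hasSum_exp' (𝕂 := ℂ) (-Rm)).mapL
      (ContinuousLinearMap.apply ℂ 𝔸 Z)
    have h2 := (NormedSpace.exp_series_hasSum_exp' (𝕂 := ℂ) (-Y)).mul_left Z
    refine HasSum.unique h1 ?_
    refine (congr_arg (fun f => HasSum f _) (funext fun n => ?_)).mpr h2
    simp [hR]
  -- Left and right multiplications commute by associativity, so the exponential of their difference
  -- ad Y factors.
  have hc : Commute Lm (-Rm) := by
    ext Z
    simp [Lm, Rm, mul_apply_eq_comp, mul_assoc]
  have h1 := NormedSpace.exp_series_hasSum_exp' (𝕂 := ℂ) (Lm + -Rm)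
  have h2 := h1.mapL (ContinuousLinearMap.apply ℂ 𝔸 X)
  rw [NormedSpace.exp_add_of_commute hc] at h2
  have h3 : (ContinuousLinearMap.apply ℂ 𝔸) X (NormedSpace.exp Lm * NormedSpace.exp (-Rm)) =
      NormedSpace.exp Y * X * NormedSpace.exp (-Y) := by
    rw [ContinuousLinearMap.apply_apply, mul_apply_eq_comp, hLm, hRm, mul_assoc]
  rw [h3] at h2
  refine (congr_arg (fun f => HasSum f _) (funext fun n => ?_)).mpr h2
  · simp only [ContinuousLinearMap.apply_apply, smul_apply]
    congr 1
    induction n with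
    | zero => simp
    | succ n ih =>
      rw [Function.iterate_succ_apply', ih, pow_succ', mul_apply_eq_comp]
      simp [Lm, Rm, sub_eq_add_neg]

namespace GaudinData

variable {m N T : ℕ} (D : GaudinData m N T)

/-- The trace form on `𝔤`. -/
noncomputable def traceForm : LinearMap.BilinForm ℂ D.𝔤 :=
  LinearMap.mk₂ ℂ (fun x y => Matrix.trace ((x : Mat m) * (y : Mat m)))
    (by intros; simp [add_mul]) (by intros; simp) (by intros; simp [mul_add]) (by intros; simp)

theorem traceForm_apply (x y : D.𝔤) :
    D.traceForm x y = Matrix.trace ((x : Mat m) * (y : Mat m)) := rfl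

theorem traceForm_nondegenerate : D.traceForm.Nondegenerate := by
  have h : ∀ x : D.𝔤, (∀ y, D.traceForm x y = 0) → x = 0 := fun x hx =>
    Subtype.ext (D.trace_nondegenerate x x.2 fun Y hY => hx ⟨Y, hY⟩)
  refine ⟨h, fun x hx => h x fun y => ?_⟩
  rw [traceForm_apply, Matrix.trace_mul_comm]
  exact hx y

/-- The orthogonal projection onto `𝔤`. -/
noncomputable def proj : Mat m →ₗ[ℂ] D.𝔤 :=
  (D.traceForm.toDual D.traceForm_nondegenerate).symm.toLinearMap ∘ₗ
    LinearMap.mk₂ ℂ (fun (x : Mat m) (y : D.𝔤) => Matrix.trace (x * (y : Mat m)))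
    (by intros; simp [add_mul]) (by intros; simp) (by intros; simp [mul_add]) (by intros; simp)

theorem trace_proj_mul (M : Mat m) (y : D.𝔤) :
    Matrix.trace ((D.proj M : Mat m) * (y : Mat m)) = Matrix.trace (M * (y : Mat m)) := by
  rw [← traceForm_apply, proj]
  exact LinearMap.BilinForm.apply_toDual_symm_apply (B := D.traceForm)
    (hB := D.traceForm_nondegenerate) _ y

theorem proj_coe (x : D.𝔤) : D.proj x = x := by
  apply (D.traceForm.toDual D.traceForm_nondegenerate).injective
  ext y
  exact D.trace_proj_mul x y

theorem proj_of_mem {X : Mat m} (h : X ∈ D.𝔤) : D.proj X = ⟨X, h⟩ := D.proj_coe ⟨X, h⟩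

/-- A linear extension of `σ^k`. -/
noncomputable def sig (k : ℕ) : Mat m →ₗ[ℂ] Mat m :=
  D.𝔤.toSubmodule.subtype ∘ₗ ((D.σ : D.𝔤 →ₗ[ℂ] D.𝔤) ^ k : Module.End ℂ D.𝔤) ∘ₗ D.proj

theorem sig_mem (k : ℕ) (X : Mat m) : D.sig k X ∈ D.𝔤 :=
  (((D.σ : D.𝔤 →ₗ[ℂ] D.𝔤) ^ k : Module.End ℂ D.𝔤) (D.proj X)).2

theorem sig_eq (k : ℕ) {X : Mat m} (h : X ∈ D.𝔤) : D.sig k X = (D.σ^[k] ⟨X, h⟩ : D.𝔤) := by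
  simp only [sig, LinearMap.comp_apply, D.proj_of_mem h, Module.End.pow_apply]
  rfl

/-- Membership matters: off `𝔤` the map `sigmaPow` takes the default value 0, whereas `sig` first
projects orthogonally onto `𝔤`. -/
theorem sigmaPow_eq (k : ℕ) {X : Mat m} (h : X ∈ D.𝔤) : D.sigmaPow k X = D.sig k X := by
  rw [sigmaPow, dif_pos h, sig_eq]

theorem sig_one {X : Mat m} (h : X ∈ D.𝔤) : D.sig 1 X = D.σ ⟨X, h⟩ := D.sig_eq 1 h

theorem sig_zero {X : Mat m} (h : X ∈ D.𝔤) : D.sig 0 X = X := D.sig_eq 0 h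

theorem sig_succ (k : ℕ) (X : Mat m) : D.sig (k + 1) X = D.sig 1 (D.sig k X) := by
  rw [D.sig_one (D.sig_mem k X)]
  simp only [sig, LinearMap.comp_apply, pow_succ', Module.End.mul_apply]
  rfl

theorem sig_lie {X Y : Mat m} (hX : X ∈ D.𝔤) (hY : Y ∈ D.𝔤) :
    D.sig 1 ⁅X, Y⁆ = ⁅D.sig 1 X, D.sig 1 Y⁆ := by
  rw [D.sig_one (D.𝔤.lie_mem hX hY), D.sig_one hX, D.sig_one hY, ← LieSubalgebra.coe_bracket,
    ← LieEquiv.map_lie]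
  rfl

theorem trace_sig {X Y : Mat m} (hX : X ∈ D.𝔤) (hY : Y ∈ D.𝔤) (k : ℕ) :
    Matrix.trace (D.sig k X * D.sig k Y) = Matrix.trace (X * Y) := by
  induction k with
  | zero => rw [D.sig_zero hX, D.sig_zero hY]
  | succ k ih =>
    rw [D.sig_succ k X, D.sig_succ k Y, D.sig_one (D.sig_mem k X), D.sig_one (D.sig_mem k Y), D.σ_trace, ih]

theorem mem_grade_iff {k : ℤ} {X : Mat m} :
    X ∈ D.grade k ↔ X ∈ D.𝔤 ∧ D.sig 1 X = D.ω ^ k • X := by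
  constructor
  · rintro ⟨h, h'⟩
    exact ⟨h, by rw [D.sig_one h, h']⟩
  · rintro ⟨h, h'⟩
    exact ⟨h, by rw [← D.sig_one h, h']⟩

theorem sig_of_grade {k : ℤ} {X : Mat m} (h : X ∈ D.grade k) (l : ℕ) :
    D.sig l X = (D.ω ^ k) ^ l • X := by
  induction l with
  | zero => rw [D.sig_zero h.1]; simp
  | succ l ih => rw [sig_succ, ih, map_smul, (D.mem_grade_iff.1 h).2, smul_smul, pow_succ]

/-- The eigenspaces of `σ` as subspaces. -/
noncomputable def gradeSub (k : ℤ) : Submodule ℂ (Mat m) where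
  carrier := D.grade k
  zero_mem' := D.mem_grade_iff.2 ⟨D.𝔤.zero_mem, by simp⟩
  add_mem' {X Y} hX hY := by
    rw [mem_grade_iff] at hX hY ⊢
    exact ⟨D.𝔤.add_mem hX.1 hY.1, by rw [map_add, hX.2, hY.2, smul_add]⟩
  smul_mem' c X hX := by
    rw [mem_grade_iff] at hX ⊢
    exact ⟨D.𝔤.smul_mem c hX.1, by rw [map_smul, hX.2, smul_comm]⟩

theorem zero_mem_grade (k : ℤ) : (0 : Mat m) ∈ D.grade k := (D.gradeSub k).zero_mem

theorem lie_mem_grade {j k : ℤ} {X Y : Mat m} (hX : X ∈ D.grade j) (hY : Y ∈ D.grade k) :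
    ⁅X, Y⁆ ∈ D.grade (j + k) := by
  have hX' := D.mem_grade_iff.1 hX
  have hY' := D.mem_grade_iff.1 hY
  refine D.mem_grade_iff.2 ⟨D.𝔤.lie_mem hX'.1 hY'.1, ?_⟩
  rw [D.sig_lie hX'.1 hY'.1, hX'.2, hY'.2, zpow_add₀ D.ω_ne_zero]
  simp only [Ring.lie_def, smul_mul_smul_comm, mul_comm (D.ω ^ k), smul_sub]

/-- Projection onto an eigenspace of `σ`, orthogonal for the trace form. -/
noncomputable def gradeProj (k : ℤ) : Mat m →ₗ[ℂ] Mat m :=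
  (T : ℂ)⁻¹ • ∑ l ∈ Finset.range T, ((D.ω ^ k) ^ l)⁻¹ • D.sig l

theorem T_ne_zero (D : GaudinData m N T) : (T : ℂ) ≠ 0 := Nat.cast_ne_zero.2 D.T_pos.ne'

/-- Cyclic reindexing of a sum over an orbit: used when σ moves the l-th term to the (l+1)-st and
σ^T = id closes the cycle. -/
theorem sum_range_shift {M : Type*} [AddCommGroup M] (f : ℕ → M) (h : f T = f 0) :
    ∑ l ∈ Finset.range T, f (l + 1) = ∑ l ∈ Finset.range T, f l := by
  have := (Finset.sum_range_succ f T).symm.trans (Finset.sum_range_succ' f T)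
  rw [h] at this
  exact (add_right_cancel this).symm

/-- The projector is a discrete Fourier average over the powers of σ; applying σ shifts the index
and produces the factor ω^k. -/
theorem gradeProj_mem (k : ℤ) (M : Mat m) : D.gradeProj k M ∈ D.grade k := by
  rw [mem_grade_iff]
  simp only [gradeProj, LinearMap.smul_apply, LinearMap.sum_apply]
  constructor
  · exact D.𝔤.smul_mem _ (sum_mem fun l _ => D.𝔤.smul_mem _ (D.sig_mem l M))
  · rw [map_smul, map_sum, smul_comm (D.ω ^ k), Finset.smul_sum (r := D.ω ^ k)]
    congr 1
    rw [← sum_range_shift (T := T) (fun l => D.ω ^ k • ((D.ω ^ k) ^ l)⁻¹ • D.sig l M)]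
    · refine Finset.sum_congr rfl fun l _ => ?_
      rw [map_smul, ← sig_succ, smul_smul, pow_succ, mul_inv, mul_left_comm,
        mul_inv_cancel₀ (zpow_ne_zero _ D.ω_ne_zero), mul_one]
    · have h1 : (D.ω ^ k) ^ T = 1 := by
        rw [← zpow_natCast, ← zpow_mul, mul_comm, zpow_mul, zpow_natCast, D.ω_pow_T, one_zpow]
      have h2 : D.sig T M = D.sig 0 M := by
        have := D.σ_iterate (D.proj M)
        simp only [sig, LinearMap.comp_apply, Module.End.pow_apply]
        exact congr_arg Subtype.val this
      simp only [h1, h2, pow_zero]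

/-- Each term of the average contributes the same amount: on X in degree -k the factor ω^{-kl} is
exactly what moving σ^l from M to X by invariance of the trace produces. The matrix M need not lie
in `𝔤`, because `sig` only sees its orthogonal projection. -/
theorem trace_mul_gradeProj {k : ℤ} {X : Mat m} (hX : X ∈ D.grade (-k)) (M : Mat m) :
    Matrix.trace (X * D.gradeProj k M) = Matrix.trace (X * M) := by
  simp only [gradeProj, LinearMap.smul_apply, LinearMap.sum_apply, Matrix.mul_smul,
    Matrix.trace_smul, Matrix.mul_sum, Matrix.trace_sum]
  have : ∀ l ∈ Finset.range T, ((D.ω ^ k) ^ l)⁻¹ • Matrix.trace (X * D.sig l M) =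
      Matrix.trace (X * M) := by
    intro l _
    have h0 : D.sig l (D.proj M) = D.sig l M := by simp [sig, D.proj_coe]
    have h1 := D.trace_sig hX.1 (D.proj M).2 l
    rw [D.sig_of_grade hX, smul_mul_assoc, Matrix.trace_smul, h0, Matrix.trace_mul_comm X (D.proj M : Mat m)] at h1
    have h2 := D.trace_proj_mul M ⟨X, hX.1⟩
    rw [h2, Matrix.trace_mul_comm, Matrix.trace_mul_comm M] at h1
    rw [← h1, zpow_neg, inv_pow, Matrix.trace_mul_comm]
  rw [Finset.sum_congr rfl this]
  simp [T_ne_zero D]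

/-- The trace form pairs the eigenspaces of degrees k and -k perfectly: any test element may be
replaced by its projection to degree -k. -/
theorem grade_eq_zero {k : ℤ} {X : Mat m} (hX : X ∈ D.grade k)
    (h : ∀ Y ∈ D.grade (-k), Matrix.trace (X * Y) = 0) : X = 0 := by
  refine D.trace_nondegenerate X hX.1 fun Y _ => ?_
  rw [← D.trace_mul_gradeProj (k := -k) (by rwa [neg_neg])]
  exact h _ (D.gradeProj_mem _ _)

theorem iterate_lie_mem {X Y : Mat m} (hX : X ∈ D.𝔤) (hY : Y ∈ D.𝔤) (n : ℕ) :
    (fun Z : Mat m => Y * Z - Z * Y)^[n] X ∈ D.𝔤 ∧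
      D.sig 1 ((fun Z : Mat m => Y * Z - Z * Y)^[n] X) =
        (fun Z : Mat m => D.sig 1 Y * Z - Z * D.sig 1 Y)^[n] (D.sig 1 X) := by
  induction n with
  | zero => exact ⟨hX, rfl⟩
  | succ n ih =>
    rw [Function.iterate_succ_apply', Function.iterate_succ_apply', ← ih.2]
    exact ⟨D.𝔤.lie_mem hY ih.1, D.sig_lie hY ih.1⟩

/-- Each term of the exponential series of ad Y lies in `𝔤`, which is closed by finite dimension,
and σ intertwines the series for Y with that for σY. -/
theorem exp_conj_mem {X Y : Mat m} (hX : X ∈ D.𝔤) (hY : Y ∈ D.𝔤) :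
    NormedSpace.exp Y * X * NormedSpace.exp (-Y) ∈ D.𝔤 ∧
      D.sig 1 (NormedSpace.exp Y * X * NormedSpace.exp (-Y)) =
        NormedSpace.exp (D.sig 1 Y) * D.sig 1 X * NormedSpace.exp (-(D.sig 1 Y)) := by
  have h := exp_conj_hasSum X Y
  constructor
  · have hcl : IsClosed (D.𝔤.toSubmodule : Set (Mat m)) :=
      Submodule.closed_of_finiteDimensional _
    exact hcl.mem_of_tendsto h (Filter.Eventually.of_forall fun s =>
      sum_mem fun n _ => D.𝔤.smul_mem _ (D.iterate_lie_mem hX hY n).1)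
  · have h2 := h.map (D.sig 1).toAddMonoidHom (LinearMap.continuous_of_finiteDimensional _)
    refine h2.unique ?_
    refine (congr_arg (fun f => HasSum f _) (funext fun n => ?_)).mpr
      (exp_conj_hasSum (D.sig 1 X) (D.sig 1 Y))
    simp only [Function.comp_apply, LinearMap.toAddMonoidHom_coe, map_smul,
      (D.iterate_lie_mem hX hY n).2]

/-- The underlying matrix of a group element. -/
def gmat {𝔤 : LieSubalgebra ℂ (Mat m)} (g : matrixGroup 𝔤) : Mat m := ((g : GL (Fin m) ℂ) : Mat m)

theorem gmat_mul {𝔤 : LieSubalgebra ℂ (Mat m)} (g h : matrixGroup 𝔤) :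
    gmat (g * h) = gmat g * gmat h := by
  simp [gmat]

theorem gmat_one {𝔤 : LieSubalgebra ℂ (Mat m)} : gmat (1 : matrixGroup 𝔤) = 1 := by
  simp [gmat]

theorem gmat_isUnit {𝔤 : LieSubalgebra ℂ (Mat m)} (g : matrixGroup 𝔤) : IsUnit (gmat g) :=
  (g : GL (Fin m) ℂ).isUnit

theorem exists_exp {X : Mat m} (hX : X ∈ D.𝔤) :
    ∃ g : matrixGroup D.𝔤, gmat g = NormedSpace.exp X ∧
      gmat (D.σG g) = NormedSpace.exp (D.sig 1 X) := by
  obtain ⟨u, hu⟩ := Matrix.isUnit_exp X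
  refine ⟨⟨u, Subgroup.subset_closure ⟨X, hX, hu⟩⟩, hu, ?_⟩
  rw [D.sig_one hX]
  exact D.σG_exp ⟨X, hX⟩ _ hu

theorem conj_mem_and (g : matrixGroup D.𝔤) {X : Mat m} (hX : X ∈ D.𝔤) :
    gmat g * X * (gmat g)⁻¹ ∈ D.𝔤 ∧
      D.sig 1 (gmat g * X * (gmat g)⁻¹) =
        gmat (D.σG g) * D.sig 1 X * (gmat (D.σG g))⁻¹ := by
  obtain ⟨g, hg⟩ := g
  have key : ∀ (g : matrixGroup D.𝔤) (Y : Mat m), Y ∈ D.𝔤 → gmat g = NormedSpace.exp Y →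
      ∀ X ∈ D.𝔤, gmat g * X * (gmat g)⁻¹ ∈ D.𝔤 ∧
      D.sig 1 (gmat g * X * (gmat g)⁻¹) =
        gmat (D.σG g) * D.sig 1 X * (gmat (D.σG g))⁻¹ := by
    intro g Y hY hgY X hX
    have h1 : gmat (D.σG g) = NormedSpace.exp (D.sig 1 Y) := by
      rw [D.sig_one hY]
      exact D.σG_exp ⟨Y, hY⟩ g hgY
    rw [h1, hgY, ← Matrix.exp_neg, ← Matrix.exp_neg]
    exact D.exp_conj_mem hX hY
  -- X is quantified inside the induction because for a product xy the hypothesis on x is applied to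
  -- y X y⁻¹.
  suffices ∀ X ∈ D.𝔤, gmat (⟨g, hg⟩ : matrixGroup D.𝔤) * X * (gmat (⟨g, hg⟩ : matrixGroup D.𝔤))⁻¹ ∈ D.𝔤 ∧
      D.sig 1 (gmat (⟨g, hg⟩ : matrixGroup D.𝔤) * X * (gmat (⟨g, hg⟩ : matrixGroup D.𝔤))⁻¹) =
        gmat (D.σG ⟨g, hg⟩) * D.sig 1 X * (gmat (D.σG ⟨g, hg⟩))⁻¹ from this X hX
  induction hg using Subgroup.closure_induction'' with
  | mem g hg =>
    obtain ⟨Y, hY, hgY⟩ := hg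
    exact key _ Y hY hgY
  | inv_mem g hg =>
    obtain ⟨Y, hY, hgY⟩ := hg
    refine key _ (-Y) (D.𝔤.neg_mem hY) ?_
    rw [Matrix.exp_neg]
    exact (Matrix.coe_units_inv g).trans (congr_arg _ hgY)
  | one =>
    intro X hX
    have : (⟨1, one_mem _⟩ : matrixGroup D.𝔤) = 1 := rfl
    rw [this, map_one, gmat_one]
    simpa using hX
  | mul x y hx hy ihx ihy =>
    intro X hX
    have : (⟨x * y, mul_mem hx hy⟩ : matrixGroup D.𝔤) = ⟨x, hx⟩ * ⟨y, hy⟩ := rfl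
    obtain ⟨h1, h2⟩ := ihy X hX
    obtain ⟨h3, h4⟩ := ihx _ h1
    rw [this, map_mul D.σG, gmat_mul, gmat_mul, Matrix.mul_inv_rev, Matrix.mul_inv_rev]
    rw [h2] at h4
    simp only [mul_assoc] at h3 h4 ⊢
    exact ⟨h3, h4⟩

theorem conj_mem (g : matrixGroup D.𝔤) {X : Mat m} (hX : X ∈ D.𝔤) :
    gmat g * X * (gmat g)⁻¹ ∈ D.𝔤 := (D.conj_mem_and g hX).1

theorem conj_mem_grade {g : matrixGroup D.𝔤} (hg : D.σG g = g) {k : ℤ} {X : Mat m}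
    (hX : X ∈ D.grade k) : gmat g * X * (gmat g)⁻¹ ∈ D.grade k := by
  have h := D.conj_mem_and g hX.1
  refine D.mem_grade_iff.2 ⟨h.1, ?_⟩
  rw [h.2, hg, (D.mem_grade_iff.1 hX).2]
  simp

end GaudinData

/-! ### Equivariant functions -/

/-- Regularity of all entries at a point. -/
def RegM {m : ℕ} (z : ℂ) (f : RatMat m) : Prop := ∀ a b, Reg z (f a b)

section evalAt

variable {m : ℕ} {z : ℂ} {f g : RatMat m}

theorem evalAt_apply (f : RatMat m) (a b) : evalAt z f a b = ev z (f a b) := rfl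

theorem RegM.add (hf : RegM z f) (hg : RegM z g) : RegM z (f + g) := fun a b => (hf a b).add (hg a b)
theorem RegM.sub (hf : RegM z f) (hg : RegM z g) : RegM z (f - g) := fun a b => (hf a b).sub (hg a b)
theorem RegM.neg (hf : RegM z f) : RegM z (-f) := fun a b => (hf a b).neg
theorem regM_zero : RegM z (0 : RatMat m) := fun _ _ => reg_zero z
theorem RegM.mul (hf : RegM z f) (hg : RegM z g) : RegM z (f * g) := fun a b => by
  rw [Matrix.mul_apply]
  exact Reg.sum _ fun i _ => (hf a i).mul (hg i b)
theorem RegM.smul {c : RatFunc ℂ} (hc : Reg z c) (hf : RegM z f) : RegM z (c • f) :=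
  fun a b => hc.mul (hf a b)
theorem regM_const (B : Mat m) : RegM z (B.map RatFunc.C) := fun _ _ => reg_C _ _
theorem RegM.sum {ι : Type*} (s : Finset ι) {f : ι → RatMat m} (hf : ∀ i ∈ s, RegM z (f i)) :
    RegM z (∑ i ∈ s, f i) := fun a b => by
  rw [Matrix.sum_apply]
  exact Reg.sum _ fun i hi => hf i hi a b

theorem evalAt_add (hf : RegM z f) (hg : RegM z g) :
    evalAt z (f + g) = evalAt z f + evalAt z g :=
  Matrix.ext fun a b => ev_add (hf a b) (hg a b)
theorem evalAt_sub (hf : RegM z f) (hg : RegM z g) :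
    evalAt z (f - g) = evalAt z f - evalAt z g :=
  Matrix.ext fun a b => ev_sub (hf a b) (hg a b)
theorem evalAt_neg (hf : RegM z f) : evalAt z (-f) = -evalAt z f :=
  Matrix.ext fun a b => ev_neg (hf a b)
theorem evalAt_zero : evalAt z (0 : RatMat m) = 0 := Matrix.ext fun _ _ => ev_zero
theorem evalAt_mul (hf : RegM z f) (hg : RegM z g) :
    evalAt z (f * g) = evalAt z f * evalAt z g := Matrix.ext fun a b => by
  rw [evalAt_apply, Matrix.mul_apply, Matrix.mul_apply,
    ev_sum _ fun i _ => (hf a i).mul (hg i b)]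
  exact Finset.sum_congr rfl fun i _ => ev_mul (hf a i) (hg i b)
theorem evalAt_smul {c : RatFunc ℂ} (hc : Reg z c) (hf : RegM z f) :
    evalAt z (c • f) = ev z c • evalAt z f := Matrix.ext fun a b => ev_mul hc (hf a b)
theorem evalAt_const (B : Mat m) : evalAt z (B.map RatFunc.C) = B := Matrix.ext fun _ _ => ev_C _
theorem evalAt_sum {ι : Type*} (s : Finset ι) {f : ι → RatMat m} (hf : ∀ i ∈ s, RegM z (f i)) :
    evalAt z (∑ i ∈ s, f i) = ∑ i ∈ s, evalAt z (f i) := Matrix.ext fun a b => by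
  rw [evalAt_apply, Matrix.sum_apply, Matrix.sum_apply, ev_sum _ fun i hi => hf i hi a b]
  rfl

theorem ev_trace (hf : RegM z f) :
    Reg z (Matrix.trace f) ∧ ev z (Matrix.trace f) = Matrix.trace (evalAt z f) :=
  ⟨Reg.sum _ fun i _ => hf i i, ev_sum _ fun i _ => hf i i⟩

theorem ratMat_ext {S : Set ℂ} (hS : S.Finite) (hf : ∀ z ∉ S, RegM z f) (hg : ∀ z ∉ S, RegM z g)
    (h : ∀ z ∉ S, evalAt z f = evalAt z g) : f = g := by
  refine Matrix.ext fun a b => ?_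
  rw [← sub_eq_zero]
  refine eq_zero_of_ev hS _ (fun z hz => (hf z hz a b).sub (hg z hz a b)) fun z hz => ?_
  rw [ev_sub (hf z hz a b) (hg z hz a b), sub_eq_zero]
  exact congr_fun (congr_fun (h z hz) a) b

theorem lin_apply (S : Mat m →ₗ[ℂ] Mat m) (M : Mat m) (a b) :
    S M a b = ∑ c, ∑ d, S (Matrix.single c d 1) a b * M c d := by
  conv_lhs => rw [Matrix.matrix_eq_sum_single M]
  simp only [map_sum, Matrix.sum_apply]
  refine Finset.sum_congr rfl fun c _ => Finset.sum_congr rfl fun d _ => ?_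
  have : Matrix.single c d (M c d) = M c d • Matrix.single c d (1 : ℂ) := by simp
  rw [this, map_smul, Matrix.smul_apply, smul_eq_mul, mul_comm]

/-- The extension of a linear map on matrices to matrices of rational functions. -/
noncomputable def ratLin (S : Mat m →ₗ[ℂ] Mat m) (f : RatMat m) : RatMat m :=
  Matrix.of fun a b => ∑ c, ∑ d, RatFunc.C (S (Matrix.single c d 1) a b) * f c d

theorem RegM.ratLin (S : Mat m →ₗ[ℂ] Mat m) (hf : RegM z f) : RegM z (CyclotomicGaudin.ratLin S f) := fun a b => by
  rw [CyclotomicGaudin.ratLin, Matrix.of_apply]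
  exact Reg.sum _ fun c _ => Reg.sum _ fun d _ => (reg_C _ _).mul (hf c d)

theorem evalAt_ratLin (S : Mat m →ₗ[ℂ] Mat m) (hf : RegM z f) :
    evalAt z (ratLin S f) = S (evalAt z f) := Matrix.ext fun a b => by
  rw [lin_apply, evalAt_apply, CyclotomicGaudin.ratLin, Matrix.of_apply,
    ev_sum _ fun c _ => Reg.sum _ fun d _ => (reg_C _ _).mul (hf c d)]
  refine Finset.sum_congr rfl fun c _ => ?_
  rw [ev_sum _ fun d _ => (reg_C _ _).mul (hf c d)]
  refine Finset.sum_congr rfl fun d _ => ?_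
  rw [ev_mul (reg_C _ _) (hf c d), ev_C]
  rfl

end evalAt

namespace GaudinData

variable {m N T : ℕ} (D : GaudinData m N T)

section expand

variable (f g : RatMat m) (r : Pt N)

theorem expand_add : D.expand (f + g) r = D.expand f r + D.expand g r := by
  simp only [expand_eq]
  exact Matrix.map_add _ (map_add _) f g
theorem expand_sub : D.expand (f - g) r = D.expand f r - D.expand g r := by
  simp only [expand_eq]
  exact Matrix.map_sub _ (map_sub _) f g
theorem expand_zero : D.expand (0 : RatMat m) r = 0 := by
  simp only [expand_eq]
  exact Matrix.ext fun a b => map_zero (D.expandHom r)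
theorem expand_mul : D.expand (f * g) r = D.expand f r * D.expand g r := by
  simp only [expand_eq]
  exact Matrix.map_mul
theorem expand_smul (c : RatFunc ℂ) : D.expand (c • f) r = D.expandHom r c • D.expand f r := by
  simp only [expand_eq]
  exact Matrix.ext fun a b => map_mul (D.expandHom r) c (f a b)
theorem expand_sum {ι : Type*} (s : Finset ι) (f : ι → RatMat m) :
    D.expand (∑ i ∈ s, f i) r = ∑ i ∈ s, D.expand (f i) r := by
  simp only [expand_eq]
  refine Matrix.ext fun a b => ?_
  simp [Matrix.sum_apply]
theorem expand_const (B : Mat m) : D.expand (B.map RatFunc.C) r = B.map HahnSeries.C := by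
  simp only [expand_eq]
  refine Matrix.ext fun a b => ?_
  simp

theorem expand_trace : D.expandHom r (Matrix.trace f) = Matrix.trace (D.expand f r) := by
  rw [expand_eq, Matrix.trace, map_sum]
  rfl

theorem lcoeff_expand_ratLin (S : Mat m →ₗ[ℂ] Mat m) (j : ℤ) :
    lcoeff (D.expand (ratLin S f) r) j = S (lcoeff (D.expand f r) j) := by
  refine Matrix.ext fun a b => ?_
  rw [lin_apply]
  simp only [expand_eq, lcoeff_apply, Matrix.map_apply, ratLin, Matrix.of_apply, map_sum, map_mul,
    expandHom_C, HahnSeries.coeff_sum, HahnSeries.C_mul_eq_smul, HahnSeries.coeff_smul, smul_eq_mul]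

end expand

theorem isEquivariant_iff {k : ℤ} {f : RatMat m} : D.IsEquivariant k f ↔
    ∀ z, z ∉ D.finitePoles → RegM z f ∧ evalAt z f ∈ D.𝔤 ∧
      D.sig 1 (evalAt z f) = D.ω ^ k • evalAt (D.ω * z) f := by
  refine forall₂_congr fun z _ => and_congr Iff.rfl ?_
  constructor
  · rintro ⟨h, h'⟩
    exact ⟨h, by rw [D.sig_one h, h']⟩
  · rintro ⟨h, h'⟩
    exact ⟨h, by rw [← D.sig_one h, h']⟩

variable {D}

theorem IsEquivariant.regM {k : ℤ} {f : RatMat m} (hf : D.IsEquivariant k f) {z : ℂ}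
    (hz : z ∉ D.finitePoles) : RegM z f := (D.isEquivariant_iff.1 hf z hz).1

theorem IsEquivariant.mem {k : ℤ} {f : RatMat m} (hf : D.IsEquivariant k f) {z : ℂ}
    (hz : z ∉ D.finitePoles) : evalAt z f ∈ D.𝔤 := (D.isEquivariant_iff.1 hf z hz).2.1

theorem IsEquivariant.sig_evalAt {k : ℤ} {f : RatMat m} (hf : D.IsEquivariant k f) {z : ℂ}
    (hz : z ∉ D.finitePoles) : D.sig 1 (evalAt z f) = D.ω ^ k • evalAt (D.ω * z) f :=
  (D.isEquivariant_iff.1 hf z hz).2.2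

theorem IsEquivariant.add {k : ℤ} {f g : RatMat m} (hf : D.IsEquivariant k f)
    (hg : D.IsEquivariant k g) : D.IsEquivariant k (f + g) := by
  rw [isEquivariant_iff]
  intro z hz
  have hz' := D.mul_mem_finitePoles hz
  rw [evalAt_add (hf.regM hz) (hg.regM hz), evalAt_add (hf.regM hz') (hg.regM hz'), map_add,
    hf.sig_evalAt hz, hg.sig_evalAt hz, smul_add]
  exact ⟨(hf.regM hz).add (hg.regM hz), D.𝔤.add_mem (hf.mem hz) (hg.mem hz), rfl⟩

theorem IsEquivariant.neg {k : ℤ} {f : RatMat m} (hf : D.IsEquivariant k f) :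
    D.IsEquivariant k (-f) := by
  rw [isEquivariant_iff]
  intro z hz
  have hz' := D.mul_mem_finitePoles hz
  rw [evalAt_neg (hf.regM hz), evalAt_neg (hf.regM hz'), map_neg, hf.sig_evalAt hz, smul_neg]
  exact ⟨(hf.regM hz).neg, D.𝔤.neg_mem (hf.mem hz), rfl⟩

theorem IsEquivariant.sub {k : ℤ} {f g : RatMat m} (hf : D.IsEquivariant k f)
    (hg : D.IsEquivariant k g) : D.IsEquivariant k (f - g) := by
  rw [sub_eq_add_neg]
  exact hf.add hg.neg

theorem isEquivariant_zero (k : ℤ) : D.IsEquivariant k (0 : RatMat m) := by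
  rw [isEquivariant_iff]
  intro z hz
  simp only [evalAt_zero, map_zero, smul_zero, and_true]
  exact ⟨regM_zero, D.𝔤.zero_mem⟩

theorem IsEquivariant.sum {ι : Type*} (s : Finset ι) {k : ℤ} {f : ι → RatMat m}
    (hf : ∀ i ∈ s, D.IsEquivariant k (f i)) : D.IsEquivariant k (∑ i ∈ s, f i) := by
  classical
  induction s using Finset.induction_on with
  | empty => simpa using isEquivariant_zero k
  | insert a s ha ih =>
    rw [Finset.sum_insert ha]
    exact (hf _ (by simp)).add (ih fun i hi => hf i (by simp [hi]))

theorem IsEquivariant.smul {k : ℤ} {f : RatMat m} (hf : D.IsEquivariant k f) (c : ℂ) :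
    D.IsEquivariant k (RatFunc.C c • f) := by
  rw [isEquivariant_iff]
  intro z hz
  have hz' := D.mul_mem_finitePoles hz
  rw [evalAt_smul (reg_C _ _) (hf.regM hz), evalAt_smul (reg_C _ _) (hf.regM hz'), ev_C, ev_C,
    map_smul, hf.sig_evalAt hz, smul_comm]
  exact ⟨(hf.regM hz).smul (reg_C _ _), D.𝔤.smul_mem _ (hf.mem hz), rfl⟩

theorem IsEquivariant.lie {j k : ℤ} {f g : RatMat m} (hf : D.IsEquivariant j f)
    (hg : D.IsEquivariant k g) : D.IsEquivariant (j + k) (f * g - g * f) := by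
  rw [isEquivariant_iff]
  intro z hz
  have hz' := D.mul_mem_finitePoles hz
  have h : ∀ {z}, z ∉ D.finitePoles → evalAt z (f * g - g * f) = ⁅evalAt z f, evalAt z g⁆ := by
    intro z hz
    rw [evalAt_sub ((hf.regM hz).mul (hg.regM hz)) ((hg.regM hz).mul (hf.regM hz)),
      evalAt_mul (hf.regM hz) (hg.regM hz), evalAt_mul (hg.regM hz) (hf.regM hz), Ring.lie_def]
  refine ⟨((hf.regM hz).mul (hg.regM hz)).sub ((hg.regM hz).mul (hf.regM hz)), ?_, ?_⟩
  · rw [h hz]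
    exact D.𝔤.lie_mem (hf.mem hz) (hg.mem hz)
  · rw [h hz, h hz', D.sig_lie (hf.mem hz) (hg.mem hz), hf.sig_evalAt hz, hg.sig_evalAt hz,
      zpow_add₀ D.ω_ne_zero]
    simp only [Ring.lie_def, smul_mul_smul_comm, mul_comm (D.ω ^ k), smul_sub]

/-- The values only tell that f is `𝔤`-valued away from the poles. But f then equals its own
projection to `𝔤` as a rational function, and a linear map commutes with taking Laurent
coefficients. -/
theorem IsEquivariant.coeff_mem {k : ℤ} {f : RatMat m} (hf : D.IsEquivariant k f) (r : Pt N)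
    (j : ℤ) : lcoeff (D.expand f r) j ∈ D.𝔤 := by
  have h : ratLin (D.𝔤.toSubmodule.subtype ∘ₗ D.proj) f = f := by
    refine ratMat_ext D.finitePoles_finite (fun z hz => (hf.regM hz).ratLin _)
      (fun z hz => hf.regM hz) fun z hz => ?_
    rw [evalAt_ratLin _ (hf.regM hz), LinearMap.comp_apply, D.proj_of_mem (hf.mem hz)]
    rfl
  rw [← h, lcoeff_expand_ratLin]
  exact (D.proj _).2

/-- Upgrades the pointwise equivariance to an identity of rational functions, which can then be
expanded at 0 and ∞. -/
theorem IsEquivariant.ratLin_eq {k : ℤ} {f : RatMat m} (hf : D.IsEquivariant k f) :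
    ratLin (D.sig 1) f = RatFunc.C (D.ω ^ k) • f.map (scaleHom D.ω D.ω_ne_zero) := by
  have h1 : ∀ z ∉ D.finitePoles, RegM z (f.map (scaleHom D.ω D.ω_ne_zero)) := fun z hz a b =>
    (scaleHom_reg_ev D.ω_ne_zero (hf.regM (D.mul_mem_finitePoles hz) a b)).1
  refine ratMat_ext D.finitePoles_finite (fun z hz => (hf.regM hz).ratLin _)
    (fun z hz => (h1 z hz).smul (reg_C _ _)) fun z hz => ?_
  rw [evalAt_ratLin _ (hf.regM hz), hf.sig_evalAt hz, evalAt_smul (reg_C _ _) (h1 z hz), ev_C]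
  congr 1
  refine Matrix.ext fun a b => ?_
  exact (scaleHom_reg_ev D.ω_ne_zero (hf.regM (D.mul_mem_finitePoles hz) a b)).2.symm

theorem IsEquivariant.isLoop {k : ℤ} {f : RatMat m} (hf : D.IsEquivariant k f) :
    D.IsLoop k (D.expand f) := by
  refine ⟨fun j => ?_, fun r j => hf.coeff_mem _ j, fun j => ?_⟩
  · refine D.mem_grade_iff.2 ⟨hf.coeff_mem _ j, ?_⟩
    rw [← lcoeff_expand_ratLin, hf.ratLin_eq, expand_smul, expandHom_C]
    refine Matrix.ext fun a b => ?_
    simp only [lcoeff_apply, Matrix.smul_apply, smul_eq_mul, expand_eq, Matrix.map_apply,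
      expandHom_zero_scaleHom, HahnSeries.C_mul_eq_smul, HahnSeries.coeff_smul, coeff_rescale]
    rw [zpow_add₀ D.ω_ne_zero, mul_assoc]
  · refine D.mem_grade_iff.2 ⟨hf.coeff_mem _ j, ?_⟩
    rw [← lcoeff_expand_ratLin, hf.ratLin_eq, expand_smul, expandHom_C]
    refine Matrix.ext fun a b => ?_
    simp only [lcoeff_apply, Matrix.smul_apply, smul_eq_mul, expand_eq, Matrix.map_apply,
      expandHom_infty_scaleHom, HahnSeries.C_mul_eq_smul, HahnSeries.coeff_smul, coeff_rescale]
    rw [sub_eq_add_neg, zpow_add₀ D.ω_ne_zero, mul_assoc, inv_zpow, zpow_neg]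

theorem continuousAt_ev {b : ℂ} {x : RatFunc ℂ} (hx : Reg b x) : ContinuousAt (fun z => ev z x) b :=
  x.num.continuous.continuousAt.div x.denom.continuous.continuousAt hx

/-- Only one representative of each orbit is a marked point, so regularity must be carried along
orbits. Clearing the denominator in ω^k f(ωz) = σ f(z) and letting z → b, a zero of the denominator
at ωb would force a zero of the numerator. -/
theorem IsEquivariant.regM_mul {k : ℤ} {f : RatMat m} (hf : D.IsEquivariant k f) {b : ℂ}
    (hb : RegM b f) : RegM (D.ω * b) f := by
  intro i j h0
  -- The point b may belong to `finitePoles`, where equivariance gives nothing; it is isolated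
  -- there, so a punctured neighbourhood is used.
  have hev : ∀ᶠ z in nhdsWithin b {b}ᶜ, z ∉ D.finitePoles := by
    have h1 : IsClosed (D.finitePoles \ {b}) :=
      (D.finitePoles_finite.subset Set.sdiff_subset).isClosed
    have h2 : (D.finitePoles \ {b})ᶜ ∈ nhds b := h1.isOpen_compl.mem_nhds (by simp)
    filter_upwards [mem_nhdsWithin_of_mem_nhds h2, self_mem_nhdsWithin] with z hz hz' hz''
    exact hz ⟨hz'', hz'⟩
  have hs : Filter.Tendsto (fun z => (D.sig 1 (evalAt z f)) i j) (nhds b)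
      (nhds ((D.sig 1 (evalAt b f)) i j)) := by
    simp only [lin_apply (D.sig 1) (evalAt _ f)]
    exact tendsto_finsetSum _ fun c _ => tendsto_finsetSum _ fun d _ =>
      tendsto_const_nhds.mul (continuousAt_ev (hb c d)).tendsto
  have hden : ContinuousAt (fun z => (f i j).denom.eval (D.ω * z)) b :=
    ((f i j).denom.continuous.comp (continuous_const.mul continuous_id)).continuousAt
  have hnum : ContinuousAt (fun z => D.ω ^ k * (f i j).num.eval (D.ω * z)) b :=
    (continuous_const.mul
      ((f i j).num.continuous.comp (continuous_const.mul continuous_id))).continuousAt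
  have t1 := (hden.tendsto.mul hs).mono_left (nhdsWithin_le_nhds (s := {b}ᶜ))
  have t2 := hnum.tendsto.mono_left (nhdsWithin_le_nhds (s := {b}ᶜ))
  have t3 := t1.congr' (f₂ := fun z => D.ω ^ k * (f i j).num.eval (D.ω * z)) (by
    filter_upwards [hev] with z hz
    rw [hf.sig_evalAt hz, Matrix.smul_apply, smul_eq_mul, evalAt_apply, ev_eq, mul_left_comm,
      mul_div_cancel₀ _ (hf.regM (D.mul_mem_finitePoles hz) i j)])
  have t4 := tendsto_nhds_unique t2 t3
  rw [h0, zero_mul, mul_eq_zero] at t4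
  have h1 := t4.resolve_left (zpow_ne_zero _ D.ω_ne_zero)
  obtain ⟨u, v, huv⟩ := RatFunc.isCoprime_num_denom (f i j)
  have := congr_arg (Polynomial.eval (D.ω * b)) huv
  simp [h0, h1] at this

/-- Liouville's theorem: without polar parts at the marked points f has no finite pole at all, and
it vanishes at infinity. All uniqueness statements rest on this. -/
theorem IsEquivariant.eq_zero {k : ℤ} {f : RatMat m} (hf : D.IsEquivariant k f)
    (hfin : ∀ r : Pt N, r ≠ .infty → ∀ j < 0, lcoeff (D.expand f r) j = 0)
    (hinf : ∀ j < 1, lcoeff (D.expand f .infty) j = 0) : f = 0 := by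
  have h1 : ∀ r : Pt N, r ≠ .infty → RegM (D.base r) f := by
    intro r hr a b
    refine D.reg_of_vanishBelow hr _ fun j hj => ?_
    have := congr_fun (congr_fun (hfin r hr j hj) a) b
    rwa [expand_eq] at this
  have h2 : ∀ z, RegM z f := by
    intro z
    by_cases hz : z ∈ D.finitePoles
    · obtain rfl | ⟨r, k, rfl⟩ := hz
      · exact h1 .zero (by simp)
      · induction k with
        | zero => simpa [base] using h1 (.pt r) (by simp)
        | succ k ih =>
          rw [pow_succ', mul_assoc]
          exact hf.regM_mul ih
    · exact hf.regM hz
  refine Matrix.ext fun a b => D.eq_zero_of_reg _ (fun z => h2 z a b) fun j hj => ?_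
  have := congr_fun (congr_fun (hinf j hj) a) b
  rwa [expand_eq] at this

end GaudinData

/-! ### Building blocks of equivariant functions -/

/-- The lowest degree of the positive part at a marked point. -/
def lowIdx {N : ℕ} : Pt N → ℤ
  | .infty => 1
  | _ => 0

/-- The function `Bλⁿ`. -/
noncomputable def monoBlock {m : ℕ} (n : ℤ) (B : Mat m) : RatMat m :=
  ((RatFunc.X : RatFunc ℂ) ^ n) • B.map RatFunc.C

/-- The function `B(λ - a)⁻ⁿ`. -/
noncomputable def poleBlock {m : ℕ} (a : ℂ) (n : ℕ) (B : Mat m) : RatMat m :=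
  ((RatFunc.X - RatFunc.C a : RatFunc ℂ)⁻¹ ^ n) • B.map RatFunc.C

section blocks

variable {m : ℕ}

theorem monoBlock_regM {z : ℂ} (hz : z ≠ 0) (n : ℤ) (B : Mat m) : RegM z (monoBlock n B) :=
  (regM_const B).smul (reg_X_zpow hz n)

theorem evalAt_monoBlock {z : ℂ} (hz : z ≠ 0) (n : ℤ) (B : Mat m) :
    evalAt z (monoBlock n B) = z ^ n • B := by
  rw [monoBlock, evalAt_smul (reg_X_zpow hz n) (regM_const B), ev_X_zpow hz, evalAt_const]

theorem poleBlock_regM {z a : ℂ} (hz : z ≠ a) (n : ℕ) (B : Mat m) : RegM z (poleBlock a n B) :=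
  (regM_const B).smul ((reg_inv_X_sub_C hz).pow n)

theorem evalAt_poleBlock {z a : ℂ} (hz : z ≠ a) (n : ℕ) (B : Mat m) :
    evalAt z (poleBlock a n B) = (z - a)⁻¹ ^ n • B := by
  rw [poleBlock, evalAt_smul ((reg_inv_X_sub_C hz).pow n) (regM_const B),
    ev_pow (reg_inv_X_sub_C hz), ev_inv_X_sub_C hz, evalAt_const]

end blocks

namespace GaudinData

variable {m N T : ℕ} (D : GaudinData m N T)

/-- The equivariant function with pole `B(λ - ζ_r)⁻ⁿ` at `ζ_r`. -/
noncomputable def orbitBlock (k : ℤ) (n : ℕ) (r : Fin N) (B : Mat m) : RatMat m :=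
  ∑ l ∈ Finset.range T,
    poleBlock (D.ω ^ l * D.ζ r) n ((D.ω ^ ((n : ℤ) - k)) ^ l • D.sig l B)

theorem monoBlock_isEquivariant {k n : ℤ} {B : Mat m} (hB : B ∈ D.grade (k + n)) :
    D.IsEquivariant k (monoBlock n B) := by
  rw [isEquivariant_iff]
  intro z hz
  have hz0 := D.ne_zero_of_not_mem hz
  rw [evalAt_monoBlock hz0, evalAt_monoBlock (mul_ne_zero D.ω_ne_zero hz0)]
  refine ⟨monoBlock_regM hz0 n B, D.𝔤.smul_mem _ hB.1, ?_⟩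
  rw [map_smul, (D.mem_grade_iff.1 hB).2, smul_smul, smul_smul, mul_zpow, zpow_add₀ D.ω_ne_zero]
  congr 1
  ring

theorem orbitBlock_regM {z : ℂ} (hz : z ∉ D.finitePoles) (k : ℤ) (n : ℕ) (r : Fin N) (B : Mat m) :
    RegM z (D.orbitBlock k n r B) :=
  RegM.sum _ fun l _ => poleBlock_regM (D.ne_of_not_mem hz r l) _ _

theorem evalAt_orbitBlock {z : ℂ} (hz : z ∉ D.finitePoles) (k : ℤ) (n : ℕ) (r : Fin N)
    (B : Mat m) : evalAt z (D.orbitBlock k n r B) = ∑ l ∈ Finset.range T,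
      (z - D.ω ^ l * D.ζ r)⁻¹ ^ n • (D.ω ^ ((n : ℤ) - k)) ^ l • D.sig l B := by
  rw [orbitBlock, evalAt_sum _ fun l _ => poleBlock_regM (D.ne_of_not_mem hz r l) _ _]
  exact Finset.sum_congr rfl fun l _ => evalAt_poleBlock (D.ne_of_not_mem hz r l) _ _

/-- σ sends the l-th summand at z to the (l+1)-st at ωz up to a scalar. The pole of order n scales
by ω^{-n}, and the factor ω^{n-k} attached to each step compensates it to leave ω^k. For n = k = 1
this factor is 1, as in the Lax matrix. -/
theorem orbitBlock_isEquivariant (k : ℤ) (n : ℕ) (r : Fin N) (B : Mat m) :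
    D.IsEquivariant k (D.orbitBlock k n r B) := by
  rw [isEquivariant_iff]
  intro z hz
  refine ⟨D.orbitBlock_regM hz k n r B, ?_, ?_⟩
  · rw [evalAt_orbitBlock _ hz]
    exact sum_mem fun l _ => D.𝔤.smul_mem _ (D.𝔤.smul_mem _ (D.sig_mem l B))
  · rw [evalAt_orbitBlock _ hz, evalAt_orbitBlock _ (D.mul_mem_finitePoles hz), map_sum,
      Finset.smul_sum]
    rw [← sum_range_shift (T := T) fun l => D.ω ^ k •
      (D.ω * z - D.ω ^ l * D.ζ r)⁻¹ ^ n • (D.ω ^ ((n : ℤ) - k)) ^ l • D.sig l B]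
    · refine Finset.sum_congr rfl fun l _ => ?_
      rw [map_smul, map_smul, ← sig_succ, pow_succ' D.ω l, mul_assoc, ← mul_sub, mul_inv, mul_pow,
        smul_smul, smul_smul, smul_smul]
      congr 1
      have h1 : D.ω ^ ((n : ℤ) - k) = D.ω ^ n * (D.ω ^ k)⁻¹ := by
        rw [zpow_sub₀ D.ω_ne_zero, zpow_natCast, div_eq_mul_inv]
      have h2 : D.ω ^ k * (D.ω ^ k)⁻¹ = 1 := mul_inv_cancel₀ (zpow_ne_zero _ D.ω_ne_zero)
      have h3 : (D.ω ^ n)⁻¹ * D.ω ^ n = 1 := inv_mul_cancel₀ (pow_ne_zero _ D.ω_ne_zero)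
      rw [pow_succ (D.ω ^ ((n : ℤ) - k)) l]
      nth_rewrite 3 [h1]
      rw [inv_pow]
      linear_combination -((z - D.ω ^ l * D.ζ r)⁻¹ ^ n * (D.ω ^ ((n : ℤ) - k)) ^ l) *
        ((D.ω ^ n)⁻¹ * D.ω ^ n * h2 + h3)
    · have h1 : (D.ω ^ ((n : ℤ) - k)) ^ T = 1 := by
        rw [← zpow_natCast, ← zpow_mul, mul_comm, zpow_mul, zpow_natCast, D.ω_pow_T, one_zpow]
      have h2 : D.sig T B = D.sig 0 B := by
        have := D.σ_iterate (D.proj B)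
        simp only [sig, LinearMap.comp_apply, Module.End.pow_apply]
        exact congr_arg Subtype.val this
      simp only [h1, h2, pow_zero, D.ω_pow_T]

theorem lcoeff_of_regM {f : RatMat m} {r : Pt N} (hr : r ≠ .infty) (hf : RegM (D.base r) f) {j : ℤ}
    (hj : j < 0) : lcoeff (D.expand f r) j = 0 := by
  refine Matrix.ext fun a b => ?_
  rw [expand_eq]
  exact D.vanishBelow_of_reg hr _ (hf a b) j hj

theorem lcoeff_monoBlock_zero (n : ℤ) (B : Mat m) (j : ℤ) :
    lcoeff (D.expand (monoBlock n B) .zero) j = if j = n then B else 0 := by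
  rw [monoBlock, expand_smul, map_zpow₀, expandHom_X, expand_const, ← lcoeff_lmono]
  congr 1
  refine Matrix.ext fun a b => ?_
  have h : (HahnSeries.single 1 (1 : ℂ)) ^ n = HahnSeries.single n 1 :=
    (RatFunc.single_zpow n).symm
  simp only [coord, Matrix.smul_apply, Matrix.map_apply, smul_eq_mul, lmono]
  rw [h, mul_comm, HahnSeries.C_apply, HahnSeries.single_mul_single, zero_add, mul_one]

theorem lcoeff_monoBlock_infty (n : ℤ) (B : Mat m) (j : ℤ) :
    lcoeff (D.expand (monoBlock n B) .infty) j = if j = -n then B else 0 := by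
  rw [monoBlock, expand_smul, map_zpow₀, expandHom_X, expand_const, ← lcoeff_lmono]
  congr 1
  refine Matrix.ext fun a b => ?_
  have h : (HahnSeries.single (-1) (1 : ℂ)) ^ n = HahnSeries.single (-n) 1 := by
    have h1 : HahnSeries.single (-1 : ℤ) (1 : ℂ) = (HahnSeries.single 1 1)⁻¹ := by simp
    rw [h1, inv_zpow, ← zpow_neg]
    exact (RatFunc.single_zpow (-n)).symm
  simp only [coord, Matrix.smul_apply, Matrix.map_apply, smul_eq_mul, lmono]
  rw [h, mul_comm, HahnSeries.C_apply, HahnSeries.single_mul_single, zero_add, mul_one]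

theorem lcoeff_monoBlock_pt (n : ℤ) (B : Mat m) (s : Fin N) {j : ℤ} (hj : j < 0) :
    lcoeff (D.expand (monoBlock n B) (.pt s)) j = 0 :=
  D.lcoeff_of_regM (r := .pt s) (by simp) (monoBlock_regM (D.ζ_ne_zero s) n B) hj

theorem lcoeff_poleBlock_self (r : Fin N) (n : ℕ) (B : Mat m) (j : ℤ) :
    lcoeff (D.expand (poleBlock (D.ζ r) n B) (.pt r)) j = if j = -n then B else 0 := by
  rw [poleBlock, expand_smul, map_pow, map_inv₀, map_sub, expandHom_X, expandHom_C, expand_const,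
    ← lcoeff_lmono]
  congr 1
  refine Matrix.ext fun a b => ?_
  simp only [coord, Matrix.smul_apply, Matrix.map_apply, smul_eq_mul, lmono, add_sub_cancel_left]
  rw [inv_pow, HahnSeries.single_pow, mul_comm, HahnSeries.C_apply, HahnSeries.inv_single,
    HahnSeries.single_mul_single]
  simp

theorem vanishBelow_smul_const {k : ℤ} {x : LaurentSeries ℂ} (hx : VanishBelow k x) (B : Mat m)
    {j : ℤ} (hj : j < k) : lcoeff (x • B.map HahnSeries.C) j = 0 := by
  refine Matrix.ext fun a b => ?_
  simp only [lcoeff_apply, Matrix.smul_apply, Matrix.map_apply, smul_eq_mul]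
  rw [mul_comm, HahnSeries.C_mul_eq_smul, HahnSeries.coeff_smul, hx j hj]
  simp

theorem lcoeff_poleBlock_infty (a : ℂ) {n : ℕ} (B : Mat m) {j : ℤ} (hj : j < n) :
    lcoeff (D.expand (poleBlock a n B) .infty) j = 0 := by
  rw [poleBlock, expand_smul, map_pow, expand_const]
  refine vanishBelow_smul_const ((D.vanishBelow_infty a).pow n) B ?_
  simpa using hj

theorem lcoeff_poleBlock_one_infty (a : ℂ) (B : Mat m) :
    lcoeff (D.expand (poleBlock a 1 B) .infty) 1 = B := by
  rw [poleBlock, expand_smul, pow_one, expand_const]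
  refine Matrix.ext fun u v => ?_
  simp only [lcoeff_apply, Matrix.smul_apply, Matrix.map_apply, smul_eq_mul]
  rw [mul_comm, HahnSeries.C_mul_eq_smul, HahnSeries.coeff_smul, D.coeff_infty]
  simp

theorem lcoeff_orbitBlock_zero (k : ℤ) (n : ℕ) (r : Fin N) (B : Mat m) {j : ℤ} (hj : j < 0) :
    lcoeff (D.expand (D.orbitBlock k n r B) .zero) j = 0 :=
  D.lcoeff_of_regM (r := .zero) (by simp) (RegM.sum _ fun l _ => poleBlock_regM
    (mul_ne_zero (pow_ne_zero _ D.ω_ne_zero) (D.ζ_ne_zero r)).symm _ _) hj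

theorem lcoeff_orbitBlock_infty (k : ℤ) (n : ℕ) (r : Fin N) (B : Mat m) {j : ℤ} (hj : j < n) :
    lcoeff (D.expand (D.orbitBlock k n r B) .infty) j = 0 := by
  rw [orbitBlock, expand_sum, lcoeff_sum]
  exact Finset.sum_eq_zero fun l _ => D.lcoeff_poleBlock_infty _ _ hj

theorem lcoeff_orbitBlock_pt (k : ℤ) (n : ℕ) (r s : Fin N) {B : Mat m} (hB : B ∈ D.𝔤) {j : ℤ}
    (hj : j < 0) : lcoeff (D.expand (D.orbitBlock k n r B) (.pt s)) j =
      if s = r ∧ j = -n then B else 0 := by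
  rw [orbitBlock, expand_sum, lcoeff_sum]
  have h0 : ∀ l ∈ Finset.range T, ¬ (s = r ∧ l = 0) → lcoeff (D.expand (poleBlock (D.ω ^ l * D.ζ r) n
      ((D.ω ^ ((n : ℤ) - k)) ^ l • D.sig l B)) (.pt s)) j = 0 := by
    intro l hl h
    refine D.lcoeff_of_regM (by simp) (poleBlock_regM (fun h' => ?_) _ _) hj
    exact h (D.orbit_injective (Finset.mem_range.1 hl) h')
  by_cases hs : s = r
  · subst hs
    rw [Finset.sum_eq_single 0 (fun l hl hl0 => h0 l hl (by simp [hl0]))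
      (fun h => absurd (Finset.mem_range.2 D.T_pos) h)]
    simp only [pow_zero, one_mul, one_smul, D.sig_zero hB, true_and]
    exact D.lcoeff_poleBlock_self s n B j
  · rw [if_neg (by simp [hs])]
    exact Finset.sum_eq_zero fun l hl => h0 l hl (by simp [hs])

/-! ### Splitting off principal parts. -/

/-- The space in which the coefficients of a tuple are required to lie. -/
noncomputable def coeffSpace (k : ℤ) : Pt N → ℤ → Submodule ℂ (Mat m)
  | .zero, j => D.gradeSub (k + j)
  | .pt _, _ => D.𝔤.toSubmodule
  | .infty, j => D.gradeSub (k - j)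

theorem isLoop_iff {k : ℤ} {X : Tuple m N} :
    D.IsLoop k X ↔ ∀ r j, lcoeff (X r) j ∈ D.coeffSpace k r j := by
  constructor
  · rintro ⟨h1, h2, h3⟩ (_ | r | _) j
    exacts [h1 j, h2 r j, h3 j]
  · intro h
    exact ⟨h .zero, fun r => h (.pt r), h .infty⟩

theorem isLoopPlus_iff {k : ℤ} {X : Tuple m N} :
    D.IsLoopPlus k X ↔ D.IsLoop k X ∧ ∀ r, ∀ j < lowIdx r, lcoeff (X r) j = 0 := by
  refine and_congr_right fun _ => ?_
  constructor
  · rintro ⟨h1, h2, h3⟩ (_ | r | _)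
    exacts [h1, h2 r, h3]
  · intro h
    exact ⟨h .zero, fun r => h (.pt r), h .infty⟩

variable {D}

theorem IsLoop.sub {k : ℤ} {X Y : Tuple m N} (hX : D.IsLoop k X) (hY : D.IsLoop k Y) :
    D.IsLoop k (X - Y) := by
  rw [isLoop_iff] at *
  intro r j
  rw [Pi.sub_apply, lcoeff_sub]
  exact Submodule.sub_mem _ (hX r j) (hY r j)

theorem lie_mem_coeffSpace {k l : ℤ} {r : Pt N} {i j : ℤ} {X Y : Mat m}
    (hX : X ∈ D.coeffSpace k r i) (hY : Y ∈ D.coeffSpace l r j) :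
    ⁅X, Y⁆ ∈ D.coeffSpace (k + l) r (i + j) := by
  cases r with
  | zero =>
    have := D.lie_mem_grade hX hY
    rwa [show k + i + (l + j) = k + l + (i + j) by ring] at this
  | pt r => exact D.𝔤.lie_mem hX hY
  | infty =>
    have := D.lie_mem_grade hX hY
    rwa [show k - i + (l - j) = k + l - (i + j) by ring] at this

theorem IsLoop.lie {k l : ℤ} {X Y : Tuple m N} (hX : D.IsLoop k X) (hY : D.IsLoop l Y) :
    D.IsLoop (k + l) (X * Y - Y * X) := by
  rw [isLoop_iff] at *
  intro r j
  obtain ⟨a, ha⟩ := exists_lcoeff_eq_zero (X r)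
  obtain ⟨b, hb⟩ := exists_lcoeff_eq_zero (Y r)
  rw [Pi.sub_apply, Pi.mul_apply, Pi.mul_apply, lcoeff_lie ha hb]
  refine Submodule.sum_mem _ fun i _ => ?_
  have := lie_mem_coeffSpace (hX r i) (hY r (j - i))
  rwa [add_sub_cancel] at this

theorem sum_principal {c : ℤ → Mat m} {M : ℕ} (hc : ∀ j < -(M : ℤ), c j = 0) {j : ℤ} (hj : j < 0) :
    (∑ n ∈ Finset.range M, if j = -((n : ℤ) + 1) then c (-((n : ℤ) + 1)) else 0) = c j := by
  by_cases h : j < -(M : ℤ)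
  · rw [hc j h]
    refine Finset.sum_eq_zero fun n hn => if_neg ?_
    have := Finset.mem_range.1 hn
    omega
  -- The summand with -(n + 1) = j.
  · rw [Finset.sum_eq_single (-j - 1).toNat]
    · have : -(((-j - 1).toNat : ℤ) + 1) = j := by omega
      rw [this, if_pos rfl]
    · intro n _ hn
      rw [if_neg]
      omega
    · intro hn
      exact absurd (Finset.mem_range.2 (by omega)) hn

theorem sum_principal_infty {c : ℤ → Mat m} {M : ℕ} (hc : ∀ j < -(M : ℤ), c j = 0) {j : ℤ}
    (hj : j < 1) :
    (∑ n ∈ Finset.range (M + 1), if j = -(n : ℤ) then c (-(n : ℤ)) else 0) = c j := by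
  by_cases h : j < -(M : ℤ)
  · rw [hc j h]
    refine Finset.sum_eq_zero fun n hn => if_neg ?_
    have := Finset.mem_range.1 hn
    omega
  · rw [Finset.sum_eq_single (-j).toNat]
    · have : -((-j).toNat : ℤ) = j := by omega
      rw [this, if_pos rfl]
    · intro n _ hn
      rw [if_neg]
      omega
    · intro hn
      exact absurd (Finset.mem_range.2 (by omega)) hn

theorem exists_nat_bound (X : LMat m) : ∃ M : ℕ, ∀ j < -(M : ℤ), lcoeff X j = 0 := by
  obtain ⟨a, ha⟩ := exists_lcoeff_eq_zero X
  exact ⟨(-a).toNat, fun j hj => ha j (by omega)⟩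

/-- Existence half of the direct sum decomposition. Each polar coefficient is matched by a block
that has no polar part at the other marked points. At infinity the constant term counts as polar, so
the last sum starts at λ⁰. The sum of blocks is kept explicit because the residue theorem is checked
block by block. -/
theorem exists_principal_part {k : ℤ} {X : Tuple m N} (hX : D.IsLoop k X) :
    ∃ M₀ : ℕ, ∃ M : Fin N → ℕ, ∃ Minf : ℕ, 
      let h := ∑ n ∈ Finset.range M₀, monoBlock (-((n : ℤ) + 1)) (lcoeff (X .zero) (-((n : ℤ) + 1)))
        + ∑ r, ∑ n ∈ Finset.range (M r),
            D.orbitBlock k (n + 1) r (lcoeff (X (.pt r)) (-((n : ℤ) + 1)))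
        + ∑ n ∈ Finset.range (Minf + 1), monoBlock n (lcoeff (X .infty) (-(n : ℤ)))
      D.IsEquivariant k h ∧ D.IsLoopPlus k (X - D.expand h) := by
  obtain ⟨M₀, hM₀⟩ := exists_nat_bound (X .zero)
  choose M hM using fun r => exists_nat_bound (X (.pt r))
  obtain ⟨Minf, hMinf⟩ := exists_nat_bound (X .infty)
  refine ⟨M₀, M, Minf, ?_⟩
  intro h
  have hh : D.IsEquivariant k h := by
    refine IsEquivariant.add (IsEquivariant.add ?_ ?_) ?_
    · refine IsEquivariant.sum _ fun n _ => D.monoBlock_isEquivariant (hX.1 _)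
    · exact IsEquivariant.sum _ fun r _ => IsEquivariant.sum _ fun n _ =>
        D.orbitBlock_isEquivariant _ _ _ _
    · refine IsEquivariant.sum _ fun n _ => D.monoBlock_isEquivariant ?_
      have := hX.2.2 (-(n : ℤ))
      rwa [sub_neg_eq_add] at this
  refine ⟨hh, D.isLoopPlus_iff.2 ⟨hX.sub hh.isLoop, ?_⟩⟩
  rintro (_ | s | _) j hj
  · have hj : j < 0 := hj
    rw [Pi.sub_apply, lcoeff_sub, sub_eq_zero]
    simp only [h, expand_add, expand_sum, lcoeff_add, lcoeff_sum, lcoeff_monoBlock_zero,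
      D.lcoeff_orbitBlock_zero _ _ _ _ hj, Finset.sum_const_zero, add_zero]
    rw [sum_principal (c := lcoeff (X .zero)) hM₀ hj, Finset.sum_eq_zero, add_zero]
    intro n _
    rw [if_neg (by omega)]
  · have hj : j < 0 := hj
    rw [Pi.sub_apply, lcoeff_sub, sub_eq_zero]
    simp only [h, expand_add, expand_sum, lcoeff_add, lcoeff_sum,
      D.lcoeff_monoBlock_pt _ _ _ hj, D.lcoeff_orbitBlock_pt _ _ _ _ (hX.2.1 _ _) hj,
      Finset.sum_const_zero, add_zero, zero_add]
    rw [Finset.sum_eq_single s]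
    · simp only [true_and, Nat.cast_add, Nat.cast_one]
      exact (sum_principal (c := lcoeff (X (.pt s))) (hM s) hj).symm
    · intro r _ hr
      refine Finset.sum_eq_zero fun n _ => if_neg ?_
      rintro ⟨rfl, _⟩
      exact hr rfl
    · simp
  · have hj : j < 1 := hj
    rw [Pi.sub_apply, lcoeff_sub, sub_eq_zero]
    simp only [h, expand_add, expand_sum, lcoeff_add, lcoeff_sum, lcoeff_monoBlock_infty]
    rw [sum_principal_infty (c := lcoeff (X .infty)) hMinf hj]
    rw [Finset.sum_eq_zero, Finset.sum_eq_zero]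
    · simp
    · intro r _
      refine Finset.sum_eq_zero fun n _ => D.lcoeff_orbitBlock_infty _ _ _ _ (by push_cast; omega)
    · intro n _
      rw [if_neg (by omega)]

/-! ### The rational functions with the poles of the Lax matrix -/

variable (D)

/-- The space of residues of a Lax matrix. -/
abbrev Residues (m N : ℕ) := Mat m × Mat m × (Fin N → Mat m)

/-- The dynamical part of the Lax matrix, as a linear function of its residues. -/
noncomputable def poleMap (B : Residues m N) : RatMat m :=
  monoBlock (-1) B.1 + monoBlock (-2) B.2.1 +
    RatFunc.C (1 / (T : ℂ)) • ∑ r : Fin N, D.orbitBlock 1 1 r (B.2.2 r)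

/-- The hypothesis is needed since `sigmaPow` is 0 off `𝔤`, while `orbitBlock` uses the linear
extension `sig`. -/
theorem ratLax_eq {B₀ B₁ : Mat m} {B : Fin N → Mat m} {Binf : Mat m} (hB : ∀ r, B r ∈ D.𝔤) :
    D.ratLax B₀ B₁ B Binf = D.poleMap (B₀, B₁, B) + monoBlock 0 Binf := by
  simp only [ratLax, poleMap, monoBlock, orbitBlock, poleBlock]
  simp only [zpow_neg, zpow_one, zpow_zero, one_smul, pow_one, Nat.cast_one, sub_self, one_pow,
    D.sigmaPow_eq _ (hB _)]
  rfl

/-- The residues of elements of the dual Lie algebra. -/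
def IsResidues (B : Residues m N) : Prop :=
  B.1 ∈ D.grade 0 ∧ B.2.1 ∈ D.grade (-1) ∧ ∀ r, B.2.2 r ∈ D.𝔤

variable {D}

theorem IsResidues.poleMap_isEquivariant {B : Residues m N} (hB : D.IsResidues B) :
    D.IsEquivariant 1 (D.poleMap B) := by
  refine IsEquivariant.add (IsEquivariant.add ?_ ?_) (IsEquivariant.smul (IsEquivariant.sum _
    fun r _ => D.orbitBlock_isEquivariant _ _ _ _) _)
  · exact D.monoBlock_isEquivariant (by simpa using hB.1)
  · exact D.monoBlock_isEquivariant (by simpa using hB.2.1)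

variable (D)

theorem lcoeff_poleMap_zero (B : Residues m N) {j : ℤ} (hj : j < 0) :
    lcoeff (D.expand (D.poleMap B) .zero) j =
      (if j = -1 then B.1 else 0) + if j = -2 then B.2.1 else 0 := by
  have : lcoeff (D.expand (RatFunc.C (1 / (T : ℂ)) • ∑ r : Fin N, D.orbitBlock 1 1 r (B.2.2 r))
      .zero) j = 0 := by
    rw [expand_smul, expandHom_C, expand_sum]
    refine Matrix.ext fun a b => ?_
    rw [lcoeff_apply, Matrix.smul_apply, smul_eq_mul, HahnSeries.C_mul_eq_smul,
      HahnSeries.coeff_smul, ← lcoeff_apply, lcoeff_sum,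
      Finset.sum_eq_zero fun r _ => D.lcoeff_orbitBlock_zero _ _ _ _ hj]
    simp
  rw [poleMap, expand_add, expand_add, lcoeff_add, lcoeff_add, this, lcoeff_monoBlock_zero,
    lcoeff_monoBlock_zero, add_zero]

theorem lcoeff_poleMap_pt {B : Residues m N} (hB : ∀ r, B.2.2 r ∈ D.𝔤) (s : Fin N) {j : ℤ}
    (hj : j < 0) : lcoeff (D.expand (D.poleMap B) (.pt s)) j =
      if j = -1 then (T : ℂ)⁻¹ • B.2.2 s else 0 := by
  have : lcoeff (D.expand (RatFunc.C (1 / (T : ℂ)) • ∑ r : Fin N, D.orbitBlock 1 1 r (B.2.2 r))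
      (.pt s)) j = if j = -1 then (T : ℂ)⁻¹ • B.2.2 s else 0 := by
    rw [expand_smul, expandHom_C, expand_sum]
    refine Matrix.ext fun a b => ?_
    rw [lcoeff_apply, Matrix.smul_apply, smul_eq_mul, HahnSeries.C_mul_eq_smul,
      HahnSeries.coeff_smul, ← lcoeff_apply, lcoeff_sum,
      Finset.sum_congr rfl fun r _ => D.lcoeff_orbitBlock_pt 1 1 r s (hB r) hj,
      Finset.sum_eq_single s (fun r _ hr => if_neg fun h => hr h.1.symm) (by simp)]
    by_cases h : j = -1 <;> simp [h]
  rw [poleMap, expand_add, expand_add, lcoeff_add, lcoeff_add, this, D.lcoeff_monoBlock_pt _ _ _ hj,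
    D.lcoeff_monoBlock_pt _ _ _ hj, add_zero, zero_add]

theorem lcoeff_poleMap_infty (B : Residues m N) {j : ℤ} (hj : j < 1) :
    lcoeff (D.expand (D.poleMap B) .infty) j = 0 := by
  have : lcoeff (D.expand (RatFunc.C (1 / (T : ℂ)) • ∑ r : Fin N, D.orbitBlock 1 1 r (B.2.2 r))
      .infty) j = 0 := by
    rw [expand_smul, expandHom_C, expand_sum]
    refine Matrix.ext fun a b => ?_
    rw [lcoeff_apply, Matrix.smul_apply, smul_eq_mul, HahnSeries.C_mul_eq_smul,
      HahnSeries.coeff_smul, ← lcoeff_apply, lcoeff_sum,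
      Finset.sum_eq_zero fun r _ => D.lcoeff_orbitBlock_infty _ _ _ _ (by simpa using hj)]
    simp
  rw [poleMap, expand_add, expand_add, lcoeff_add, lcoeff_add, this, lcoeff_monoBlock_infty,
    lcoeff_monoBlock_infty, if_neg (by omega), if_neg (by omega)]
  simp

end GaudinData

/-! ### The residue theorem -/

namespace GaudinData

variable {m N T : ℕ} (D : GaudinData m N T)

/-- The scalar model with the same marked points. -/
noncomputable def scalarModel : GaudinData 1 N T where
  T_pos := D.T_pos
  ω := D.ω
  primitive := D.primitive
  ζ := D.ζ
  ζ_ne_zero := D.ζ_ne_zero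
  ζ_disjoint := D.ζ_disjoint
  𝔤 := ⊤
  trace_nondegenerate X _ h := by
    have := h 1 (LieSubalgebra.mem_top _)
    ext i j
    rw [Subsingleton.elim i 0, Subsingleton.elim j 0]
    simpa [Matrix.trace] using this
  σ := LieEquiv.refl
  σ_iterate X := by
    have : (⇑(LieEquiv.refl : (⊤ : LieSubalgebra ℂ (Mat 1)) ≃ₗ⁅ℂ⁆ _)) = id := rfl
    rw [this, Function.iterate_id]
    rfl
  σ_trace _ _ := rfl
  σG := MonoidHom.id _
  σG_exp X g h := h
  Λ₀₀ := 0
  Λ₀₁ := 0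
  Λ := 0
  Λinf := 0
  Λ₀₀_mem := ⟨LieSubalgebra.mem_top _, rfl⟩
  Λ₀₁_mem := ⟨LieSubalgebra.mem_top _, by rw [smul_zero]; rfl⟩
  Λ_mem _ := LieSubalgebra.mem_top _
  Λinf_mem := ⟨LieSubalgebra.mem_top _, by rw [smul_zero]; rfl⟩

theorem sig_scalarModel (l : ℕ) (B : Mat 1) : D.scalarModel.sig l B = B := by
  rw [sig_eq _ _ (LieSubalgebra.mem_top B : B ∈ D.scalarModel.𝔤)]
  have : (⇑D.scalarModel.σ) = id := rfl
  rw [this, Function.iterate_id]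
  rfl

/-- The weighted sum of all residues. -/
noncomputable def totalRes (f : RatMat m) : Mat m :=
  (T : ℂ) • ∑ r : Fin N, lcoeff (D.expand f (.pt r)) (-1) + lcoeff (D.expand f .zero) (-1)
    - lcoeff (D.expand f .infty) 1

theorem totalRes_add (f g : RatMat m) : D.totalRes (f + g) = D.totalRes f + D.totalRes g := by
  simp only [totalRes, expand_add, lcoeff_add, Finset.sum_add_distrib, smul_add]
  abel

theorem totalRes_zero : D.totalRes (0 : RatMat m) = 0 := by
  simp [totalRes, expand_zero]

theorem totalRes_sum {ι : Type*} (s : Finset ι) (f : ι → RatMat m) :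
    D.totalRes (∑ i ∈ s, f i) = ∑ i ∈ s, D.totalRes (f i) := by
  classical
  induction s using Finset.induction_on with
  | empty => simp [totalRes_zero]
  | insert a s ha ih => rw [Finset.sum_insert ha, Finset.sum_insert ha, totalRes_add, ih]

theorem totalRes_monoBlock (n : ℤ) (B : Mat m) : D.totalRes (monoBlock n B) = 0 := by
  simp only [totalRes, D.lcoeff_monoBlock_pt n B _ (show (-1 : ℤ) < 0 by norm_num),
    lcoeff_monoBlock_zero, lcoeff_monoBlock_infty, Finset.sum_const_zero, smul_zero, zero_add]
  rw [sub_eq_zero]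
  exact if_congr (by omega) rfl rfl

/-- A simple pole contributes T·B at ζ_r through the weight, and the T poles of its orbit contribute
the same at infinity with the opposite sign. Poles of higher order contribute nothing at either
place. -/
theorem totalRes_orbitBlock_scalarModel (n : ℕ) (r : Fin N) (B : Mat 1) :
    D.scalarModel.totalRes (D.scalarModel.orbitBlock 1 (n + 1) r B) = 0 := by
  have h1 : (-1 : ℤ) < 0 := by norm_num
  simp only [totalRes, D.scalarModel.lcoeff_orbitBlock_zero _ _ _ _ h1,
    D.scalarModel.lcoeff_orbitBlock_pt _ _ _ _
      (LieSubalgebra.mem_top B : B ∈ D.scalarModel.𝔤) h1, add_zero]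
  rw [sub_eq_zero, Finset.sum_eq_single r (fun s _ hs => if_neg fun h => hs h.1) (by simp)]
  rcases n with _ | n
  · simp only [zero_add, Nat.cast_one, true_and, if_true]
    rw [orbitBlock, expand_sum, lcoeff_sum]
    simp only [lcoeff_poleBlock_one_infty, sig_scalarModel, Nat.cast_one, sub_self, zpow_zero,
      one_pow, one_smul, Finset.sum_const, Finset.card_range]
    rw [Nat.cast_smul_eq_nsmul]
  · rw [D.scalarModel.lcoeff_orbitBlock_infty _ _ _ _ (by push_cast; omega), if_neg, smul_zero]
    push_cast
    omega

/-- R is viewed as a 1×1 equivariant one-form with trivial σ. By Liouville it equals the sum of its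
principal parts, and the weighted residues of each block cancel. -/
theorem sum_residues_eq_zero {R : RatFunc ℂ} (hreg : ∀ z ∉ D.finitePoles, Reg z R)
    (heq : ∀ z ∉ D.finitePoles, D.ω * ev (D.ω * z) R = ev z R) :
    (T : ℂ) * ∑ r : Fin N, (D.expandHom (.pt r) R).coeff (-1) + (D.expandHom .zero R).coeff (-1)
      - (D.expandHom .infty R).coeff 1 = 0 := by
  let f : RatMat 1 := Matrix.of fun _ _ => R
  have hf : D.scalarModel.IsEquivariant 1 f := by
    rw [isEquivariant_iff]
    intro z hz
    refine ⟨fun _ _ => hreg z hz, LieSubalgebra.mem_top _, ?_⟩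
    rw [sig_scalarModel, zpow_one]
    exact Matrix.ext fun _ _ => (heq z hz).symm
  obtain ⟨M₀, M, Minf, hh, hplus⟩ := exists_principal_part hf.isLoop
  set h := ∑ n ∈ Finset.range M₀, monoBlock (-((n : ℤ) + 1)) (lcoeff (D.scalarModel.expand f .zero) (-((n : ℤ) + 1)))
        + ∑ r, ∑ n ∈ Finset.range (M r),
            D.scalarModel.orbitBlock 1 (n + 1) r (lcoeff (D.scalarModel.expand f (.pt r)) (-((n : ℤ) + 1)))
        + ∑ n ∈ Finset.range (Minf + 1), monoBlock n (lcoeff (D.scalarModel.expand f .infty) (-(n : ℤ))) with hdef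
  have hfh : f - h = 0 := by
    refine (hf.sub hh).eq_zero (fun r hr j hj => ?_) fun j hj => ?_
    · rw [expand_sub]
      have := (D.scalarModel.isLoopPlus_iff.1 hplus).2 r j
      cases r with
      | zero => exact this hj
      | pt r => exact this hj
      | infty => exact absurd rfl hr
    · rw [expand_sub]
      exact (D.scalarModel.isLoopPlus_iff.1 hplus).2 .infty j hj
  have ht : D.scalarModel.totalRes f = 0 := by
    rw [sub_eq_zero.1 hfh, hdef]
    simp only [totalRes_add, totalRes_sum, totalRes_monoBlock, totalRes_orbitBlock_scalarModel,
      Finset.sum_const_zero, add_zero]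
  have := congr_fun (congr_fun ht 0) 0
  simp only [totalRes, Matrix.sub_apply, Matrix.add_apply, Matrix.smul_apply, Matrix.sum_apply,
    lcoeff_apply, smul_eq_mul, expand_eq, Matrix.map_apply, Matrix.zero_apply] at this
  exact this

/-- Since σ preserves the trace, Tr(gf) dλ is invariant under λ ↦ ωλ. Its residues agree along each
orbit, which is the origin of the weight T, and the pairing is the sum of all residues on the
sphere. -/
theorem pairing_expand_expand {f g : RatMat m} (hg : D.IsEquivariant 1 g)
    (hf : D.IsEquivariant 0 f) : pairing T (D.expand g) (D.expand f) = 0 := by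
  have key := D.sum_residues_eq_zero (R := Matrix.trace (g * f))
    (fun z hz => (ev_trace ((hg.regM hz).mul (hf.regM hz))).1) (by
      intro z hz
      have hz' := D.mul_mem_finitePoles hz
      rw [(ev_trace ((hg.regM hz).mul (hf.regM hz))).2, (ev_trace ((hg.regM hz').mul (hf.regM hz'))).2,
        evalAt_mul (hg.regM hz) (hf.regM hz), evalAt_mul (hg.regM hz') (hf.regM hz'),
        ← D.trace_sig (hg.mem hz) (hf.mem hz) 1, hg.sig_evalAt hz, hf.sig_evalAt hz]
      simp)
  simp only [expand_trace, expand_mul] at key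
  rw [← key, pairing]
  simp only [resAt]
  ring

end GaudinData

/-! ### The pairing and gradients of the invariant functions -/

/-- These instances make matrices of Laurent series a complex algebra for `hasDerivAt_pow` and
`contDiff_pow`. -/
instance : IsScalarTower ℂ (LaurentSeries ℂ) (LaurentSeries ℂ) := ⟨fun x y z => by
  change (x • y) * z = x • (y * z)
  rw [← HahnSeries.C_mul_eq_smul, ← HahnSeries.C_mul_eq_smul, mul_assoc]⟩

instance : SMulCommClass ℂ (LaurentSeries ℂ) (LaurentSeries ℂ) := ⟨fun x y z => by
  change x • (y * z) = y * (x • z)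
  rw [← HahnSeries.C_mul_eq_smul, ← HahnSeries.C_mul_eq_smul, mul_left_comm]⟩

instance {m : ℕ} : IsScalarTower ℂ (LMat m) (LMat m) := ⟨fun x y z => by
  refine Matrix.ext fun a b => ?_
  simp [Matrix.mul_apply, Finset.smul_sum, smul_mul_assoc]⟩

instance {m : ℕ} : SMulCommClass ℂ (LMat m) (LMat m) := ⟨fun x y z => by
  refine Matrix.ext fun a b => ?_
  simp [Matrix.mul_apply, Finset.smul_sum, mul_smul_comm]⟩

theorem lmat_mul_smul {m : ℕ} (c : LaurentSeries ℂ) (X Y : LMat m) :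
    X * (c • Y) = c • (X * Y) := by
  refine Matrix.ext fun a b => ?_
  simp only [Matrix.mul_apply, Matrix.smul_apply, smul_eq_mul, Finset.mul_sum]
  exact Finset.sum_congr rfl fun i _ => by ring

/-- The degree picked by the residue at a marked point. -/
def resIdx {N : ℕ} : Pt N → ℤ
  | .infty => 1
  | _ => -1

/-- The sign of the residue at a marked point. -/
def resSign {N : ℕ} : Pt N → ℂ
  | .infty => -1
  | _ => 1

theorem resAt_eq {N : ℕ} (r : Pt N) (F : LaurentSeries ℂ) :
    resAt r F = resSign r * F.coeff (resIdx r) := by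
  cases r <;> simp [resAt, resSign, resIdx]

theorem resSign_ne_zero {N : ℕ} (r : Pt N) : resSign r ≠ 0 := by
  cases r <;> simp [resSign]

theorem weight_ne_zero {N T : ℕ} (hT : (T : ℂ) ≠ 0) (r : Pt N) : weight T r ≠ 0 := by
  cases r <;> simp only [weight]
  exacts [one_ne_zero, hT, one_ne_zero]

/-- The contribution of a marked point to the pairing. -/
noncomputable def localPairing {m N : ℕ} (T : ℕ) (r : Pt N) (Y X : LMat m) : ℂ :=
  weight T r * resAt r (Matrix.trace (Y * X))

theorem localPairing_eq {m N T : ℕ} (r : Pt N) (Y X : LMat m) :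
    localPairing T r Y X =
      weight T r * resSign r * Matrix.trace (lcoeff (Y * X) (resIdx r)) := by
  rw [localPairing, resAt_eq, coeff_trace, mul_assoc]

section pairing

variable {m N T : ℕ}

theorem pairing_eq (Y X : Tuple m N) : pairing T Y X =
    ∑ r : Fin N, localPairing T (.pt r) (Y (.pt r)) (X (.pt r))
      + localPairing (N := N) T .zero (Y .zero) (X .zero)
      + localPairing (N := N) T .infty (Y .infty) (X .infty) := by
  simp only [pairing, localPairing, weight, one_mul, Finset.mul_sum]

theorem localPairing_add_left (r : Pt N) (Y Y' X : LMat m) :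
    localPairing T r (Y + Y') X = localPairing T r Y X + localPairing T r Y' X := by
  simp only [localPairing_eq, add_mul, lcoeff_add, Matrix.trace_add]
  ring

theorem localPairing_comm (r : Pt N) (Y X : LMat m) :
    localPairing T r Y X = localPairing T r X Y := by
  rw [localPairing, localPairing, Matrix.trace_mul_comm]

theorem pairing_comm (Y X : Tuple m N) : pairing T Y X = pairing T X Y := by
  rw [pairing_eq, pairing_eq, localPairing_comm .zero, localPairing_comm .infty,
    Finset.sum_congr rfl fun r _ =>
      localPairing_comm (N := N) (T := T) (.pt r) (Y (.pt r)) (X (.pt r))]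

theorem pairing_add_left (Y Y' X : Tuple m N) :
    pairing T (Y + Y') X = pairing T Y X + pairing T Y' X := by
  simp only [pairing_eq, Pi.add_apply, localPairing_add_left, Finset.sum_add_distrib]
  ring

theorem pairing_add_right (Y X X' : Tuple m N) :
    pairing T Y (X + X') = pairing T Y X + pairing T Y X' := by
  rw [pairing_comm, pairing_add_left, pairing_comm X, pairing_comm X']

theorem pairing_sub_right (Y X X' : Tuple m N) :
    pairing T Y (X - X') = pairing T Y X - pairing T Y X' := by
  rw [eq_sub_iff_add_eq, ← pairing_add_right, sub_add_cancel]

theorem pairing_lie (Z Y X : Tuple m N) :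
    pairing T (Z * Y - Y * Z) X = pairing T Z (Y * X - X * Y) := by
  have h : ∀ A B C : LMat m,
      Matrix.trace ((A * B - B * A) * C) = Matrix.trace (A * (B * C - C * B)) := by
    intro A B C
    rw [sub_mul, mul_sub, Matrix.trace_sub, Matrix.trace_sub, mul_assoc, mul_assoc B,
      Matrix.trace_mul_comm B, mul_assoc]
  simp only [pairing_eq, localPairing, Pi.sub_apply, Pi.mul_apply, h]

theorem pairing_single (r : Pt N) (Y : Tuple m N) (X : LMat m) :
    pairing T Y (Pi.single r X) = localPairing T r (Y r) X := by
  have h0 : ∀ s, s ≠ r → localPairing T s (Y s) ((Pi.single r X : Tuple m N) s) = 0 := by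
    intro s hs
    rw [Pi.single_eq_of_ne hs, localPairing_eq, mul_zero, lcoeff_zero, Matrix.trace_zero, mul_zero]
  rw [pairing_eq]
  cases r with
  | zero =>
    rw [Finset.sum_eq_zero fun s _ => h0 _ (by simp), h0 .infty (by simp), Pi.single_eq_same]
    simp
  | pt r =>
    rw [h0 .zero (by simp), h0 .infty (by simp), Finset.sum_eq_single r
      (fun s _ hs => h0 _ (by simpa using hs)) (by simp), Pi.single_eq_same]
    simp
  | infty =>
    rw [Finset.sum_eq_zero fun s _ => h0 _ (by simp), h0 .zero (by simp), Pi.single_eq_same]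
    simp

end pairing

/-! ### Derivatives of powers seen through a linear functional. -/

section deriv

variable {A : Type*} [Ring A] [Module ℂ A] [IsScalarTower ℂ A A] [SMulCommClass ℂ A A]

/-- The algebra A carries no topology, so only scalar functions are differentiated. The induction
runs over all functionals ℓ, because peeling off one factor replaces ℓ by its composition with a
left multiplication. -/
theorem hasDerivAt_pow (ℓ : A →ₗ[ℂ] ℂ) (a b : A) (n : ℕ) :
    HasDerivAt (fun ε : ℂ => ℓ ((a + ε • b) ^ n))
      (∑ i ∈ Finset.range n, ℓ (a ^ i * b * a ^ (n - 1 - i))) 0 := by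
  induction n generalizing ℓ with
  | zero => simpa using hasDerivAt_const (0 : ℂ) (ℓ 1)
  | succ n ih =>
    have h1 := ih (ℓ ∘ₗ LinearMap.mulLeft ℂ a)
    have h2 := ih (ℓ ∘ₗ LinearMap.mulLeft ℂ b)
    have h3 := h1.add ((hasDerivAt_id (0 : ℂ)).mul h2)
    have h4 : (fun ε : ℂ => ℓ ((a + ε • b) ^ (n + 1))) = fun ε : ℂ =>
        (ℓ ∘ₗ LinearMap.mulLeft ℂ a) ((a + ε • b) ^ n) +
          ε * (ℓ ∘ₗ LinearMap.mulLeft ℂ b) ((a + ε • b) ^ n) := by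
      ext ε
      rw [pow_succ', add_mul, map_add, smul_mul_assoc, map_smul]
      rfl
    rw [h4]
    refine h3.congr_deriv ?_
    rw [Finset.sum_range_succ']
    simp [pow_succ', mul_assoc]
    refine Finset.sum_congr rfl fun i hi => ?_
    congr 5
    omega

/-- In coordinates of V this is a polynomial. It supplies the genuine differentiability of the
Hamiltonians in the residues that directional derivatives do not give. -/
theorem contDiff_pow {V : Type*} [NormedAddCommGroup V] [NormedSpace ℂ V] [FiniteDimensional ℂ V]
    (ℓ : A →ₗ[ℂ] ℂ) (y : V →ₗ[ℂ] A) (a : A) (n : ℕ) {k : WithTop ℕ∞} :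
    ContDiff ℂ k fun v => ℓ ((a + y v) ^ n) := by
  induction n generalizing ℓ with
  | zero => simpa using contDiff_const
  | succ n ih =>
    let e := Module.finBasis ℂ V
    have h : (fun v => ℓ ((a + y v) ^ (n + 1))) = fun v =>
        (ℓ ∘ₗ LinearMap.mulLeft ℂ a) ((a + y v) ^ n) +
          ∑ j, e.coord j v * (ℓ ∘ₗ LinearMap.mulLeft ℂ (y (e j))) ((a + y v) ^ n) := by
      ext v
      have : y v = ∑ j, e.coord j v • y (e j) := by
        conv_lhs => rw [← e.sum_repr v, map_sum]
        exact Finset.sum_congr rfl fun j _ => map_smul _ _ _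
      rw [pow_succ', add_mul, map_add]
      congr 1
      generalize (a + y v) ^ n = w
      rw [this, Finset.sum_mul, map_sum]
      refine Finset.sum_congr rfl fun j _ => ?_
      rw [smul_mul_assoc, map_smul]
      rfl
    rw [h]
    refine (ih _).add (ContDiff.sum fun j _ => ContDiff.mul ?_ (ih _))
    exact (LinearMap.toContinuousLinearMap (e.coord j)).contDiff

end deriv

/-! ### Nondegeneracy of the pairing and gradients of the invariant functions. -/

namespace GaudinData

variable {m N T : ℕ} (D : GaudinData m N T)

/-- The coefficient of degree j pairs with the one of degree `resIdx r - j`, and for twists k and 1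
- k the eigenvalue degrees at 0 and ∞ are then opposite. -/
theorem coeffSpace_eq_zero {k : ℤ} {r : Pt N} {j : ℤ} {X : Mat m} (hX : X ∈ D.coeffSpace k r j)
    (h : ∀ B ∈ D.coeffSpace (1 - k) r (resIdx r - j), Matrix.trace (X * B) = 0) : X = 0 := by
  cases r with
  | zero =>
    refine D.grade_eq_zero hX fun B hB => h B ?_
    change B ∈ D.grade (1 - k + (-1 - j))
    rwa [show 1 - k + (-1 - j) = -(k + j) by ring]
  | pt r => exact D.trace_nondegenerate X hX h
  | infty =>
    refine D.grade_eq_zero hX fun B hB => h B ?_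
    change B ∈ D.grade (1 - k - (1 - j))
    rwa [show 1 - k - (1 - j) = -(k - j) by ring]

theorem isLoop_single {k : ℤ} {r : Pt N} {X : LMat m}
    (hX : ∀ j, lcoeff X j ∈ D.coeffSpace k r j) : D.IsLoop k (Pi.single r X : Tuple m N) := by
  rw [isLoop_iff]
  intro s j
  by_cases h : s = r
  · subst h
    rw [Pi.single_eq_same]
    exact hX j
  · rw [Pi.single_eq_of_ne h, lcoeff_zero]
    exact Submodule.zero_mem _

variable {D}

/-- Testing against a single monomial at a single marked point isolates one coefficient. -/
theorem IsLoop.eq_zero {k : ℤ} {X : Tuple m N} (hX : D.IsLoop k X)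
    (h : ∀ Y, D.IsLoop (1 - k) Y → pairing T X Y = 0) : X = 0 := by
  rw [isLoop_iff] at hX
  funext r
  refine eq_zero_of_lcoeff fun j => D.coeffSpace_eq_zero (hX r j) fun B hB => ?_
  have h1 := h (Pi.single r (lmono (resIdx r - j) B)) (D.isLoop_single fun i => by
    rw [lcoeff_lmono]
    split_ifs with hi
    · rwa [hi]
    · exact Submodule.zero_mem _)
  rw [pairing_single, localPairing_eq, lcoeff_mul_lmono, sub_sub_cancel] at h1
  exact (mul_eq_zero.1 h1).resolve_left
    (mul_ne_zero (weight_ne_zero (T_ne_zero D) r) (resSign_ne_zero r))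

variable (D)

/-- The projections of matrices onto the coefficient spaces of the loop algebra. -/
noncomputable def coeffProj : Pt N → ℤ → Mat m →ₗ[ℂ] Mat m
  | .zero, j => D.gradeProj j
  | .pt _, _ => D.𝔤.toSubmodule.subtype ∘ₗ D.proj
  | .infty, j => D.gradeProj (-j)

theorem coeffProj_mem (r : Pt N) (j : ℤ) (M : Mat m) :
    D.coeffProj r j M ∈ D.coeffSpace 0 r j := by
  cases r with
  | zero =>
    have := D.gradeProj_mem j M
    change _ ∈ D.grade (0 + j)
    rwa [zero_add]
  | pt r => exact (D.proj M).2
  | infty =>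
    have := D.gradeProj_mem (-j) M
    change _ ∈ D.grade (0 - j)
    rwa [zero_sub]

theorem trace_mul_coeffProj {r : Pt N} {i j : ℤ} (hij : i + j = resIdx r) {B : Mat m}
    (hB : B ∈ D.coeffSpace 1 r i) (M : Mat m) :
    Matrix.trace (B * D.coeffProj r j M) = Matrix.trace (B * M) := by
  cases r with
  | zero =>
    refine D.trace_mul_gradeProj ?_ M
    have hB : B ∈ D.grade (1 + i) := hB
    have hij : i + j = -1 := hij
    rwa [show -j = 1 + i by omega]
  | pt r =>
    rw [Matrix.trace_mul_comm, Matrix.trace_mul_comm B]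
    exact D.trace_proj_mul M ⟨B, hB⟩
  | infty =>
    refine D.trace_mul_gradeProj ?_ M
    have hB : B ∈ D.grade (1 - i) := hB
    have hij : i + j = 1 := hij
    rwa [show - -j = 1 - i by omega]

/-- The linear functional whose value at `Y_r^{p+1}` is the invariant function. -/
noncomputable def hamLin (p : ℕ) (r : Pt N) : LMat m →ₗ[ℂ] ℂ where
  toFun M := resAt r (HahnSeries.C (weight T r / (p + 1)) * D.coord r ^ p * Matrix.trace M)
  map_add' M M' := by
    simp only [resAt_eq, Matrix.trace_add, mul_add, HahnSeries.coeff_add]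
  map_smul' c M := by
    rw [resAt_eq, resAt_eq, Matrix.trace_smul, mul_smul_comm, HahnSeries.coeff_smul, smul_eq_mul,
      RingHom.id_apply, smul_eq_mul]
    ring

theorem hamiltonian_eq (p : ℕ) (r : Pt N) (Y : Tuple m N) :
    D.hamiltonian p r Y = D.hamLin p r (Y r ^ (p + 1)) := rfl

/-- The derivative of the invariant functions. -/
theorem hasDerivAt_hamiltonian (p : ℕ) (r : Pt N) (Y η : Tuple m N) :
    HasDerivAt (fun ε : ℂ => D.hamiltonian p r (Y + ε • η))
      (localPairing T r (η r) (D.coord r ^ p • Y r ^ p)) 0 := by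
  have h := hasDerivAt_pow (D.hamLin p r) (Y r) (η r) (p + 1)
  refine h.congr_deriv ?_
  have h1 : ∀ i ∈ Finset.range (p + 1), D.hamLin p r (Y r ^ i * η r * Y r ^ (p + 1 - 1 - i)) =
      D.hamLin p r (η r * Y r ^ p) := by
    intro i hi
    have : Matrix.trace (Y r ^ i * η r * Y r ^ (p + 1 - 1 - i)) =
        Matrix.trace (η r * Y r ^ p) := by
      rw [mul_assoc, Matrix.trace_mul_comm, mul_assoc, ← pow_add]
      congr 3
      have := Finset.mem_range.1 hi
      omega
    simp only [hamLin, LinearMap.coe_mk, AddHom.coe_mk, this]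
  rw [Finset.sum_congr rfl h1, Finset.sum_const, Finset.card_range, hamLin, LinearMap.coe_mk,
    AddHom.coe_mk, localPairing, lmat_mul_smul, Matrix.trace_smul, smul_eq_mul, mul_assoc,
    HahnSeries.C_mul_eq_smul, resAt_eq, resAt_eq, HahnSeries.coeff_smul, nsmul_eq_mul, smul_eq_mul]
  have h2 : ((p : ℂ) + 1) ≠ 0 := Nat.cast_add_one_ne_zero p
  push_cast
  field_simp

/-- The naive gradient λ^p Y^p need not be `𝔤`-valued or twisted. Projecting its coefficients onto
the required spaces does not change the pairing with twisted elements of the dual. The weight of the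
point is already in the pairing, so it does not appear. -/
theorem exists_isGradient (p : ℕ) (r : Pt N) (Y : Tuple m N) :
    ∃ X, D.IsGradient (D.hamiltonian p r) Y X := by
  set M : LMat m := D.coord r ^ p • Y r ^ p
  obtain ⟨b, hb⟩ := exists_lcoeff_eq_zero M
  have hb' : ∀ j < b, D.coeffProj r j (lcoeff M j) = 0 := fun j hj => by rw [hb j hj, map_zero]
  refine ⟨Pi.single r (ofCoeff (fun j => D.coeffProj r j (lcoeff M j)) ⟨b, hb'⟩),
    D.isLoop_single fun j => ?_, fun η hη => ?_⟩
  · rw [lcoeff_ofCoeff]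
    exact D.coeffProj_mem r j _
  · refine (D.hasDerivAt_hamiltonian p r Y η).congr_deriv ?_
    rw [pairing_single, localPairing_eq, localPairing_eq]
    congr 1
    obtain ⟨a, ha⟩ := exists_lcoeff_eq_zero (η r)
    rw [lcoeff_mul ha hb, lcoeff_mul (b := b) ha fun j hj => by rw [lcoeff_ofCoeff, hb' j hj],
      Matrix.trace_sum, Matrix.trace_sum]
    refine Finset.sum_congr rfl fun i _ => ?_
    rw [lcoeff_ofCoeff]
    exact (D.trace_mul_coeffProj (by ring) (D.isLoop_iff.1 hη r i) _).symm

variable {D}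

theorem IsGradient.pairing_eq {p : ℕ} {r : Pt N} {Y X : Tuple m N}
    (hX : D.IsGradient (D.hamiltonian p r) Y X) {η : Tuple m N} (hη : D.IsLoop 1 η) :
    pairing T η X = localPairing T r (η r) (D.coord r ^ p • Y r ^ p) :=
  (hX.2 η hη).unique (D.hasDerivAt_hamiltonian p r Y η)

theorem IsGradient.unique {H : Tuple m N → ℂ} {Y X X' : Tuple m N}
    (hX : D.IsGradient H Y X) (hX' : D.IsGradient H Y X') : X = X' := by
  rw [← sub_eq_zero]
  refine (hX.1.sub hX'.1).eq_zero fun η hη => ?_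
  rw [pairing_comm, pairing_sub_right, (hX.2 η (by simpa using hη)).unique
    (hX'.2 η (by simpa using hη)), sub_self]

/-- The gradient of an invariant function centralises the point. -/
theorem IsGradient.commute {p : ℕ} {r : Pt N} {Y X : Tuple m N}
    (hX : D.IsGradient (D.hamiltonian p r) Y X) (hY : D.IsLoop 1 Y) : Y * X = X * Y := by
  rw [← sub_eq_zero]
  refine IsLoop.eq_zero (k := 1) (by simpa using hY.lie hX.1) fun Z hZ => ?_
  have hZ' : D.IsLoop 0 Z := by simpa using hZ
  rw [pairing_comm, ← pairing_lie, hX.pairing_eq (by simpa using hZ'.lie hY), localPairing,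
    lmat_mul_smul, Matrix.trace_smul]
  -- Invariance under conjugation: Tr([Z, Y] Y^p) = 0 by cyclicity, so H is stationary in the
  -- direction [Z, Y].
  have : Matrix.trace ((Z * Y - Y * Z) r * Y r ^ p) = 0 := by
    rw [Pi.sub_apply, Pi.mul_apply, Pi.mul_apply, sub_mul, Matrix.trace_sub, mul_assoc,
      mul_assoc, Matrix.trace_mul_comm (Y r), mul_assoc, ← pow_succ', ← pow_succ, sub_self]
  rw [this, smul_zero, resAt_eq]
  simp

theorem IsEquivariant.eq_of_isLoopPlus {k l : ℤ} {X : Tuple m N} {f g : RatMat m}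
    (hf : D.IsEquivariant k f) (hg : D.IsEquivariant k g) (hXf : D.IsLoopPlus l (X - D.expand f))
    (hXg : D.IsLoopPlus l (X - D.expand g)) : f = g := by
  rw [← sub_eq_zero]
  have h : ∀ r, ∀ j < lowIdx r, lcoeff (D.expand (f - g) r) j = 0 := by
    intro r j hj
    have h1 := (D.isLoopPlus_iff.1 hXf).2 r j hj
    have h2 := (D.isLoopPlus_iff.1 hXg).2 r j hj
    rw [Pi.sub_apply, lcoeff_sub, sub_eq_zero] at h1 h2
    rw [expand_sub, lcoeff_sub, ← h1, ← h2, sub_self]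
  refine (hf.sub hg).eq_zero (fun r hr => ?_) (h .infty)
  cases r with
  | zero => exact h .zero
  | pt r => exact h (.pt r)
  | infty => exact absurd rfl hr

/-- The gradient is unique by nondegeneracy of the pairing, and its decomposition by Liouville. -/
theorem existsUnique_isLaxGenerator (p : ℕ) (r : Pt N) (q : Config m N) :
    ∃! h, D.IsLaxGenerator p r q h := by
  obtain ⟨X, hX⟩ := D.exists_isGradient p r (D.expand (D.lax q))
  obtain ⟨M₀, M, Minf, hh, hplus⟩ := exists_principal_part hX.1
  refine ⟨_, ⟨hh, X, hX, hplus⟩, ?_⟩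
  rintro h' ⟨hh', X', hX', hplus'⟩
  rw [hX'.unique hX] at hplus'
  exact hh'.eq_of_isLoopPlus hh hplus' hplus

/-! ### Residues of the Lax matrix -/

variable (D)

/-- The residues of the Lax matrix. -/
noncomputable def residues (q : Config m N) : Residues m N := (D.A₀₀ q, D.A₀₁ q, D.A q)

variable {D}

/-- Conjugation by a σ-fixed group element preserves degrees, and the bracket term in A₀^{(0)} joins
degrees 1 and -1. -/
theorem IsConfig.residues {q : Config m N} (hq : D.IsConfig q) : D.IsResidues (D.residues q) := by
  obtain ⟨h1, ⟨g, hg, hgq⟩, h3⟩ := hq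
  have h01 : D.A₀₁ q ∈ D.grade (-1) := by
    rw [A₀₁, ← hgq]
    refine D.conj_mem_grade hg ?_
    obtain ⟨h, h'⟩ := D.Λ₀₁_mem
    exact ⟨h, by rw [h', zpow_neg_one]⟩
  have h00 : q.2.1 * D.Λ₀₀ * q.2.1⁻¹ ∈ D.grade 0 := by
    rw [← hgq]
    refine D.conj_mem_grade hg ?_
    obtain ⟨h, h'⟩ := D.Λ₀₀_mem
    exact ⟨h, by rw [h', zpow_zero, one_smul]⟩
  refine ⟨?_, h01, fun s => ?_⟩
  · have := D.lie_mem_grade h3 h01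
    rw [add_neg_cancel] at this
    exact (D.gradeSub 0).add_mem h00 this
  · obtain ⟨g, hg⟩ := h1 s
    change D.A q s ∈ D.𝔤
    rw [A, ← hg]
    exact D.conj_mem g (D.Λ_mem s)

theorem Λinf_mem_grade : D.Λinf ∈ D.grade 1 := by
  obtain ⟨h, h'⟩ := D.Λinf_mem
  exact ⟨h, by rw [h', zpow_one]⟩

theorem lax_eq {q : Config m N} (hq : D.IsResidues (D.residues q)) :
    D.lax q = D.poleMap (D.residues q) + monoBlock 0 D.Λinf :=
  D.ratLax_eq hq.2.2

theorem lax_isEquivariant {q : Config m N} (hq : D.IsResidues (D.residues q)) :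
    D.IsEquivariant 1 (D.lax q) := by
  rw [lax_eq hq]
  exact hq.poleMap_isEquivariant.add (D.monoBlock_isEquivariant (by simpa using D.Λinf_mem_grade))

end GaudinData

/-! ### Calculus of group-valued fields in a normed algebra -/

section calculus

variable {𝔸 : Type} [NormedRing 𝔸] [NormedAlgebra ℝ 𝔸]
  {E : Type} [NormedAddCommGroup E] [NormedSpace ℝ E] {x : E} {f g φ ψ : E → 𝔸}

theorem fderiv_mul_apply' (hf : DifferentiableAt ℝ f x) (hg : DifferentiableAt ℝ g x) (w : E) :
    fderiv ℝ (fun y => f y * g y) x w = fderiv ℝ f x w * g x + f x * fderiv ℝ g x w := by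
  have h := (hf.hasFDerivAt.mul' hg.hasFDerivAt).fderiv
  have h2 : fderiv ℝ (fun y => f y * g y) x = fderiv ℝ (f * g) x := rfl
  rw [h2, h]
  simp [add_comm]

theorem differentiableAt_fderiv_apply (hφ : ContDiffAt ℝ 2 φ x) (v : E) :
    DifferentiableAt ℝ (fun y => fderiv ℝ φ y v) x := by
  have h1 : DifferentiableAt ℝ (fderiv ℝ φ) x :=
    (hφ.fderiv_right (m := 1) (by norm_num)).differentiableAt (by norm_num)
  exact h1.clm_apply (differentiableAt_const v)

theorem fderiv_fderiv_apply (hφ : ContDiffAt ℝ 2 φ x) (u v : E) :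
    fderiv ℝ (fun y => fderiv ℝ φ y v) x u = fderiv ℝ (fderiv ℝ φ) x u v := by
  have h1 : DifferentiableAt ℝ (fderiv ℝ φ) x :=
    (hφ.fderiv_right (m := 1) (by norm_num)).differentiableAt (by norm_num)
  rw [fderiv_clm_apply h1 (differentiableAt_const v)]
  simp

variable [CompleteSpace 𝔸]

theorem differentiableAt_inverse' (hf : DifferentiableAt ℝ f x) (hu : IsUnit (f x)) :
    DifferentiableAt ℝ (fun y => Ring.inverse (f y)) x := by
  obtain ⟨u, hu⟩ := hu
  have h := hasFDerivAt_ringInverse (𝕜 := ℝ) u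
  rw [hu] at h
  exact (h.comp x hf.hasFDerivAt).differentiableAt

theorem fderiv_inverse_apply' (hf : DifferentiableAt ℝ f x) (hu : IsUnit (f x)) (w : E) :
    fderiv ℝ (fun y => Ring.inverse (f y)) x w =
      -(Ring.inverse (f x) * fderiv ℝ f x w * Ring.inverse (f x)) := by
  obtain ⟨u, hu⟩ := hu
  have h := hasFDerivAt_ringInverse (𝕜 := ℝ) u
  rw [hu] at h
  have h2 := (h.comp x hf.hasFDerivAt).fderiv
  have h3 : fderiv ℝ (fun y => Ring.inverse (f y)) x = fderiv ℝ (Ring.inverse ∘ f) x := rfl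
  rw [h3, h2, ← hu, Ring.inverse_unit]
  simp

theorem differentiableAt_conj (hφ : DifferentiableAt ℝ φ x) (hu : IsUnit (φ x)) (Λ : 𝔸) :
    DifferentiableAt ℝ (fun y => φ y * Λ * Ring.inverse (φ y)) x :=
  (hφ.mul (differentiableAt_const Λ)).mul (differentiableAt_inverse' hφ hu)

theorem fderiv_conj_apply (hφ : DifferentiableAt ℝ φ x) (hu : IsUnit (φ x)) (Λ : 𝔸) (w : E) :
    fderiv ℝ (fun y => φ y * Λ * Ring.inverse (φ y)) x w =
      ⁅fderiv ℝ φ x w * Ring.inverse (φ x), φ x * Λ * Ring.inverse (φ x)⁆ := by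
  have h1 : DifferentiableAt ℝ (fun y => φ y * Λ) x := hφ.mul (differentiableAt_const Λ)
  have hc : φ x * Ring.inverse (φ x) = 1 := Ring.mul_inverse_cancel _ hu
  have hc' : Ring.inverse (φ x) * φ x = 1 := Ring.inverse_mul_cancel _ hu
  rw [fderiv_mul_apply' h1 (differentiableAt_inverse' hφ hu), fderiv_inverse_apply' hφ hu,
    fderiv_mul_apply' hφ (differentiableAt_const Λ), Ring.lie_def]
  simp only [fderiv_fun_const, Pi.zero_apply, zero_apply, mul_zero, add_zero]
  have e1 : fderiv ℝ φ x w * Ring.inverse (φ x) * (φ x * Λ * Ring.inverse (φ x)) =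
      fderiv ℝ φ x w * (Ring.inverse (φ x) * φ x) * Λ * Ring.inverse (φ x) := by
    simp only [mul_assoc]
  rw [e1, hc', mul_one]
  simp only [mul_assoc, mul_neg, sub_eq_add_neg]

/-- The right logarithmic derivative of a field. -/
noncomputable def logDer (φ : E → 𝔸) (v : E) (y : E) : 𝔸 := fderiv ℝ φ y v * Ring.inverse (φ y)

theorem differentiableAt_logDer (hφ : ContDiffAt ℝ 2 φ x) (hu : IsUnit (φ x)) (v : E) :
    DifferentiableAt ℝ (logDer φ v) x :=
  (differentiableAt_fderiv_apply hφ v).mul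
    (differentiableAt_inverse' (hφ.differentiableAt (by norm_num)) hu)

/-- The Maurer–Cartan equation: the second derivatives of φ cancel by symmetry and only the
derivatives of φ⁻¹ remain. -/
theorem fderiv_logDer_sub (hφ : ContDiffAt ℝ 2 φ x) (hu : IsUnit (φ x)) (u v : E) :
    fderiv ℝ (logDer φ v) x u - fderiv ℝ (logDer φ u) x v = ⁅logDer φ u x, logDer φ v x⁆ := by
  have hd := hφ.differentiableAt (by norm_num)
  have h1 : ∀ u v, fderiv ℝ (logDer φ v) x u =
      fderiv ℝ (fderiv ℝ φ) x u v * Ring.inverse (φ x) - logDer φ v x * logDer φ u x := by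
    intro u v
    have := fderiv_mul_apply' (differentiableAt_fderiv_apply hφ v)
      (differentiableAt_inverse' hd hu) u
    rw [fderiv_fderiv_apply hφ, fderiv_inverse_apply' hd hu] at this
    rw [show logDer φ v = fun y => fderiv ℝ φ y v * Ring.inverse (φ y) from rfl, this]
    simp only [logDer, mul_assoc, mul_neg, sub_eq_add_neg]
  have hs : fderiv ℝ (fderiv ℝ φ) x u v = fderiv ℝ (fderiv ℝ φ) x v u :=
    (hφ.isSymmSndFDerivAt (by simp)) u v
  rw [h1, h1, hs, Ring.lie_def]
  abel

variable (τ : 𝔸 →L[ℝ] ℂ)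

theorem differentiableAt_trace_mul {A : E → 𝔸} (hA : DifferentiableAt ℝ A x)
    (hφ : ContDiffAt ℝ 2 φ x) (hu : IsUnit (φ x)) (v : E) :
    DifferentiableAt ℝ (fun y => τ (A y * logDer φ v y)) x :=
  τ.differentiableAt.comp x (hA.mul (differentiableAt_logDer hφ hu v))

theorem fderiv_trace_mul {A : E → 𝔸} (hA : DifferentiableAt ℝ A x)
    (hφ : ContDiffAt ℝ 2 φ x) (hu : IsUnit (φ x)) (u v : E) :
    fderiv ℝ (fun y => τ (A y * logDer φ v y)) x u =
      τ (fderiv ℝ A x u * logDer φ v x + A x * fderiv ℝ (logDer φ v) x u) := by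
  have h1 : DifferentiableAt ℝ (fun y => A y * logDer φ v y) x :=
    hA.mul (differentiableAt_logDer hφ hu v)
  have := (τ.hasFDerivAt.comp x h1.hasFDerivAt).fderiv
  rw [show (fun y => τ (A y * logDer φ v y)) = τ ∘ fun y => A y * logDer φ v y from rfl, this,
    ContinuousLinearMap.comp_apply, fderiv_mul_apply' hA (differentiableAt_logDer hφ hu v)]

/-- Exterior derivative of the one-form `τ (A dφ φ⁻¹)`. -/
theorem exterior_trace_mul (hτ : ∀ a b, τ (a * b) = τ (b * a)) {A : E → 𝔸} (hA : DifferentiableAt ℝ A x)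
    (hφ : ContDiffAt ℝ 2 φ x) (hu : IsUnit (φ x)) (u v : E) {R : 𝔸}
    (hR : fderiv ℝ A x u = ⁅logDer φ u x, A x⁆ + R) :
    fderiv ℝ (fun y => τ (A y * logDer φ v y)) x u - fderiv ℝ (fun y => τ (A y * logDer φ u y)) x v =
      τ (R * logDer φ v x) - τ (logDer φ u x * fderiv ℝ A x v) := by
  have h := fderiv_logDer_sub hφ hu u v
  rw [sub_eq_iff_eq_add] at h
  rw [fderiv_trace_mul τ hA hφ hu, fderiv_trace_mul τ hA hφ hu, h, hR, map_add, map_add,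
    hτ (fderiv ℝ A x v)]
  -- By cyclicity the Maurer–Cartan term cancels the part of dA generated by conjugation; only the
  -- remainder R survives.
  have h2 : τ (A x * (⁅logDer φ u x, logDer φ v x⁆)) =
      - τ (⁅logDer φ u x, A x⁆ * logDer φ v x) := by
    simp only [Ring.lie_def, mul_sub, sub_mul, map_sub]
    rw [hτ _ (logDer φ v x * logDer φ u x), hτ (logDer φ u x * A x), mul_assoc, mul_assoc]
    ring
  rw [add_mul, map_add, mul_add, map_add, h2]
  ring

/-- The derivative of the nilpotent part of a twisted orbit map. -/
theorem fderiv_twisted_orbit {c : E → 𝔸} (hφ : DifferentiableAt ℝ φ x) (hu : IsUnit (φ x))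
    (hc : DifferentiableAt ℝ c x) (Λ₀ Λ₁ : 𝔸) (w : E) :
    DifferentiableAt ℝ (fun y => φ y * Λ₀ * Ring.inverse (φ y) +
      ⁅c y, φ y * Λ₁ * Ring.inverse (φ y)⁆) x ∧
    fderiv ℝ (fun y => φ y * Λ₀ * Ring.inverse (φ y) +
      ⁅c y, φ y * Λ₁ * Ring.inverse (φ y)⁆) x w =
      ⁅logDer φ w x, φ x * Λ₀ * Ring.inverse (φ x) + ⁅c x, φ x * Λ₁ * Ring.inverse (φ x)⁆⁆ +
        ⁅fderiv ℝ c x w - ⁅logDer φ w x, c x⁆, φ x * Λ₁ * Ring.inverse (φ x)⁆ := by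
  have h0 := differentiableAt_conj hφ hu Λ₀
  have h1 := differentiableAt_conj hφ hu Λ₁
  have e0 := fderiv_conj_apply hφ hu Λ₀ w
  have e1 := fderiv_conj_apply hφ hu Λ₁ w
  simp only [Ring.lie_def]
  have m1 : DifferentiableAt ℝ (fun y => c y * (φ y * Λ₁ * Ring.inverse (φ y))) x := hc.mul h1
  have m2 : DifferentiableAt ℝ (fun y => φ y * Λ₁ * Ring.inverse (φ y) * c y) x := h1.mul hc
  have m3 : DifferentiableAt ℝ (fun y => c y * (φ y * Λ₁ * Ring.inverse (φ y)) -
    φ y * Λ₁ * Ring.inverse (φ y) * c y) x := m1.sub m2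
  refine ⟨h0.add m3, ?_⟩
  rw [fderiv_fun_add h0 m3, fderiv_fun_sub m1 m2]
  simp only [add_apply, sub_apply]
  rw [fderiv_mul_apply' hc h1, fderiv_mul_apply' h1 hc, e0, e1]
  simp only [Ring.lie_def, logDer]
  noncomm_ring

/-- Exterior derivative of the one-form `τ (A dφ φ⁻¹)` on a twisted orbit. -/
theorem exterior_trace_twisted (hτ : ∀ a b, τ (a * b) = τ (b * a)) {c : E → 𝔸}
    (hφ : ContDiffAt ℝ 2 φ x) (hu : IsUnit (φ x)) (hc : DifferentiableAt ℝ c x) (Λ₀ Λ₁ : 𝔸)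
    {A₀ A₁ : E → 𝔸} (hA₁ : A₁ = fun y => φ y * Λ₁ * Ring.inverse (φ y))
    (hA₀ : A₀ = fun y => φ y * Λ₀ * Ring.inverse (φ y) + ⁅c y, A₁ y⁆) (u v : E) :
    fderiv ℝ (fun y => τ (A₀ y * logDer φ v y)) x u -
      fderiv ℝ (fun y => τ (A₀ y * logDer φ u y)) x v =
      -(τ (logDer φ u x * fderiv ℝ A₀ x v) +
        τ ((fderiv ℝ c x u - ⁅logDer φ u x, c x⁆) * fderiv ℝ A₁ x v)) := by
  have hd := hφ.differentiableAt (by norm_num)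
  subst hA₁
  have h := fderiv_twisted_orbit hd hu hc Λ₀ Λ₁ u
  rw [← hA₀] at h
  have h2 : fderiv ℝ A₀ x u = ⁅logDer φ u x, A₀ x⁆ + ⁅fderiv ℝ c x u - ⁅logDer φ u x, c x⁆,
      φ x * Λ₁ * Ring.inverse (φ x)⁆ := by rw [h.2, hA₀]
  rw [exterior_trace_mul τ hτ h.1 hφ hu u v h2, fderiv_conj_apply hd hu,
    show fderiv ℝ φ x v * Ring.inverse (φ x) = logDer φ v x from rfl]
  generalize fderiv ℝ c x u - ⁅logDer φ u x, c x⁆ = d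
  generalize φ x * Λ₁ * Ring.inverse (φ x) = a
  generalize logDer φ v x = b
  have e : τ (⁅d, a⁆ * b) = - τ (d * ⁅b, a⁆) := by
    simp only [Ring.lie_def, mul_sub, sub_mul, map_sub]
    rw [hτ (a * d) b, ← mul_assoc, ← mul_assoc, ← mul_assoc, hτ (b * a) d, ← mul_assoc]
    ring
  rw [e]
  ring

end calculus

/-! ### Matrices of Taylor series and the loop group -/

/-- Matrices of power series. -/
abbrev PMat (m : ℕ) := Matrix (Fin m) (Fin m) ℂ⟦X⟧

section power

variable {m : ℕ}

@[simp] theorem pcoeff_apply (X : PMat m) (n : ℕ) (a b) :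
    pcoeff X n a b = PowerSeries.coeff n (X a b) := rfl

theorem pcoeff_mul (X Y : PMat m) (n : ℕ) :
    pcoeff (X * Y) n = ∑ p ∈ Finset.HasAntidiagonal.antidiagonal n, pcoeff X p.1 * pcoeff Y p.2 := by
  ext a b
  simp only [pcoeff_apply, Matrix.mul_apply, map_sum, PowerSeries.coeff_mul, Matrix.sum_apply]
  rw [Finset.sum_comm]

theorem pcoeff_sub (X Y : PMat m) (n : ℕ) : pcoeff (X - Y) n = pcoeff X n - pcoeff Y n := by
  ext a b
  simp

theorem pcoeff_one_succ (n : ℕ) : pcoeff (1 : PMat m) (n + 1) = 0 := by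
  ext a b
  by_cases h : a = b <;> simp [h, PowerSeries.coeff_one]

theorem pcoeff_one_zero : pcoeff (1 : PMat m) 0 = 1 := by
  ext a b
  by_cases h : a = b <;> simp [Matrix.one_apply, h]

/-- The entrywise derivative. -/
noncomputable def derivMat (X : PMat m) : PMat m := X.map fun x => PowerSeries.derivative ℂ x

theorem pcoeff_derivMat (X : PMat m) (n : ℕ) :
    pcoeff (derivMat X) n = ((n : ℂ) + 1) • pcoeff X (n + 1) := by
  ext a b
  simp [derivMat, PowerSeries.coeff_derivative, mul_comm]

theorem derivMat_mul (X Y : PMat m) : derivMat (X * Y) = derivMat X * Y + X * derivMat Y := by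
  ext a b : 1
  simp only [derivMat, Matrix.map_apply, Matrix.mul_apply, Matrix.add_apply, map_sum,
    Derivation.leibniz, smul_eq_mul, Finset.sum_add_distrib]
  rw [add_comm]
  congr 1
  exact Finset.sum_congr rfl fun k _ => mul_comm _ _

theorem derivMat_const (B : Mat m) : derivMat (B.map PowerSeries.C) = 0 := by
  ext a b : 1
  simp [derivMat, PowerSeries.derivative_C]

theorem pcoeff_const_mul (φ ψ : PMat m) (B : Mat m) :
    pcoeff (φ * B.map PowerSeries.C * ψ) 0 = pcoeff φ 0 * B * pcoeff ψ 0 := by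
  have : pcoeff (B.map PowerSeries.C) 0 = B := by
    ext a b
    simp
  simp [pcoeff_mul, this]

theorem mul_inv_of_pcoeff {φ : PMat m} (h : IsUnit (pcoeff φ 0)) : φ * φ⁻¹ = 1 := by
  apply Matrix.mul_nonsing_inv
  rw [PowerSeries.isUnit_iff_constantCoeff, RingHom.map_det]
  exact (Matrix.isUnit_iff_isUnit_det _).1 (by
    convert h using 1
    ext a b
    simp)

theorem inv_mul_of_pcoeff {φ : PMat m} (h : IsUnit (pcoeff φ 0)) : φ⁻¹ * φ = 1 :=
  mul_eq_one_comm.1 (mul_inv_of_pcoeff h)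

theorem pcoeff_inv_zero {φ : PMat m} (h : IsUnit (pcoeff φ 0)) :
    pcoeff φ⁻¹ 0 = (pcoeff φ 0)⁻¹ := by
  have h1 := congrArg (fun X => pcoeff X 0) (mul_inv_of_pcoeff h)
  simp only [pcoeff_mul, pcoeff_one_zero, Finset.Nat.antidiagonal_zero, Finset.sum_singleton] at h1
  exact (Matrix.inv_eq_right_inv h1).symm

theorem pcoeff_mul_one (X Y : PMat m) :
    pcoeff (X * Y) 1 = pcoeff X 0 * pcoeff Y 1 + pcoeff X 1 * pcoeff Y 0 := by
  rw [pcoeff_mul, Finset.Nat.antidiagonal_succ]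
  simp

theorem pcoeff_inv_one {φ : PMat m} (h : IsUnit (pcoeff φ 0)) :
    pcoeff φ⁻¹ 1 = -((pcoeff φ 0)⁻¹ * pcoeff φ 1 * (pcoeff φ 0)⁻¹) := by
  have h1 := congrArg (fun X => pcoeff X 1) (mul_inv_of_pcoeff h)
  simp only [pcoeff_mul_one, pcoeff_one_succ 0, pcoeff_inv_zero h] at h1
  have h2 := eq_neg_of_add_eq_zero_left h1
  have h3 : (pcoeff φ 0)⁻¹ * pcoeff φ 0 = 1 :=
    Matrix.nonsing_inv_mul _ ((Matrix.isUnit_iff_isUnit_det _).1 h)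
  rw [mul_assoc, ← mul_neg, ← h2, ← mul_assoc, h3, one_mul]

/-- The formal differential equation satisfied by φBφ⁻¹, in the form required by
`pcoeff_mem_of_derivMat`. -/
theorem derivMat_conj {φ : PMat m} (h : IsUnit (pcoeff φ 0)) (B : Mat m) :
    derivMat (φ * B.map PowerSeries.C * φ⁻¹) =
      loopLogDeriv φ * (φ * B.map PowerSeries.C * φ⁻¹) -
        φ * B.map PowerSeries.C * φ⁻¹ * loopLogDeriv φ := by
  have h1 := congrArg derivMat (mul_inv_of_pcoeff h)
  have h2 := inv_mul_of_pcoeff h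
  have h0 : derivMat (1 : PMat m) = 0 := by
    have := derivMat_const (1 : Mat m)
    rwa [Matrix.map_one _ (map_zero _) (map_one _)] at this
  rw [derivMat_mul, h0] at h1
  have h3 : derivMat φ⁻¹ = -(φ⁻¹ * derivMat φ * φ⁻¹) := by
    have := congrArg (fun Z => φ⁻¹ * Z) (eq_neg_of_add_eq_zero_right h1)
    simp only [← mul_assoc, h2, one_mul, mul_neg] at this
    exact this
  rw [derivMat_mul, derivMat_mul, derivMat_const, h3,
    show loopLogDeriv φ = derivMat φ * φ⁻¹ from rfl]
  have e : derivMat φ * φ⁻¹ * (φ * B.map PowerSeries.C * φ⁻¹) =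
      derivMat φ * (φ⁻¹ * φ) * B.map PowerSeries.C * φ⁻¹ := by simp only [mul_assoc]
  rw [e, h2, mul_one]
  simp only [mul_zero, add_zero, mul_neg, mul_assoc, sub_eq_add_neg]

/-- Solutions of a formal linear differential equation `B' = [a, B]` stay in the subspaces
preserved by the equation. -/
theorem pcoeff_mem_of_derivMat {a B : PMat m} (hB : derivMat B = a * B - B * a)
    {V W : ℕ → Submodule ℂ (Mat m)} (h0 : pcoeff B 0 ∈ V 0) (ha : ∀ n, pcoeff a n ∈ W n)
    (hVW : ∀ i j, ∀ x ∈ W i, ∀ y ∈ V j, ⁅x, y⁆ ∈ V (i + j + 1)) (n : ℕ) : pcoeff B n ∈ V n := by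
  induction n using Nat.strong_induction_on with
  | _ n ih =>
    cases n with
    | zero => exact h0
    | succ n =>
      have h := congrArg (fun X => pcoeff X n) hB
      simp only [pcoeff_derivMat, pcoeff_sub] at h
      have h1 : pcoeff (a * B) n - pcoeff (B * a) n =
          ∑ p ∈ Finset.HasAntidiagonal.antidiagonal n, ⁅pcoeff a p.1, pcoeff B p.2⁆ := by
        rw [pcoeff_mul, pcoeff_mul,
          ← Finset.Nat.sum_antidiagonal_swap (f := fun p => pcoeff B p.1 * pcoeff a p.2),
          ← Finset.sum_sub_distrib]
        rfl
      -- Characteristic zero: the recursion determines the coefficient of degree n + 1 after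
      -- division by n + 1.
      have hn : ((n : ℂ) + 1) ≠ 0 := by exact_mod_cast n.succ_ne_zero
      have h2 : pcoeff B (n + 1) = ((n : ℂ) + 1)⁻¹ •
          ∑ p ∈ Finset.HasAntidiagonal.antidiagonal n, ⁅pcoeff a p.1, pcoeff B p.2⁆ := by
        rw [← h1, ← h, smul_smul, inv_mul_cancel₀ hn, one_smul]
      rw [h2]
      refine Submodule.smul_mem _ _ (Submodule.sum_mem _ fun p hp => ?_)
      have hp' := Finset.HasAntidiagonal.mem_antidiagonal.1 hp
      have := hVW p.1 p.2 _ (ha p.1) _ (ih p.2 (by omega))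
      rwa [hp'] at this

theorem lcoeff_toLaurent_mem {V : ℤ → Submodule ℂ (Mat m)} {X : PMat m} {i : ℤ}
    (h : ∀ n : ℕ, pcoeff X n ∈ V (i + n)) (n : ℤ) : lcoeff (toLaurent X) n ∈ V (i + n) := by
  rcases lt_or_ge n 0 with hn | hn
  · rw [lcoeff_toLaurent_neg _ hn]
    exact Submodule.zero_mem _
  · lift n to ℕ using hn
    rw [lcoeff_toLaurent_nat]
    exact h n

theorem mul_smul_mul {R : Type} [CommRing R] (s : R) (A B C : Matrix (Fin m) (Fin m) R) :
    A * (s • B) * C = A * B * C * (s • 1) := by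
  simp

/-- The monomial is scalar and factors out, reducing a conjugated Laurent monomial to a conjugated
constant. -/
theorem mul_lmono_mul (φ ψ : PMat m) (j : ℤ) (B : Mat m) :
    toLaurent φ * lmono j B * toLaurent ψ =
      toLaurent (φ * B.map PowerSeries.C * ψ) * lmono j 1 := by
  have h1 : ∀ B : Mat m, lmono j B =
      (HahnSeries.single j 1 : LaurentSeries ℂ) • toLaurent (B.map PowerSeries.C) := by
    intro B
    ext u v : 2
    rw [Matrix.smul_apply, lmono, toLaurent, Matrix.map_apply, Matrix.map_apply, Matrix.map_apply,
      HahnSeries.ofPowerSeries_C, HahnSeries.C_apply, smul_eq_mul, HahnSeries.single_mul_single,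
      add_zero, one_mul]
  rw [h1 B, h1 1, Matrix.map_one _ (map_zero _) (map_one _), toLaurent_one, toLaurent_mul,
    toLaurent_mul, mul_smul_mul]

/-- Membership of the coefficients of `φ Y ψ`, from those of the series `φ B ψ` with constant
`B`. -/
theorem lcoeff_conj_mem {V : ℤ → Submodule ℂ (Mat m)} (φ ψ : PMat m) (Y : LMat m)
    (h : ∀ (j : ℤ) (n : ℕ), pcoeff (φ * (lcoeff Y j).map PowerSeries.C * ψ) n ∈ V (j + n)) (n : ℤ) :
    lcoeff (toLaurent φ * Y * toLaurent ψ) n ∈ V n := by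
  obtain ⟨a, ha⟩ := exists_lcoeff_eq_zero Y
  -- Degree n of the product only sees the coefficients of Y up to degree n, which are finitely many
  -- monomials.
  set Z := ∑ j ∈ Finset.Icc a n, lmono j (lcoeff Y j) with hZ
  have hY : ∀ i < n + 1, lcoeff (Y - Z) i = 0 := by
    intro i hi
    rw [lcoeff_sub, hZ, lcoeff_sum]
    simp only [lcoeff_lmono, Finset.sum_ite_eq, Finset.mem_Icc]
    split_ifs with h
    · exact sub_self _
    · rw [ha i (by omega), sub_zero]
  have h1 : lcoeff (toLaurent φ * (Y - Z) * toLaurent ψ) n = 0 := by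
    have h2 : ∀ i < n + 1, lcoeff (toLaurent φ * (Y - Z)) i = 0 := by
      intro i hi
      rw [lcoeff_mul (a := 0) (fun j hj => lcoeff_toLaurent_neg _ hj) hY,
        Finset.Icc_eq_empty (by omega), Finset.sum_empty]
    rw [lcoeff_mul h2 (b := 0) (fun j hj => lcoeff_toLaurent_neg _ hj),
      Finset.Icc_eq_empty (by omega), Finset.sum_empty]
  have h3 : toLaurent φ * Y * toLaurent ψ = toLaurent φ * (Y - Z) * toLaurent ψ +
      toLaurent φ * Z * toLaurent ψ := by
    rw [mul_sub, sub_mul]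
    abel
  rw [h3, lcoeff_add, h1, zero_add, hZ, Finset.mul_sum, Finset.sum_mul, lcoeff_sum]
  refine Submodule.sum_mem _ fun j _ => ?_
  rw [mul_lmono_mul, lcoeff_mul_lmono, mul_one]
  have := lcoeff_toLaurent_mem (V := V) (h j) (n - j)
  rwa [add_sub_cancel] at this

/-- The two lowest coefficients of `φ Y ψ`. -/
theorem lcoeff_conj_low (φ ψ : PMat m) {Y : LMat m} {a : ℤ} (ha : ∀ j < a, lcoeff Y j = 0) :
    (∀ j < a, lcoeff (toLaurent φ * Y * toLaurent ψ) j = 0) ∧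
    lcoeff (toLaurent φ * Y * toLaurent ψ) a = pcoeff φ 0 * lcoeff Y a * pcoeff ψ 0 ∧
    lcoeff (toLaurent φ * Y * toLaurent ψ) (a + 1) =
      pcoeff φ 0 * lcoeff Y (a + 1) * pcoeff ψ 0 + pcoeff φ 1 * lcoeff Y a * pcoeff ψ 0 +
        pcoeff φ 0 * lcoeff Y a * pcoeff ψ 1 := by
  have hφ : ∀ j < 0, lcoeff (toLaurent φ) j = 0 := fun j hj => lcoeff_toLaurent_neg _ hj
  have hψ : ∀ j < 0, lcoeff (toLaurent ψ) j = 0 := fun j hj => lcoeff_toLaurent_neg _ hj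
  have h0 : ∀ j < a, lcoeff (toLaurent φ * Y) j = 0 := by
    intro j hj
    rw [lcoeff_mul hφ ha, Finset.Icc_eq_empty (by omega), Finset.sum_empty]
  have hI : ∀ b : ℤ, Finset.Icc b (b + 1) = {b, b + 1} := by
    intro b
    ext x
    simp only [Finset.mem_Icc, Finset.mem_insert, Finset.mem_singleton]
    omega
  have hz := fun X : PMat m => lcoeff_toLaurent_nat X 0
  have ho := fun X : PMat m => lcoeff_toLaurent_nat X 1
  simp only [Nat.cast_zero, Nat.cast_one] at hz ho
  have h1 : lcoeff (toLaurent φ * Y) a = pcoeff φ 0 * lcoeff Y a := by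
    rw [lcoeff_mul hφ ha, sub_self, Finset.Icc_self, Finset.sum_singleton, hz, sub_zero]
  have h2 : lcoeff (toLaurent φ * Y) (a + 1) =
      pcoeff φ 0 * lcoeff Y (a + 1) + pcoeff φ 1 * lcoeff Y a := by
    have := hI 0
    rw [zero_add] at this
    rw [lcoeff_mul hφ ha, add_sub_cancel_left, this, Finset.sum_pair (by norm_num), hz, ho,
      sub_zero, add_sub_cancel_right]
  refine ⟨fun j hj => ?_, ?_, ?_⟩
  · rw [lcoeff_mul h0 hψ, Finset.Icc_eq_empty (by omega), Finset.sum_empty]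
  · rw [lcoeff_mul h0 hψ, sub_zero, Finset.Icc_self, Finset.sum_singleton, sub_self, hz, h1]
  · rw [lcoeff_mul h0 hψ, sub_zero, hI, Finset.sum_pair (by simp), add_sub_cancel_left, sub_self,
      ho, hz, h1, h2, add_mul]
    abel

end power

/-! ### The coadjoint orbit of Λ. -/

namespace GaudinData

variable {m N T : ℕ} {D : GaudinData m N T}

theorem lcoeff_lax_zero {q : Config m N} (hq : D.IsResidues (D.residues q)) {j : ℤ} (hj : j < 0) :
    lcoeff (D.expand (D.lax q) .zero) j =
      (if j = -1 then D.A₀₀ q else 0) + if j = -2 then D.A₀₁ q else 0 := by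
  rw [lax_eq hq, expand_add, lcoeff_add, D.lcoeff_poleMap_zero _ hj, D.lcoeff_monoBlock_zero,
    if_neg hj.ne, add_zero]
  rfl

theorem lcoeff_lax_pt {q : Config m N} (hq : D.IsResidues (D.residues q)) (s : Fin N) {j : ℤ}
    (hj : j < 0) : lcoeff (D.expand (D.lax q) (.pt s)) j =
      if j = -1 then (T : ℂ)⁻¹ • D.A q s else 0 := by
  rw [lax_eq hq, expand_add, lcoeff_add, D.lcoeff_poleMap_pt hq.2.2 s hj,
    D.lcoeff_monoBlock_pt _ _ s hj, add_zero]
  rfl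

theorem lcoeff_lax_infty {q : Config m N} (hq : D.IsResidues (D.residues q)) {j : ℤ} (hj : j < 1) :
    lcoeff (D.expand (D.lax q) .infty) j = if j = 0 then D.Λinf else 0 := by
  rw [lax_eq hq, expand_add, lcoeff_add, D.lcoeff_poleMap_infty _ hj, D.lcoeff_monoBlock_infty,
    zero_add, neg_zero]

theorem isConfig_one : D.IsConfig ((fun _ => 1), 1, 0) := by
  refine ⟨fun s => ⟨1, rfl⟩, ⟨1, map_one _, rfl⟩, ?_⟩
  rw [zero_mul]
  exact D.zero_mem_grade 1

/-- Λ is the Lax matrix at the trivial field, so the expansions computed for Lax matrices apply to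
it. -/
theorem ratLambda_eq : D.ratLambda = D.lax ((fun _ => 1), 1, 0) := by
  have h : D.A ((fun _ => 1), 1, 0) = D.Λ := by
    funext s
    simp [A]
  simp [lax, ratLambda, A₀₀, A₀₁, h]

/-- A uniform description of the components of elements of the loop group. -/
theorem IsLoopGroupPlus.component {φ : TaylorTuple m N} (hφ : D.IsLoopGroupPlus φ) (r : Pt N) :
    IsUnit (pcoeff (φ r) 0) ∧
    (∀ n : ℕ, pcoeff (loopLogDeriv (φ r)) n ∈ D.coeffSpace 0 r (n + 1)) ∧
    ∀ k j B, B ∈ D.coeffSpace k r j →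
      pcoeff (φ r) 0 * B * (pcoeff (φ r) 0)⁻¹ ∈ D.coeffSpace k r j := by
  obtain ⟨⟨⟨g, hg, hg0⟩, h0⟩, h1, hinf, h2⟩ := hφ
  cases r with
  | zero =>
    refine ⟨hg0 ▸ gmat_isUnit g, fun n => ?_, fun k j B hB => ?_⟩
    · have := h0 n
      rw [← zero_add ((n : ℤ) + 1)] at this
      exact this
    · rw [← hg0]
      exact D.conj_mem_grade hg hB
  | pt s =>
    obtain ⟨⟨g, hg⟩, h⟩ := h1 s
    refine ⟨hg ▸ gmat_isUnit g, h, fun k j B hB => ?_⟩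
    rw [← hg]
    exact D.conj_mem g hB
  | infty =>
    refine ⟨hinf ▸ isUnit_one, fun n => ?_, fun k j B hB => ?_⟩
    · have := h2 n
      rw [← zero_sub] at this
      exact this
    · rw [hinf, inv_one, one_mul, mul_one]
      exact hB

/-- Conjugation by the constant term preserves each coefficient space. The logarithmic derivative
then propagates this to all orders through the formal differential equation. -/
theorem IsLoop.coadjoint {φ : TaylorTuple m N} (hφ : D.IsLoopGroupPlus φ) {k : ℤ} {Y : Tuple m N}
    (hY : D.IsLoop k Y) : D.IsLoop k (CyclotomicGaudin.coadjoint φ Y) := by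
  rw [isLoop_iff] at hY ⊢
  intro r n
  obtain ⟨hu, ha, hconj⟩ := hφ.component r
  refine lcoeff_conj_mem (V := D.coeffSpace k r) _ _ _ (fun j n => ?_) n
  refine pcoeff_mem_of_derivMat (derivMat_conj hu _) (V := fun n : ℕ => D.coeffSpace k r (j + n))
    (W := fun n : ℕ => D.coeffSpace 0 r (n + 1)) ?_ ha (fun i l x hx y hy => ?_) n
  · rw [pcoeff_const_mul, pcoeff_inv_zero hu]
    simpa using hconj k j _ (hY r j)
  -- The logarithmic derivative has its n-th coefficient in degree n + 1, because differentiation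
  -- lowers the power by one; this matches the step of the recursion.
  · have := D.lie_mem_coeffSpace hx hy
    rw [zero_add, show (i : ℤ) + 1 + (j + l) = j + ((i + l + 1 : ℕ) : ℤ) by push_cast; ring] at this
    exact this

theorem IsLoopGroupPlus.isConfig {φ : TaylorTuple m N} (hφ : D.IsLoopGroupPlus φ) :
    D.IsConfig (components φ) := by
  refine ⟨fun s => (hφ.2.1 s).1, hφ.1.1, ?_⟩
  have h := hφ.1.2 0
  have e : pcoeff (loopLogDeriv (φ .zero)) 0 = pcoeff (φ .zero) 1 * (pcoeff (φ .zero) 0)⁻¹ := by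
    rw [show loopLogDeriv (φ .zero) = derivMat (φ .zero) * (φ .zero)⁻¹ from rfl, pcoeff_mul,
      ← pcoeff_inv_zero (hφ.component .zero).1]
    simp [pcoeff_derivMat]
  rw [e, Nat.cast_zero, zero_add] at h
  exact h

/-- Conjugation by Taylor series does not increase pole orders, so only the lowest coefficients of
the conjugate need to be compared with those of L: two at 0, one at each ζ_s and the constant at ∞.
-/
theorem isMinusPart_lax {φ : TaylorTuple m N} (hφ : D.IsLoopGroupPlus φ) :
    D.IsMinusPart (coadjoint φ (D.expand D.ratLambda)) (D.lax (components φ)) := by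
  have hq := hφ.isConfig.residues
  have h1 := (isConfig_one (D := D)).residues
  refine ⟨lax_isEquivariant hq, D.isLoopPlus_iff.2 ⟨IsLoop.sub (IsLoop.coadjoint hφ ?_)
    (IsEquivariant.isLoop (lax_isEquivariant hq)), fun r j hj => ?_⟩⟩
  · rw [ratLambda_eq]
    exact (lax_isEquivariant h1).isLoop
  rw [ratLambda_eq]
  have hu := (hφ.component r).1
  have hinv := pcoeff_inv_zero hu
  rw [Pi.sub_apply, lcoeff_sub, sub_eq_zero]
  change lcoeff (toLaurent (φ r) * _ * toLaurent (φ r)⁻¹) j = _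
  cases r with
  | zero =>
    have hj : j < 0 := hj
    have ha : ∀ j < -2, lcoeff (D.expand (D.lax ((fun _ => 1), 1, 0)) .zero) j = 0 := by
      intro j hj
      rw [lcoeff_lax_zero h1 (by omega), if_neg (by omega), if_neg (by omega), add_zero]
    obtain ⟨hl0, hl1, hl2⟩ := lcoeff_conj_low (φ .zero) (φ .zero)⁻¹ ha
    rw [lcoeff_lax_zero hq hj]
    rcases lt_trichotomy j (-2) with h | h | h
    · rw [hl0 j h, if_neg (by omega), if_neg (by omega), add_zero]
    · subst h
      rw [hl1, lcoeff_lax_zero h1 hj, hinv]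
      simp [A₀₁, components]
    -- The residue at the origin: the first-order coefficients of φ₀ and φ₀⁻¹ against the double
    -- pole give the bracket [φ₀^{(1)} φ₀^{(0)⁻¹}, A₀^{(1)}].
    · obtain rfl : j = -2 + 1 := by omega
      rw [hl2, lcoeff_lax_zero h1 hj, lcoeff_lax_zero h1 (by norm_num), hinv, pcoeff_inv_one hu]
      have hc : (pcoeff (φ .zero) 0)⁻¹ * pcoeff (φ .zero) 0 = 1 :=
        Matrix.nonsing_inv_mul _ ((Matrix.isUnit_iff_isUnit_det _).1 hu)
      have e : pcoeff (φ .zero) 1 * (pcoeff (φ .zero) 0)⁻¹ *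
          (pcoeff (φ .zero) 0 * D.Λ₀₁ * (pcoeff (φ .zero) 0)⁻¹) =
          pcoeff (φ .zero) 1 * D.Λ₀₁ * (pcoeff (φ .zero) 0)⁻¹ := by
        rw [show ∀ a b c d : Mat m, a * b * (c * d * b) = a * (b * c) * d * b by
          intros; noncomm_ring, hc, mul_one]
      simp only [A₀₀, A₀₁, components, Ring.lie_def, e]
      simp
      noncomm_ring
  | pt s =>
    have hj : j < 0 := hj
    have ha : ∀ j < -1, lcoeff (D.expand (D.lax ((fun _ => 1), 1, 0)) (.pt s)) j = 0 := by
      intro j hj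
      rw [lcoeff_lax_pt h1 s (by omega), if_neg (by omega)]
    obtain ⟨hl0, hl1, -⟩ := lcoeff_conj_low (φ (.pt s)) (φ (.pt s))⁻¹ ha
    rw [lcoeff_lax_pt hq s hj]
    rcases lt_or_eq_of_le (show j ≤ -1 by omega) with h | h
    · rw [hl0 j h, if_neg (by omega)]
    · subst h
      rw [hl1, lcoeff_lax_pt h1 s hj, hinv]
      simp [A, components]
  | infty =>
    have hj : j < 1 := hj
    have ha : ∀ j < 0, lcoeff (D.expand (D.lax ((fun _ => 1), 1, 0)) .infty) j = 0 := by
      intro j hj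
      rw [lcoeff_lax_infty h1 (by omega), if_neg (by omega)]
    obtain ⟨hl0, hl1, -⟩ := lcoeff_conj_low (φ .infty) (φ .infty)⁻¹ ha
    rw [lcoeff_lax_infty hq hj]
    rcases lt_or_eq_of_le (show j ≤ 0 by omega) with h | h
    · rw [hl0 j h, if_neg (by omega)]
    -- The normalisation φ_∞^{(0)} = 1 is what keeps Λ_∞ undressed.
    · subst h
      rw [hl1, lcoeff_lax_infty h1 hj, hinv, hφ.2.2.1]
      simp

theorem isMinusPart_iff {φ : TaylorTuple m N} (hφ : D.IsLoopGroupPlus φ) (g : RatMat m) :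
    D.IsMinusPart (coadjoint φ (D.expand D.ratLambda)) g ↔ g = D.lax (components φ) := by
  have h := isMinusPart_lax hφ
  constructor
  · intro hg
    exact IsEquivariant.eq_of_isLoopPlus hg.1 h.1 hg.2 h.2
  · rintro rfl
    exact h

end GaudinData

/-! ### Calculus of matrix-valued fields -/

section fields

theorem fderiv_comp_linear {V W E : Type} [NormedAddCommGroup V] [NormedSpace ℝ V]
    [FiniteDimensional ℝ V] [NormedAddCommGroup W] [NormedSpace ℝ W]
    [NormedAddCommGroup E] [NormedSpace ℝ E]
    (ℓ : V →ₗ[ℝ] W) {f : E → V} {x : E} (hf : DifferentiableAt ℝ f x) (w : E) :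
    DifferentiableAt ℝ (fun y => ℓ (f y)) x ∧
      fderiv ℝ (fun y => ℓ (f y)) x w = ℓ (fderiv ℝ f x w) := by
  have h := (LinearMap.toContinuousLinearMap ℓ).hasFDerivAt.comp x hf.hasFDerivAt
  have h2 : HasFDerivAt (fun y => ℓ (f y)) ((LinearMap.toContinuousLinearMap ℓ).comp (fderiv ℝ f x))
    x := h
  exact ⟨h2.differentiableAt, by rw [h2.fderiv]; rfl⟩

/-- A linear map on a finite-dimensional space, as a continuous linear map. -/
noncomputable def toCLM {V W : Type} [NormedAddCommGroup V] [NormedSpace ℝ V]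
    [FiniteDimensional ℝ V] [NormedAddCommGroup W] [NormedSpace ℝ W] (ℓ : V →ₗ[ℝ] W) : V →L[ℝ] W :=
  LinearMap.toContinuousLinearMap ℓ

section triple

variable {V E : Type} [NormedAddCommGroup V] [NormedSpace ℝ V] [NormedAddCommGroup E]
  [NormedSpace ℝ E] {ι : Type} [Fintype ι] {Φ : E → (ι → V) × V × V} {x : E}

theorem differentiableAt_triple_iff : DifferentiableAt ℝ Φ x ↔
    (∀ s, DifferentiableAt ℝ (fun y => (Φ y).1 s) x) ∧
      DifferentiableAt ℝ (fun y => (Φ y).2.1) x ∧ DifferentiableAt ℝ (fun y => (Φ y).2.2) x := by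
  constructor
  · intro h
    exact ⟨fun s => differentiableAt_pi.1 h.fst s, h.snd.fst, h.snd.snd⟩
  · rintro ⟨h1, h2, h3⟩
    exact (differentiableAt_pi.2 h1).prodMk (h2.prodMk h3)

theorem fderiv_triple (h : DifferentiableAt ℝ Φ x) (w : E) :
    (∀ s, (fderiv ℝ Φ x w).1 s = fderiv ℝ (fun y => (Φ y).1 s) x w) ∧
      (fderiv ℝ Φ x w).2.1 = fderiv ℝ (fun y => (Φ y).2.1) x w ∧
      (fderiv ℝ Φ x w).2.2 = fderiv ℝ (fun y => (Φ y).2.2) x w := by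
  refine ⟨fun s => ?_, ?_, ?_⟩
  · have h1 := (hasFDerivAt_pi'.1 h.hasFDerivAt.fst s).fderiv
    rw [h1]
    rfl
  · rw [h.hasFDerivAt.snd.fst.fderiv]
    rfl
  · rw [h.hasFDerivAt.snd.snd.fderiv]
    rfl

theorem contDiffAt_triple_iff {n : WithTop ℕ∞} : ContDiffAt ℝ n Φ x ↔
    (∀ s, ContDiffAt ℝ n (fun y => (Φ y).1 s) x) ∧
      ContDiffAt ℝ n (fun y => (Φ y).2.1) x ∧ ContDiffAt ℝ n (fun y => (Φ y).2.2) x := by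
  constructor
  · intro h
    exact ⟨fun s => contDiffAt_pi.1 h.fst s, h.snd.fst, h.snd.snd⟩
  · rintro ⟨h1, h2, h3⟩
    exact (contDiffAt_pi.2 h1).prodMk (h2.prodMk h3)

end triple

variable {m : ℕ}

instance : FiniteDimensional ℝ (Mat m) := inferInstance

/-- The trace as a real-linear map. -/
noncomputable def realTrace (m : ℕ) : Mat m →ₗ[ℝ] ℂ :=
  (Matrix.traceLinearMap (Fin m) ℂ ℂ).restrictScalars ℝ

theorem realTrace_apply (X : Mat m) : toCLM (realTrace m) X = Matrix.trace X := rfl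

theorem realTrace_mul_comm (X Y : Mat m) :
    toCLM (realTrace m) (X * Y) = toCLM (realTrace m) (Y * X) := by
  rw [realTrace_apply, realTrace_apply, Matrix.trace_mul_comm]

end fields

/-! ### The geometric Lagrangian -/

section pairing

variable {m N T : ℕ}

theorem Icc_add_one (b : ℤ) : Finset.Icc b (b + 1) = {b, b + 1} := by
  ext x
  simp only [Finset.mem_Icc, Finset.mem_insert, Finset.mem_singleton]
  omega

/-- The pairing of a tuple with poles of low order and a tuple of Taylor series. -/
theorem pairing_of_low {Y V : Tuple m N}
    (h0 : ∀ j < -2, lcoeff (Y .zero) j = 0) (h1 : ∀ s, ∀ j < -1, lcoeff (Y (.pt s)) j = 0)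
    (h2 : ∀ j < 0, lcoeff (Y .infty) j = 0) (hV : ∀ r, ∀ j < 0, lcoeff (V r) j = 0) :
    pairing T Y V =
      ∑ s, Matrix.trace (((T : ℂ) • lcoeff (Y (.pt s)) (-1)) * lcoeff (V (.pt s)) 0) +
        (Matrix.trace (lcoeff (Y .zero) (-1) * lcoeff (V .zero) 0) +
          Matrix.trace (lcoeff (Y .zero) (-2) * lcoeff (V .zero) 1)) -
        (Matrix.trace (lcoeff (Y .infty) 0 * lcoeff (V .infty) 1) +
          Matrix.trace (lcoeff (Y .infty) 1 * lcoeff (V .infty) 0)) := by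
  have e1 := Icc_add_one (-2)
  have e2 := Icc_add_one 0
  norm_num at e1 e2
  simp only [pairing_eq, localPairing_eq, weight, resSign, resIdx, one_mul, mul_one, neg_mul]
  rw [lcoeff_mul h0 (hV .zero), lcoeff_mul h2 (hV .infty), sub_zero, sub_zero, e1, e2,
    Finset.sum_pair (by norm_num), Finset.sum_pair (by norm_num), Matrix.trace_add,
    Matrix.trace_add]
  have e3 : ∀ s, (T : ℂ) * Matrix.trace (lcoeff (Y (.pt s) * V (.pt s)) (-1)) =
      Matrix.trace (((T : ℂ) • lcoeff (Y (.pt s)) (-1)) * lcoeff (V (.pt s)) 0) := by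
    intro s
    rw [lcoeff_mul (h1 s) (hV (.pt s)), sub_zero, Finset.Icc_self, Finset.sum_singleton, sub_self,
      Matrix.smul_mul, Matrix.trace_smul, smul_eq_mul]
  simp only [e3]
  norm_num
  ring

end pairing

section velocity

theorem pd_congr {N : ℕ} {I : Finset (ℕ × Pt N)} {V : Type} [NormedAddCommGroup V]
    [NormedSpace ℝ V] {i : I} {F G : (I → ℝ) → V} {t : I → ℝ} (h : F =ᶠ[nhds t] G) :
    pd i F t = pd i G t := by
  rw [pd, pd, h.fderiv_eq]

theorem pd_const {N : ℕ} {I : Finset (ℕ × Pt N)} {V : Type} [NormedAddCommGroup V]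
    [NormedSpace ℝ V] (i : I) (c : V) (t : I → ℝ) : pd i (fun _ => c) t = 0 := by
  rw [pd, fderiv_fun_const]
  rfl

/-- With a = φ₀^{(0)} and b its inverse, this moves the differential of b φ₀^{(1)}, paired with
Λ₀^{(1)}, to the right-invariant velocity paired with A₀^{(1)}. -/
theorem trace_conj_eq {m : ℕ} {a b : Mat m} (h : b * a = 1) (L x y z : Mat m) :
    Matrix.trace (L * (b * x - b * y * b * z)) =
      Matrix.trace (a * L * b * (x * b - y * (b * z * b))) := by
  rw [mul_assoc a, mul_assoc a, Matrix.trace_mul_comm a]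
  simp only [mul_sub, sub_mul, mul_assoc, h, mul_one]

variable {m N : ℕ} {I : Finset (ℕ × Pt N)}

theorem pcoeff_pd {φ : (I → ℝ) → TaylorTuple m N} {t : I → ℝ} (i : I) (r : Pt N)
    (h : ∀ k, DifferentiableAt ℝ (fun t => pcoeff (φ t r) k) t) (k : ℕ) :
    pcoeff (Matrix.of fun a b => PowerSeries.mk fun k =>
      pd i (fun t' => PowerSeries.coeff k (φ t' r a b)) t) k =
      pd i (fun t' => pcoeff (φ t' r) k) t := by
  ext a b
  rw [pcoeff_apply, Matrix.of_apply, PowerSeries.coeff_mk]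
  exact (fderiv_comp_linear (Matrix.entryLinearMap ℝ ℂ a b) (h k) _).2

theorem lcoeff_rightVelocity_neg (φ : (I → ℝ) → TaylorTuple m N) (t : I → ℝ) (i : I) (r : Pt N)
    {j : ℤ} (hj : j < 0) : lcoeff (rightVelocity i φ t r) j = 0 :=
  lcoeff_toLaurent_neg _ hj

theorem lcoeff_rightVelocity_zero {φ : (I → ℝ) → TaylorTuple m N} {t : I → ℝ} (i : I) (r : Pt N)
    (h : ∀ k, DifferentiableAt ℝ (fun t => pcoeff (φ t r) k) t)
    (hu : IsUnit (pcoeff (φ t r) 0)) : lcoeff (rightVelocity i φ t r) 0 =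
      pd i (fun t' => pcoeff (φ t' r) 0) t * (pcoeff (φ t r) 0)⁻¹ := by
  have := lcoeff_toLaurent_nat ((Matrix.of fun a b => PowerSeries.mk fun k =>
      pd i (fun t' => PowerSeries.coeff k (φ t' r a b)) t) * (φ t r)⁻¹) 0
  rw [pcoeff_mul, Finset.Nat.antidiagonal_zero, Finset.sum_singleton, pcoeff_pd i r h,
    pcoeff_inv_zero hu] at this
  exact this

theorem lcoeff_rightVelocity_one {φ : (I → ℝ) → TaylorTuple m N} {t : I → ℝ} (i : I) (r : Pt N)
    (h : ∀ k, DifferentiableAt ℝ (fun t => pcoeff (φ t r) k) t)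
    (hu : IsUnit (pcoeff (φ t r) 0)) : lcoeff (rightVelocity i φ t r) 1 =
      pd i (fun t' => pcoeff (φ t' r) 1) t * (pcoeff (φ t r) 0)⁻¹ -
        pd i (fun t' => pcoeff (φ t' r) 0) t *
          ((pcoeff (φ t r) 0)⁻¹ * pcoeff (φ t r) 1 * (pcoeff (φ t r) 0)⁻¹) := by
  have := lcoeff_toLaurent_nat ((Matrix.of fun a b => PowerSeries.mk fun k =>
      pd i (fun t' => PowerSeries.coeff k (φ t' r a b)) t) * (φ t r)⁻¹) 1
  rw [pcoeff_mul_one, pcoeff_pd i r h, pcoeff_pd i r h, pcoeff_inv_zero hu, pcoeff_inv_one hu,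
    mul_neg, neg_add_eq_sub] at this
  exact this

end velocity

namespace GaudinData

variable {m N T : ℕ} (D : GaudinData m N T)

/-- The potential of the exact part of the geometric Lagrangian one-form. -/
noncomputable def potential (φ : TaylorTuple m N) : ℂ :=
  Matrix.trace (D.Λ₀₁ * ((pcoeff (φ .zero) 0)⁻¹ * pcoeff (φ .zero) 1)) -
    Matrix.trace (D.Λinf * pcoeff (φ .infty) 1)

theorem fderiv_potential {E : Type} [NormedAddCommGroup E] [NormedSpace ℝ E]
    {φ : E → TaylorTuple m N} {x : E} (hu : IsUnit (pcoeff (φ x .zero) 0))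
    (h : ∀ r k, DifferentiableAt ℝ (fun y => pcoeff (φ y r) k) x) (w : E) :
    DifferentiableAt ℝ (fun y => D.potential (φ y)) x ∧
    fderiv ℝ (fun y => D.potential (φ y)) x w =
      Matrix.trace (D.Λ₀₁ * ((pcoeff (φ x .zero) 0)⁻¹ *
          fderiv ℝ (fun y => pcoeff (φ y .zero) 1) x w -
        (pcoeff (φ x .zero) 0)⁻¹ * fderiv ℝ (fun y => pcoeff (φ y .zero) 0) x w *
          (pcoeff (φ x .zero) 0)⁻¹ * pcoeff (φ x .zero) 1)) -
      Matrix.trace (D.Λinf * fderiv ℝ (fun y => pcoeff (φ y .infty) 1) x w) := by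
  have hi := differentiableAt_inverse' (h .zero 0) hu
  have hi' := fderiv_inverse_apply' (h .zero 0) hu w
  simp only [← Matrix.nonsing_inv_eq_ringInverse] at hi hi'
  have hm : DifferentiableAt ℝ
      (fun y => (pcoeff (φ y .zero) 0)⁻¹ * pcoeff (φ y .zero) 1) x := hi.mul (h .zero 1)
  have hm' := fderiv_mul_apply' hi (h .zero 1) w
  rw [hi'] at hm'
  obtain ⟨d1, e1⟩ := fderiv_comp_linear
    (realTrace m ∘ₗ LinearMap.mulLeft ℝ D.Λ₀₁) hm w
  obtain ⟨d2, e2⟩ := fderiv_comp_linear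
    (realTrace m ∘ₗ LinearMap.mulLeft ℝ D.Λinf) (h .infty 1) w
  refine ⟨d1.sub d2, ?_⟩
  have := congrArg (fun L => L w) (fderiv_fun_sub d1 d2)
  refine this.trans ?_
  rw [sub_apply, e1, e2, hm']
  change Matrix.trace (D.Λ₀₁ * _) - Matrix.trace (D.Λinf * _) = _
  rw [neg_mul, neg_add_eq_sub]
  rfl

variable {D} {I : Finset (ℕ × Pt N)}

/-- The velocity is a Taylor tuple, so only a few coefficients of L enter. The terms at the ζ_s and
at order zero at the origin form the Lagrangian. The two remaining ones, A₀^{(1)} against the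
first-order velocity at 0 and Λ_∞ against the one at ∞, are exact. -/
theorem geometricLagrangian_eq {U : Set (I → ℝ)} (hU : IsOpen U)
    {φ : (I → ℝ) → TaylorTuple m N} (hφ : ∀ t ∈ U, D.IsLoopGroupPlus (φ t))
    (hs : ∀ r k, ContDiffOn ℝ ((⊤ : ℕ∞) : WithTop ℕ∞) (fun t => pcoeff (φ t r) k) U)
    {t : I → ℝ} (ht : t ∈ U) (i : I) {f : RatMat m} (hf : D.IsEquivariant 0 f) :
    D.geometricLagrangian i φ f t (D.lax (components (φ t))) =
      D.lagrangian i (components (φ t)) (jet (fun t' => components (φ t')) t) +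
        pd i (fun t' => D.potential (φ t')) t := by
  have hd : ∀ r k, DifferentiableAt ℝ (fun t => pcoeff (φ t r) k) t := fun r k =>
    ((hs r k).contDiffAt (hU.mem_nhds ht)).differentiableAt (by simp)
  have hq := (hφ t ht).isConfig.residues
  have hu : ∀ r, IsUnit (pcoeff (φ t r) 0) := fun r => ((hφ t ht).component r).1
  -- The constant term at infinity is frozen, so the λ_∞-coefficient of L, which is dynamical, drops
  -- out of the pairing.
  have hinf : pd i (fun t' => pcoeff (φ t' .infty) 0) t = 0 := by
    have : (fun t' => pcoeff (φ t' .infty) 0) =ᶠ[nhds t] fun _ => 1 := by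
      filter_upwards [hU.mem_nhds ht] with t' ht'
      exact (hφ t' ht').2.2.1
    rw [pd_congr this, pd_const]
  have hc : DifferentiableAt ℝ (fun t' => components (φ t')) t :=
    differentiableAt_triple_iff.2 ⟨fun s => hd (.pt s) 0, hd .zero 0, hd .zero 1⟩
  obtain ⟨j1, j2, -⟩ := fderiv_triple hc (Pi.single i 1)
  have hpot := (D.fderiv_potential (hu .zero) hd (Pi.single i 1)).2
  rw [geometricLagrangian, lagrangian, pairing_add_right,
    pairing_expand_expand D (lax_isEquivariant hq) hf, add_zero]
  rw [pairing_of_low (fun j hj => ?_) (fun s j hj => ?_) (fun j hj => ?_)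
    (fun r j hj => lcoeff_rightVelocity_neg φ t i r hj)]
  rotate_left
  · rw [lcoeff_lax_zero hq (by omega), if_neg (by omega), if_neg (by omega), add_zero]
  · rw [lcoeff_lax_pt hq s (by omega), if_neg (by omega)]
  · rw [lcoeff_lax_infty hq (by omega), if_neg (by omega)]
  rw [lcoeff_rightVelocity_zero i .zero (hd .zero) (hu .zero),
    lcoeff_rightVelocity_one i .zero (hd .zero) (hu .zero),
    lcoeff_rightVelocity_zero i .infty (hd .infty) (hu .infty),
    lcoeff_rightVelocity_one i .infty (hd .infty) (hu .infty), hinf,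
    lcoeff_lax_zero hq (by norm_num), lcoeff_lax_zero hq (by norm_num),
    lcoeff_lax_infty hq (by norm_num)]
  have hpt : ∀ s, (T : ℂ) • lcoeff (D.expand (D.lax (components (φ t))) (.pt s)) (-1) =
      D.A (components (φ t)) s := by
    intro s
    rw [lcoeff_lax_pt hq s (by norm_num), if_pos rfl, smul_smul, mul_inv_cancel₀ D.T_ne_zero,
      one_smul]
  have hv : ∀ s, lcoeff (rightVelocity i φ t (.pt s)) 0 =
      (jet (fun t' => components (φ t')) t i).1 s * ((components (φ t)).1 s)⁻¹ := by
    intro s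
    rw [lcoeff_rightVelocity_zero i (.pt s) (hd (.pt s)) (hu (.pt s))]
    exact congrArg (· * _) (j1 s).symm
  have hv0 : pd i (fun t' => pcoeff (φ t' .zero) 0) t =
      (jet (fun t' => components (φ t')) t i).2.1 := j2.symm
  have hp : pd i (fun t' => D.potential (φ t')) t =
      Matrix.trace (D.A₀₁ (components (φ t)) * (pd i (fun t' => pcoeff (φ t' .zero) 1) t *
        (pcoeff (φ t .zero) 0)⁻¹ - pd i (fun t' => pcoeff (φ t' .zero) 0) t *
          ((pcoeff (φ t .zero) 0)⁻¹ * pcoeff (φ t .zero) 1 * (pcoeff (φ t .zero) 0)⁻¹))) -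
      Matrix.trace (D.Λinf * pd i (fun t' => pcoeff (φ t' .infty) 1) t) := by
    refine hpot.trans ?_
    congr 1
    change _ = Matrix.trace (pcoeff (φ t .zero) 0 * D.Λ₀₁ * (pcoeff (φ t .zero) 0)⁻¹ * _)
    exact trace_conj_eq (Matrix.nonsing_inv_mul _ ((Matrix.isUnit_iff_isUnit_det _).1 (hu .zero)))
      _ _ _ _
  have hinf0 : (pcoeff (φ t .infty) 0)⁻¹ = 1 := by rw [(hφ t ht).2.2.1, inv_one]
  simp only [hpt, hv, hp, hv0, hinf0]
  norm_num
  have : ((components (φ t)).2.1) = pcoeff (φ t .zero) 0 := rfl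
  rw [this]
  ring

end GaudinData

/-! ### The residues of the Lax matrix as a phase space -/

namespace GaudinData

variable {m N : ℕ}

/-- Elements `(x₀, x₁, x_s)` of the truncated Lie algebra acting on the residues. -/
abbrev Truncated (m N : ℕ) := Mat m × Mat m × (Fin N → Mat m)

/-- The coadjoint action of the truncated Lie algebra on residues. -/
def lieRes (ξ : Truncated m N) (B : Residues m N) : Residues m N :=
  (⁅ξ.1, B.1⁆ + ⁅ξ.2.1, B.2.1⁆, ⁅ξ.1, B.2.1⁆, fun s => ⁅ξ.2.2 s, B.2.2 s⁆)

/-- The pairing of residues with the truncated Lie algebra. -/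
def resPair (B : Residues m N) (ξ : Truncated m N) : ℂ :=
  ∑ s, Matrix.trace (B.2.2 s * ξ.2.2 s) +
    (Matrix.trace (B.1 * ξ.1) + Matrix.trace (B.2.1 * ξ.2.1))

theorem resPair_sub (B C : Residues m N) (ξ : Truncated m N) :
    resPair (B - C) ξ = resPair B ξ - resPair C ξ := by
  simp only [resPair, Prod.fst_sub, Prod.snd_sub, Pi.sub_apply, sub_mul, Matrix.trace_sub,
    Finset.sum_sub_distrib]
  ring

theorem trace_lie_mul (x b y : Mat m) :
    Matrix.trace (⁅x, b⁆ * y) = -Matrix.trace (⁅y, b⁆ * x) := by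
  simp only [Ring.lie_def, sub_mul, Matrix.trace_sub]
  rw [Matrix.trace_mul_comm (b * x) y, mul_assoc x b y, Matrix.trace_mul_comm x, ← mul_assoc y b x,
    mul_assoc b y x, Matrix.trace_mul_comm b, mul_assoc y x b, Matrix.trace_mul_comm y (x * b)]
  rw [mul_assoc x b y, Matrix.trace_mul_comm x (b * y)]
  ring

/-- Antisymmetry of the Kirillov–Kostant form; the two off-diagonal terms involving the double pole
are exchanged with each other. -/
theorem resPair_lieRes (ξ η : Truncated m N) (B : Residues m N) :
    resPair (lieRes ξ B) η = -resPair (lieRes η B) ξ := by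
  simp only [resPair, lieRes, add_mul, Matrix.trace_add]
  rw [Finset.sum_congr rfl fun s _ => trace_lie_mul (ξ.2.2 s) (B.2.2 s) (η.2.2 s),
    Finset.sum_neg_distrib, trace_lie_mul ξ.1 B.1, trace_lie_mul ξ.2.1 B.2.1,
    trace_lie_mul ξ.1 B.2.1]
  ring

end GaudinData

section blocks

variable {m : ℕ}

theorem monoBlock_add (n : ℤ) (B C : Mat m) :
    monoBlock n (B + C) = monoBlock n B + monoBlock n C := by
  rw [monoBlock, Matrix.map_add _ (map_add _), smul_add]
  rfl

theorem map_C_smul (c : ℂ) (B : Mat m) :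
    (c • B).map RatFunc.C = RatFunc.C c • B.map (RatFunc.C : ℂ →+* RatFunc ℂ) := by
  ext a b
  simp

theorem monoBlock_smul (n : ℤ) (c : ℂ) (B : Mat m) :
    monoBlock n (c • B) = RatFunc.C c • monoBlock n B := by
  rw [monoBlock, map_C_smul, smul_comm]
  rfl

theorem poleBlock_add (a : ℂ) (n : ℕ) (B C : Mat m) :
    poleBlock a n (B + C) = poleBlock a n B + poleBlock a n C := by
  rw [poleBlock, Matrix.map_add _ (map_add _), smul_add]
  rfl

theorem poleBlock_smul (a : ℂ) (n : ℕ) (c : ℂ) (B : Mat m) :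
    poleBlock a n (c • B) = RatFunc.C c • poleBlock a n B := by
  rw [poleBlock, map_C_smul, smul_comm]
  rfl

end blocks

namespace GaudinData

variable {m N T : ℕ} (D : GaudinData m N T)

theorem poleMap_add (B C : Residues m N) : D.poleMap (B + C) = D.poleMap B + D.poleMap C := by
  simp only [poleMap, Prod.fst_add, Prod.snd_add, Pi.add_apply, monoBlock_add, orbitBlock, map_add,
    smul_add, poleBlock_add, Finset.sum_add_distrib]
  abel

theorem poleMap_smul (c : ℂ) (B : Residues m N) :
    D.poleMap (c • B) = RatFunc.C c • D.poleMap B := by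
  simp only [poleMap, Prod.smul_fst, Prod.smul_snd, Pi.smul_apply, monoBlock_smul, orbitBlock,
    map_smul, smul_add, Finset.smul_sum]
  simp only [smul_comm _ c, poleBlock_smul]
  simp only [smul_comm _ (RatFunc.C c)]

theorem poleMap_regM {z : ℂ} (hz : z ∉ D.finitePoles) (B : Residues m N) :
    RegM z (D.poleMap B) :=
  ((monoBlock_regM (D.ne_zero_of_not_mem hz) _ _).add
    (monoBlock_regM (D.ne_zero_of_not_mem hz) _ _)).add
    (RegM.smul (reg_C _ _) (RegM.sum _ fun _ _ => D.orbitBlock_regM hz _ _ _ _))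

/-- The expansion of `poleMap` at a marked point, as a linear map. -/
noncomputable def poleExpand (r : Pt N) : Residues m N →ₗ[ℂ] LMat m where
  toFun B := D.expand (D.poleMap B) r
  map_add' B C := by rw [poleMap_add, expand_add]
  map_smul' c B := by
    rw [poleMap_smul, expand_smul, expandHom_C]
    ext a b : 2
    rw [Matrix.smul_apply, RingHom.id_apply, Matrix.smul_apply, smul_eq_mul]
    exact congrArg HahnSeries.coeff
      (HahnSeries.C_mul_eq_smul (r := c) (x := D.expand (D.poleMap B) r a b))

/-- The value of `poleMap` at a regular point, as a linear map. -/
noncomputable def poleEval {z : ℂ} (hz : z ∉ D.finitePoles) : Residues m N →ₗ[ℂ] Mat m where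
  toFun B := evalAt z (D.poleMap B)
  map_add' B C := by rw [poleMap_add, evalAt_add (D.poleMap_regM hz B) (D.poleMap_regM hz C)]
  map_smul' c B := by
    rw [poleMap_smul, evalAt_smul (reg_C _ _) (D.poleMap_regM hz B), ev_C, RingHom.id_apply]

/-- The truncated Lie algebra of `D`. -/
def IsTruncated (ξ : Truncated m N) : Prop :=
  ξ.1 ∈ D.grade 0 ∧ ξ.2.1 ∈ D.grade 1 ∧ ∀ s, ξ.2.2 s ∈ D.𝔤

variable {D}

theorem IsResidues.lieRes_mem {ξ : Truncated m N} (hξ : D.IsTruncated ξ) {B : Residues m N}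
    (hB : D.IsResidues B) : D.IsResidues (lieRes ξ B) := by
  obtain ⟨h0, h1, hs⟩ := hξ
  obtain ⟨b0, b1, bs⟩ := hB
  refine ⟨?_, ?_, fun s => D.𝔤.lie_mem (hs s) (bs s)⟩
  · have e0 := D.lie_mem_grade h0 b0
    have e1 := D.lie_mem_grade h1 b1
    rw [add_zero] at e0
    rw [add_neg_cancel] at e1
    exact (D.gradeSub 0).add_mem e0 e1
  · have e0 := D.lie_mem_grade h0 b1
    rwa [zero_add] at e0

theorem IsResidues.sub {B C : Residues m N} (hB : D.IsResidues B) (hC : D.IsResidues C) :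
    D.IsResidues (B - C) :=
  ⟨(D.gradeSub 0).sub_mem hB.1 hC.1, (D.gradeSub (-1)).sub_mem hB.2.1 hC.2.1,
    fun s => D.𝔤.sub_mem (hB.2.2 s) (hC.2.2 s)⟩

/-- The pairing of residues with the truncated Lie algebra is nondegenerate. -/
theorem IsResidues.eq_zero {B : Residues m N} (hB : D.IsResidues B)
    (h : ∀ ξ, D.IsTruncated ξ → resPair B ξ = 0) : B = 0 := by
  have z0 := D.zero_mem_grade 0
  have z1 := D.zero_mem_grade 1
  have zs := D.𝔤.zero_mem
  have h0 : B.1 = 0 := by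
    refine D.grade_eq_zero hB.1 fun Y hY => ?_
    rw [neg_zero] at hY
    have := h (Y, 0, 0) ⟨hY, z1, fun _ => zs⟩
    simpa [resPair] using this
  have h1 : B.2.1 = 0 := by
    refine D.grade_eq_zero hB.2.1 fun Y hY => ?_
    rw [neg_neg] at hY
    have := h (0, Y, 0) ⟨z0, hY, fun _ => zs⟩
    simpa [resPair] using this
  have hs : ∀ s, B.2.2 s = 0 := by
    intro s
    refine D.trace_nondegenerate _ (hB.2.2 s) fun Y hY => ?_
    have := h (0, 0, Pi.single s Y) ⟨z0, z1, fun s' => ?_⟩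
    · simp only [resPair, mul_zero, Matrix.trace_zero, add_zero] at this
      rw [Finset.sum_eq_single s] at this
      · simpa using this
      · intro s' _ hs'
        rw [Pi.single_eq_of_ne hs', mul_zero, Matrix.trace_zero]
      · simp
    · by_cases hss : s' = s
      · subst hss
        simpa using hY
      · simp [Pi.single_eq_of_ne hss]
  exact Prod.ext h0 (Prod.ext h1 (funext hs))

/-- The truncation of a tuple of Taylor series. -/
def truncation (X : Tuple m N) : Truncated m N :=
  (lcoeff (X .zero) 0, lcoeff (X .zero) 1, fun s => lcoeff (X (.pt s)) 0)

theorem IsLoop.truncation_mem {X : Tuple m N} (hX : D.IsLoop 0 X) :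
    D.IsTruncated (truncation X) := by
  refine ⟨?_, ?_, fun s => hX.2.1 s 0⟩
  · simpa [GaudinData.truncation] using hX.1 0
  · simpa [GaudinData.truncation] using hX.1 1

/-- The truncated Lie algebra is what the polar part of the Lax matrix can see of a Taylor tuple.
The weight T in the pairing cancels the factor 1/T in the residues. -/
theorem pairing_poleMap {B : Residues m N} (hB : D.IsResidues B) {X : Tuple m N}
    (hX : D.IsLoopPlus 0 X) :
    pairing T (D.expand (D.poleMap B)) X = resPair B (truncation X) := by
  rw [D.isLoopPlus_iff] at hX
  have hXi : ∀ j < 1, lcoeff (X .infty) j = 0 := hX.2 .infty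
  rw [pairing_of_low (fun j hj => ?_) (fun s j hj => ?_) (fun j hj => ?_) (fun r j hj => ?_)]
  rotate_left
  · rw [D.lcoeff_poleMap_zero _ (by omega), if_neg (by omega), if_neg (by omega), add_zero]
  · rw [D.lcoeff_poleMap_pt hB.2.2 s (by omega), if_neg (by omega)]
  · rw [D.lcoeff_poleMap_infty _ (by omega)]
  · refine hX.2 r j ?_
    cases r
    exacts [hj, hj, lt_trans hj one_pos]
  have hpt : ∀ s, (T : ℂ) • lcoeff (D.expand (D.poleMap B) (.pt s)) (-1) = B.2.2 s := by
    intro s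
    rw [D.lcoeff_poleMap_pt hB.2.2 s (by norm_num), if_pos rfl, smul_smul,
      mul_inv_cancel₀ D.T_ne_zero, one_smul]
  rw [D.lcoeff_poleMap_infty _ (by norm_num), hXi 0 (by norm_num),
    D.lcoeff_poleMap_zero _ (by norm_num), D.lcoeff_poleMap_zero _ (by norm_num)]
  simp only [hpt]
  norm_num
  rfl

end GaudinData

/-! ### The Lax equation on residues -/

namespace GaudinData

variable {m N T : ℕ} {D : GaudinData m N T}

/-- The action of a tuple of Taylor series on the polar part of the Lax matrix. -/
theorem lcoeff_lie_lax {q : Config m N} (hq : D.IsResidues (D.residues q)) {X : Tuple m N}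
    (hX : ∀ r, ∀ j < lowIdx r, lcoeff (X r) j = 0) (hr : D.IsResidues (lieRes (truncation X) (D.residues q)))
    (r : Pt N) {j : ℤ} (hj : j < lowIdx r) :
    lcoeff (X r * D.expand (D.lax q) r - D.expand (D.lax q) r * X r) j =
      lcoeff (D.expand (D.poleMap (lieRes (truncation X) (D.residues q))) r) j := by
  cases r with
  | zero =>
    have hj : j < 0 := hj
    have hL : ∀ j < -2, lcoeff (D.expand (D.lax q) .zero) j = 0 := by
      intro j hj
      rw [lcoeff_lax_zero hq (by omega), if_neg (by omega), if_neg (by omega), add_zero]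
    rw [lcoeff_lie (hX .zero) hL, D.lcoeff_poleMap_zero _ hj]
    change ∑ i ∈ Finset.Icc (0 : ℤ) _, _ = _
    rcases lt_trichotomy j (-2) with h | h | h
    · rw [Finset.Icc_eq_empty (by omega), Finset.sum_empty, if_neg (by omega), if_neg (by omega),
        add_zero]
    · subst h
      rw [sub_self, Finset.Icc_self, Finset.sum_singleton, sub_zero, lcoeff_lax_zero hq hj]
      norm_num
      rfl
    · obtain rfl : j = -1 := by omega
      have e := Icc_add_one 0
      rw [zero_add] at e
      rw [show (-1 : ℤ) - -2 = 1 by norm_num, e, Finset.sum_pair (by norm_num), sub_zero,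
        lcoeff_lax_zero hq (by norm_num), lcoeff_lax_zero hq (by norm_num)]
      norm_num
      rfl
  | pt s =>
    have hj : j < 0 := hj
    have hL : ∀ j < -1, lcoeff (D.expand (D.lax q) (.pt s)) j = 0 := by
      intro j hj
      rw [lcoeff_lax_pt hq s (by omega), if_neg (by omega)]
    rw [lcoeff_lie (hX (.pt s)) hL, D.lcoeff_poleMap_pt hr.2.2 s hj]
    change ∑ i ∈ Finset.Icc (0 : ℤ) _, _ = _
    rcases lt_or_eq_of_le (show j ≤ -1 by omega) with h | h
    · rw [Finset.Icc_eq_empty (by omega), Finset.sum_empty, if_neg (by omega)]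
    · subst h
      rw [sub_self, Finset.Icc_self, Finset.sum_singleton, sub_zero, lcoeff_lax_pt hq s hj,
        if_pos rfl, if_pos rfl]
      exact lie_smul _ _ _
  | infty =>
    have hj : j < 1 := hj
    have hL : ∀ j < 0, lcoeff (D.expand (D.lax q) .infty) j = 0 := by
      intro j hj
      rw [lcoeff_lax_infty hq (by omega), if_neg (by omega)]
    rw [lcoeff_lie (hX .infty) hL, D.lcoeff_poleMap_infty _ hj]
    change ∑ i ∈ Finset.Icc (1 : ℤ) _, _ = _
    rw [Finset.Icc_eq_empty (by omega), Finset.sum_empty]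

/-- The Lax equation for residues: for the generator `h` in `∇H = X = (X - ι h) + ι h`, the
derivative of the Lax matrix is `-[h, L]` if and only if its residues move by the coadjoint action
of `X - ι h`. -/
theorem lax_iff_lieRes {p : ℕ} {r : Pt N} {q : Config m N} (hq : D.IsResidues (D.residues q))
    {h : RatMat m} {X : Tuple m N} (hh : D.IsEquivariant 0 h)
    (hX : D.IsGradient (D.hamiltonian p r) (D.expand (D.lax q)) X)
    (hN : D.IsLoopPlus 0 (X - D.expand h)) {B : Residues m N} (hB : D.IsResidues B) :
    ((∀ z ∉ D.finitePoles, evalAt z (D.poleMap B) = -⁅evalAt z h, evalAt z (D.lax q)⁆) ↔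
      B = lieRes (truncation (X - D.expand h)) (D.residues q)) ∧
    (B = lieRes (truncation (X - D.expand h)) (D.residues q) →
      D.expand (D.poleMap B) =
        (X - D.expand h) * D.expand (D.lax q) - D.expand (D.lax q) * (X - D.expand h)) := by
  have hL := lax_isEquivariant hq
  set Y := X - D.expand h with hY
  have hBL : D.IsResidues (lieRes (truncation Y) (D.residues q)) :=
    hq.lieRes_mem hN.1.truncation_mem
  have hlow := (D.isLoopPlus_iff.1 hN).2
  -- The defect of the Lax equation. It is equivariant, hence zero as soon as its polar parts
  -- vanish.
  set f := D.poleMap B + (h * D.lax q - D.lax q * h) with hf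
  have hfe : D.IsEquivariant 1 f := by
    have := hh.lie hL
    rw [zero_add] at this
    exact (hB.poleMap_isEquivariant).add this
  have hexp : ∀ s, D.expand f s = D.expand (D.poleMap B) s -
      (Y s * D.expand (D.lax q) s - D.expand (D.lax q) s * Y s) := by
    intro s
    -- The gradient X commutes with L, so [h, L] expands to -[Y, L] with Y = X - ι h, a Taylor
    -- tuple.
    have hc : D.expand (D.lax q) s * X s = X s * D.expand (D.lax q) s :=
      congrFun (hX.commute hL.isLoop) s
    rw [hf, expand_add, expand_sub, expand_mul, expand_mul,
      show Y s = X s - D.expand h s from rfl, sub_mul, mul_sub, hc]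
    abel
  have hf0 : f = 0 ↔ B = lieRes (truncation Y) (D.residues q) := by
    constructor
    · intro h0
      have hl : ∀ s, ∀ j < lowIdx s, lcoeff (D.expand (D.poleMap B) s) j =
          lcoeff (D.expand (D.poleMap (lieRes (truncation Y) (D.residues q))) s) j := by
        intro s j hj
        have := congrArg (fun Z => lcoeff Z j) (hexp s)
        simp only [h0, expand_zero, lcoeff_zero, lcoeff_sub] at this
        rw [← lcoeff_lie_lax hq hlow hBL s hj, lcoeff_sub]
        exact (sub_eq_zero.1 this.symm)
      have e1 := hl .zero (-1) (by norm_num [lowIdx])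
      have e2 := hl .zero (-2) (by norm_num [lowIdx])
      rw [D.lcoeff_poleMap_zero _ (by norm_num), D.lcoeff_poleMap_zero _ (by norm_num)] at e1 e2
      norm_num at e1 e2
      refine Prod.ext e1 (Prod.ext e2 (funext fun s => ?_))
      have e3 := hl (.pt s) (-1) (by norm_num [lowIdx])
      rw [D.lcoeff_poleMap_pt hB.2.2 s (by norm_num), D.lcoeff_poleMap_pt hBL.2.2 s (by norm_num),
        if_pos rfl, if_pos rfl] at e3
      exact smul_right_injective _ (inv_ne_zero D.T_ne_zero) e3
    · intro hBe
      have hl : ∀ s, ∀ j < lowIdx s, lcoeff (D.expand f s) j = 0 := by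
        intro s j hj
        rw [hexp, lcoeff_sub, lcoeff_lie_lax hq hlow hBL s hj, ← hBe, sub_self]
      refine hfe.eq_zero (fun s hs j hj => hl s j ?_) (hl .infty)
      cases s
      exacts [hj, hj, absurd rfl hs]
  refine ⟨?_, fun hBe => ?_⟩
  · rw [← hf0]
    have hev : ∀ z ∉ D.finitePoles, evalAt z f =
        evalAt z (D.poleMap B) + ⁅evalAt z h, evalAt z (D.lax q)⁆ := by
      intro z hz
      have r1 := hh.regM hz
      have r2 := hL.regM hz
      rw [hf, evalAt_add (D.poleMap_regM hz B) ((r1.mul r2).sub (r2.mul r1)),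
        evalAt_sub (r1.mul r2) (r2.mul r1), evalAt_mul r1 r2, evalAt_mul r2 r1, Ring.lie_def]
    constructor
    · intro hz
      refine ratMat_ext D.finitePoles_finite (fun z hz => hfe.regM hz) (fun z _ => regM_zero)
        fun z hz' => ?_
      rw [hev z hz', hz z hz', neg_add_cancel, evalAt_zero]
    · intro h0 z hz
      have := hev z hz
      rw [h0, evalAt_zero] at this
      exact eq_neg_of_add_eq_zero_left this.symm
  · funext s
    have := hexp s
    rw [hf0.2 hBe, expand_zero] at this
    exact (sub_eq_zero.1 this.symm)

end GaudinData

/-! ### Residues and momenta along a field -/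

section triple

variable {V E : Type} [NormedAddCommGroup V] [NormedSpace ℝ V] [NormedAddCommGroup E]
  [NormedSpace ℝ E] {ι : Type} [Fintype ι] {f g : E → V} {h : ι → E → V} {x : E}

theorem fderiv_prod_pi (hf : DifferentiableAt ℝ f x) (hg : DifferentiableAt ℝ g x)
    (hh : ∀ s, DifferentiableAt ℝ (h s) x) (w : E) :
    DifferentiableAt ℝ (fun y => (f y, g y, fun s => h s y)) x ∧
    fderiv ℝ (fun y => (f y, g y, fun s => h s y)) x w =
      (fderiv ℝ f x w, fderiv ℝ g x w, fun s => fderiv ℝ (h s) x w) := by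
  have h3 : HasFDerivAt (fun y => fun s => h s y)
      (ContinuousLinearMap.pi fun s => fderiv ℝ (h s) x) x :=
    hasFDerivAt_pi.2 fun s => (hh s).hasFDerivAt
  have h4 := hf.hasFDerivAt.prodMk (hg.hasFDerivAt.prodMk h3)
  exact ⟨h4.differentiableAt, by rw [h4.fderiv]; rfl⟩

end triple

namespace GaudinData

variable {m N T : ℕ} (D : GaudinData m N T)

/-- The nilpotent part `φ₀^{(1)} (φ₀^{(0)})⁻¹` of a field. -/
noncomputable def unipotent (q : Config m N) : Mat m := q.2.2 * Ring.inverse q.2.1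

theorem A_eq {F : Type} (s : Fin N) (Φ : F → Config m N) : (fun y => D.A (Φ y) s) =
    fun y => (Φ y).1 s * D.Λ s * Ring.inverse ((Φ y).1 s) := by
  funext y
  rw [A, Matrix.nonsing_inv_eq_ringInverse]

theorem A₀₁_eq {F : Type} (Φ : F → Config m N) : (fun y => D.A₀₁ (Φ y)) =
    fun y => (Φ y).2.1 * D.Λ₀₁ * Ring.inverse (Φ y).2.1 := by
  funext y
  rw [A₀₁, Matrix.nonsing_inv_eq_ringInverse]

theorem A₀₀_eq {F : Type} (Φ : F → Config m N) : (fun y => D.A₀₀ (Φ y)) =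
    fun y => (Φ y).2.1 * D.Λ₀₀ * Ring.inverse (Φ y).2.1 +
      ⁅unipotent (Φ y), (Φ y).2.1 * D.Λ₀₁ * Ring.inverse (Φ y).2.1⁆ := by
  funext y
  rw [A₀₀, Matrix.nonsing_inv_eq_ringInverse, unipotent]

variable {E : Type} [NormedAddCommGroup E] [NormedSpace ℝ E]

/-- The velocity of a field, transported to the truncated Lie algebra. -/
noncomputable def angular (Φ : E → Config m N) (u x : E) : Truncated m N :=
  (logDer (fun y => (Φ y).2.1) u x,
    fderiv ℝ (fun y => unipotent (Φ y)) x u -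
      ⁅logDer (fun y => (Φ y).2.1) u x, unipotent (Φ x)⁆,
    fun s => logDer (fun y => (Φ y).1 s) u x)

/-- The momentum one-form: the part of the Lagrangian that is linear in the velocities. -/
noncomputable def momentum (q w : Config m N) : ℂ :=
  ∑ s : Fin N, Matrix.trace (D.A q s * (w.1 s * (q.1 s)⁻¹))
    + Matrix.trace (D.A₀₀ q * (w.2.1 * q.2.1⁻¹))

theorem IsConfig.isUnit {q : Config m N} (hq : D.IsConfig q) :
    (∀ s, IsUnit (q.1 s)) ∧ IsUnit q.2.1 := by
  obtain ⟨h1, ⟨g, -, hg⟩, -⟩ := hq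
  refine ⟨fun s => ?_, hg ▸ gmat_isUnit g⟩
  obtain ⟨g, hg⟩ := h1 s
  exact hg ▸ gmat_isUnit g

theorem fderiv_config {Φ : E → Config m N} {x : E} (h : DifferentiableAt ℝ Φ x) (w : E) :
    (∀ s, (fderiv ℝ Φ x w).1 s = fderiv ℝ (fun y => (Φ y).1 s) x w) ∧
      (fderiv ℝ Φ x w).2.1 = fderiv ℝ (fun y => (Φ y).2.1) x w ∧
      (fderiv ℝ Φ x w).2.2 = fderiv ℝ (fun y => (Φ y).2.2) x w :=
  fderiv_triple h w

variable {D} {U : Set E} {Φ : E → Config m N} {x : E}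

theorem IsSmoothField.contDiffAt (hΦ : D.IsSmoothField U Φ) (hU : IsOpen U) (hx : x ∈ U) :
    ContDiffAt ℝ 2 Φ x :=
  (hΦ.1.contDiffAt (hU.mem_nhds hx)).of_le (WithTop.coe_le_coe.2 (le_top : (2 : ℕ∞) ≤ ⊤))

theorem IsSmoothField.components (hΦ : D.IsSmoothField U Φ) (hU : IsOpen U) (hx : x ∈ U) :
    (∀ s, ContDiffAt ℝ 2 (fun y => (Φ y).1 s) x) ∧ ContDiffAt ℝ 2 (fun y => (Φ y).2.1) x ∧
      ContDiffAt ℝ 2 (fun y => (Φ y).2.2) x :=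
  contDiffAt_triple_iff.1 (hΦ.contDiffAt hU hx)

theorem fderiv_unipotent (h0 : DifferentiableAt ℝ (fun y => (Φ y).2.1) x)
    (h1 : DifferentiableAt ℝ (fun y => (Φ y).2.2) x) (hu : IsUnit (Φ x).2.1) (w : E) :
    DifferentiableAt ℝ (fun y => unipotent (Φ y)) x ∧
    fderiv ℝ (fun y => unipotent (Φ y)) x w =
      fderiv ℝ (fun y => (Φ y).2.2) x w * (Φ x).2.1⁻¹ -
        (Φ x).2.2 * (Φ x).2.1⁻¹ * fderiv ℝ (fun y => (Φ y).2.1) x w * (Φ x).2.1⁻¹ := by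
  have hi := differentiableAt_inverse' h0 hu
  refine ⟨h1.mul hi, ?_⟩
  have := fderiv_mul_apply' h1 hi w
  rw [fderiv_inverse_apply' h0 hu] at this
  refine this.trans ?_
  rw [Matrix.nonsing_inv_eq_ringInverse, mul_neg, sub_eq_add_neg]
  simp only [mul_assoc]
  rfl

/-- Velocities of fields belong to the truncated Lie algebra. -/
theorem IsSmoothField.angular_mem (hΦ : D.IsSmoothField U Φ) (hU : IsOpen U) (hx : x ∈ U) (u : E) :
    D.IsTruncated (angular Φ u x) := by
  obtain ⟨hc, ht⟩ := hΦ.2 x hx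
  obtain ⟨h1, h2, h3⟩ := hΦ.components hU hx
  obtain ⟨t1, t2, t3⟩ := ht u
  have two : (2 : WithTop ℕ∞) ≠ 0 := by norm_num
  obtain ⟨e1, e2, e3⟩ := fderiv_config ((hΦ.contDiffAt hU hx).differentiableAt two) u
  have hu := fderiv_unipotent (h2.differentiableAt two) (h3.differentiableAt two) hc.isUnit.2 u
  have b0 : logDer (fun y => (Φ y).2.1) u x ∈ D.grade 0 := by
    rw [e2, Matrix.nonsing_inv_eq_ringInverse] at t2
    exact t2
  refine ⟨b0, ?_, fun s => ?_⟩
  · refine (D.gradeSub 1).sub_mem ?_ ?_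
    · rw [hu.2, ← e2, ← e3]
      exact t3
    · have hc1 := hc.2.2
      rw [Matrix.nonsing_inv_eq_ringInverse] at hc1
      have := D.lie_mem_grade b0 hc1
      rw [zero_add] at this
      exact this
  · have := t1 s
    rw [e1, Matrix.nonsing_inv_eq_ringInverse] at this
    exact this

/-- Residues move by the coadjoint action of the velocity. -/
theorem IsSmoothField.fderiv_residues (hΦ : D.IsSmoothField U Φ) (hU : IsOpen U) (hx : x ∈ U)
    (u : E) : DifferentiableAt ℝ (fun y => D.residues (Φ y)) x ∧
    fderiv ℝ (fun y => D.residues (Φ y)) x u = lieRes (angular Φ u x) (D.residues (Φ x)) ∧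
    fderiv ℝ (fun y => D.residues (Φ y)) x u = (fderiv ℝ (fun y => D.A₀₀ (Φ y)) x u,
      fderiv ℝ (fun y => D.A₀₁ (Φ y)) x u, fun s => fderiv ℝ (fun y => D.A (Φ y) s) x u) := by
  obtain ⟨hc, -⟩ := hΦ.2 x hx
  obtain ⟨h1, h2, h3⟩ := hΦ.components hU hx
  have two : (2 : WithTop ℕ∞) ≠ 0 := by norm_num
  have hu := fderiv_unipotent (h2.differentiableAt two) (h3.differentiableAt two) hc.isUnit.2 u
  have t0 := fderiv_twisted_orbit (h2.differentiableAt two) hc.isUnit.2 hu.1 D.Λ₀₀ D.Λ₀₁ u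
  have t1 := fderiv_conj_apply (h2.differentiableAt two) hc.isUnit.2 D.Λ₀₁ u
  have d1 := differentiableAt_conj (h2.differentiableAt two) hc.isUnit.2 D.Λ₀₁
  have ts := fun s => fderiv_conj_apply ((h1 s).differentiableAt two) (hc.isUnit.1 s) (D.Λ s) u
  have ds := fun s => differentiableAt_conj ((h1 s).differentiableAt two) (hc.isUnit.1 s) (D.Λ s)
  rw [← A₀₀_eq] at t0
  rw [← A₀₁_eq] at t1 d1
  have hA : ∀ s, (Φ x).1 s * D.Λ s * Ring.inverse ((Φ x).1 s) = D.A (Φ x) s := fun s =>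
    (congrFun (D.A_eq s Φ) x).symm
  have hA1 : (Φ x).2.1 * D.Λ₀₁ * Ring.inverse (Φ x).2.1 = D.A₀₁ (Φ x) :=
    (congrFun (D.A₀₁_eq Φ) x).symm
  have hA0 : (Φ x).2.1 * D.Λ₀₀ * Ring.inverse (Φ x).2.1 +
      ⁅unipotent (Φ x), (Φ x).2.1 * D.Λ₀₁ * Ring.inverse (Φ x).2.1⁆ = D.A₀₀ (Φ x) :=
    (congrFun (D.A₀₀_eq Φ) x).symm
  rw [hA0, hA1] at t0
  rw [hA1] at t1
  simp only [hA, ← A_eq] at ts ds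
  have h := fderiv_prod_pi t0.1 d1 ds u
  refine ⟨h.1, ?_, h.2⟩
  refine h.2.trans ?_
  rw [t0.2, t1]
  simp only [ts]
  rfl

/-- The momentum one-form along a field. -/
theorem IsSmoothField.momentum_eq (hΦ : D.IsSmoothField U Φ) (hU : IsOpen U) (hx : x ∈ U) (u : E) :
    D.momentum (Φ x) (fderiv ℝ Φ x u) =
      ∑ s, toCLM (realTrace m) (D.A (Φ x) s * logDer (fun y => (Φ y).1 s) u x) +
        toCLM (realTrace m) (D.A₀₀ (Φ x) * logDer (fun y => (Φ y).2.1) u x) := by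
  have two : (2 : WithTop ℕ∞) ≠ 0 := by norm_num
  obtain ⟨e1, e2, -⟩ := fderiv_config ((hΦ.contDiffAt hU hx).differentiableAt two) u
  simp only [momentum, e1, e2, Matrix.nonsing_inv_eq_ringInverse]
  rfl

theorem IsSmoothField.momentum_eventuallyEq (hΦ : D.IsSmoothField U Φ) (hU : IsOpen U) (hx : x ∈ U)
    (u : E) : (fun x => D.momentum (Φ x) (fderiv ℝ Φ x u)) =ᶠ[nhds x] fun x =>
      ∑ s, toCLM (realTrace m) (D.A (Φ x) s * logDer (fun y => (Φ y).1 s) u x) +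
        toCLM (realTrace m) (D.A₀₀ (Φ x) * logDer (fun y => (Φ y).2.1) u x) := by
  filter_upwards [hU.mem_nhds hx] with y hy
  exact hΦ.momentum_eq hU hy u

end GaudinData

/-! ### The exterior derivative of the momentum one-form and the derivative of the Hamiltonians -/

section abstract_calculus

variable {E V : Type} [NormedAddCommGroup E] [NormedSpace ℝ E]

theorem fderiv_sum_add {ι : Type} [Fintype ι] {f : ι → E → ℂ} {g : E → ℂ} {x : E}
    (hf : ∀ s, DifferentiableAt ℝ (f s) x) (hg : DifferentiableAt ℝ g x) (u : E) :
    DifferentiableAt ℝ (fun y => ∑ s, f s y + g y) x ∧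
    fderiv ℝ (fun y => ∑ s, f s y + g y) x u = ∑ s, fderiv ℝ (f s) x u + fderiv ℝ g x u := by
  have h1 : HasFDerivAt (fun y => ∑ s, f s y) (∑ s, fderiv ℝ (f s) x) x :=
    HasFDerivAt.fun_sum fun s _ => (hf s).hasFDerivAt
  have h2 := h1.add hg.hasFDerivAt
  have h3 : HasFDerivAt (fun y => ∑ s, f s y + g y) (∑ s, fderiv ℝ (f s) x + fderiv ℝ g x) x := h2
  refine ⟨h3.differentiableAt, ?_⟩
  rw [h3.fderiv]
  simp

theorem fderiv_congr_add_const [NormedAddCommGroup V] [NormedSpace ℝ V] {f g : E → V} {x : E} {c : V}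
    (h : f =ᶠ[nhds x] fun y => g y + c) (u : E) : fderiv ℝ f x u = fderiv ℝ g x u := by
  rw [h.fderiv_eq, fderiv_add_const]

/-- The derivative along a real curve of a complex differentiable function. -/
theorem fderiv_comp_of_hasDerivAt [NormedAddCommGroup V] [NormedSpace ℂ V] [NormedSpace ℝ V]
    [IsScalarTower ℝ ℂ V] {g : V → ℂ} {B : E → V} {x u : E} {c : ℂ}
    (hg : DifferentiableAt ℂ g (B x)) (hB : DifferentiableAt ℝ B x)
    (hc : HasDerivAt (fun ε : ℂ => g (B x + ε • fderiv ℝ B x u)) c 0) :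
    DifferentiableAt ℝ (fun y => g (B y)) x ∧ fderiv ℝ (fun y => g (B y)) x u = c := by
  have h1 : HasFDerivAt g ((fderiv ℂ g (B x)).restrictScalars ℝ) (B x) :=
    hg.hasFDerivAt.restrictScalars ℝ
  have h2 : HasFDerivAt (fun y => g (B y)) (((fderiv ℂ g (B x)).restrictScalars ℝ).comp
    (fderiv ℝ B x)) x := h1.comp x hB.hasFDerivAt
  refine ⟨h2.differentiableAt, ?_⟩
  rw [h2.fderiv]
  set η := fderiv ℝ B x u with hη
  have h3 : HasDerivAt (fun ε : ℂ => B x + ε • η) η 0 := by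
    simpa using ((hasDerivAt_id (0 : ℂ)).smul_const η).const_add (B x)
  have h4 : HasFDerivAt g (fderiv ℂ g (B x)) (B x + (0 : ℂ) • η) := by
    rw [zero_smul, add_zero]
    exact hg.hasFDerivAt
  -- The gradient only prescribes derivatives along complex lines; together with differentiability
  -- of g this determines the derivative along the curve.
  have h5 := h4.comp_hasDerivAt (0 : ℂ) h3
  exact h5.unique hc

end abstract_calculus

namespace GaudinData

variable {m N T : ℕ} {D : GaudinData m N T} {E : Type} [NormedAddCommGroup E] [NormedSpace ℝ E]
  {U : Set E} {Φ : E → Config m N} {x : E}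

theorem IsSmoothField.differentiableAt_momentum (hΦ : D.IsSmoothField U Φ) (hU : IsOpen U)
    (hx : x ∈ U) (v : E) :
    DifferentiableAt ℝ (fun y => D.momentum (Φ y) (fderiv ℝ Φ y v)) x ∧
    ∀ u, fderiv ℝ (fun y => D.momentum (Φ y) (fderiv ℝ Φ y v)) x u =
      ∑ s, fderiv ℝ (fun y => toCLM (realTrace m)
          (D.A (Φ y) s * logDer (fun y => (Φ y).1 s) v y)) x u +
        fderiv ℝ (fun y => toCLM (realTrace m)
          (D.A₀₀ (Φ y) * logDer (fun y => (Φ y).2.1) v y)) x u := by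
  obtain ⟨hc, -⟩ := hΦ.2 x hx
  obtain ⟨h1, h2, h3⟩ := hΦ.components hU hx
  have two : (2 : WithTop ℕ∞) ≠ 0 := by norm_num
  have hu := (fderiv_unipotent (h2.differentiableAt two) (h3.differentiableAt two)
    hc.isUnit.2 v).1
  have d0 := (fderiv_twisted_orbit (h2.differentiableAt two) hc.isUnit.2 hu D.Λ₀₀ D.Λ₀₁ v).1
  rw [← A₀₀_eq] at d0
  have ds := fun s => differentiableAt_conj ((h1 s).differentiableAt two) (hc.isUnit.1 s) (D.Λ s)
  simp only [← A_eq] at ds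
  have e := hΦ.momentum_eventuallyEq hU hx v
  have hs := fun s => differentiableAt_trace_mul (toCLM (realTrace m)) (ds s) (h1 s)
    (hc.isUnit.1 s) v
  have h0 := differentiableAt_trace_mul (toCLM (realTrace m)) d0 h2 hc.isUnit.2 v
  refine ⟨e.differentiableAt_iff.2 (fderiv_sum_add hs h0 0).1, fun u => ?_⟩
  rw [e.fderiv_eq]
  exact (fderiv_sum_add hs h0 u).2

/-- The exterior derivative of the momentum one-form is the Kirillov–Kostant form. -/
theorem IsSmoothField.exterior_momentum (hΦ : D.IsSmoothField U Φ) (hU : IsOpen U)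
    (hx : x ∈ U) (u v : E) :
    fderiv ℝ (fun y => D.momentum (Φ y) (fderiv ℝ Φ y v)) x u -
      fderiv ℝ (fun y => D.momentum (Φ y) (fderiv ℝ Φ y u)) x v =
      -resPair (fderiv ℝ (fun y => D.residues (Φ y)) x v) (angular Φ u x) := by
  obtain ⟨hc, -⟩ := hΦ.2 x hx
  obtain ⟨h1, h2, h3⟩ := hΦ.components hU hx
  have two : (2 : WithTop ℕ∞) ≠ 0 := by norm_num
  have hu := (fderiv_unipotent (h2.differentiableAt two) (h3.differentiableAt two)
    hc.isUnit.2 u).1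
  rw [(hΦ.differentiableAt_momentum hU hx v).2, (hΦ.differentiableAt_momentum hU hx u).2,
    (hΦ.fderiv_residues hU hx v).2.2]
  have h0 := exterior_trace_twisted (toCLM (realTrace m)) realTrace_mul_comm h2 hc.isUnit.2 hu
    D.Λ₀₀ D.Λ₀₁ (D.A₀₁_eq Φ) (A₀ := fun y => D.A₀₀ (Φ y)) ((D.A₀₀_eq Φ).trans (by
      funext y
      rw [← congrFun (D.A₀₁_eq Φ) y])) u v
  have hs : ∀ s, fderiv ℝ (fun y => toCLM (realTrace m)
        (D.A (Φ y) s * logDer (fun y => (Φ y).1 s) v y)) x u -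
      fderiv ℝ (fun y => toCLM (realTrace m)
        (D.A (Φ y) s * logDer (fun y => (Φ y).1 s) u y)) x v =
      -Matrix.trace (fderiv ℝ (fun y => D.A (Φ y) s) x v * logDer (fun y => (Φ y).1 s) u x) := by
    intro s
    have d := differentiableAt_conj ((h1 s).differentiableAt two) (hc.isUnit.1 s) (D.Λ s)
    have f := fderiv_conj_apply ((h1 s).differentiableAt two) (hc.isUnit.1 s) (D.Λ s) u
    rw [show (Φ x).1 s * D.Λ s * Ring.inverse ((Φ x).1 s) = D.A (Φ x) s from
      (congrFun (D.A_eq s Φ) x).symm] at f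
    rw [← A_eq] at d f
    -- At the points ζ_s there is no double pole, so the orbit is untwisted and the remainder R is
    -- zero.
    have := exterior_trace_mul (toCLM (realTrace m)) realTrace_mul_comm d (h1 s) (hc.isUnit.1 s) u v
      (R := 0) (f.trans (add_zero _).symm)
    refine this.trans ?_
    rw [zero_mul, map_zero, zero_sub, realTrace_apply, Matrix.trace_mul_comm]
    rfl
  rw [add_sub_add_comm, ← Finset.sum_sub_distrib, Finset.sum_congr rfl fun s _ => hs s,
    Finset.sum_neg_distrib]
  have h0' : fderiv ℝ (fun y => toCLM (realTrace m)
        (D.A₀₀ (Φ y) * logDer (fun y => (Φ y).2.1) v y)) x u -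
      fderiv ℝ (fun y => toCLM (realTrace m)
        (D.A₀₀ (Φ y) * logDer (fun y => (Φ y).2.1) u y)) x v =
      -(Matrix.trace (fderiv ℝ (fun y => D.A₀₀ (Φ y)) x v * (angular Φ u x).1) +
        Matrix.trace (fderiv ℝ (fun y => D.A₀₁ (Φ y)) x v * (angular Φ u x).2.1)) := by
    refine h0.trans ?_
    exact congrArg Neg.neg (congrArg₂ (· + ·) (realTrace_mul_comm _ _)
      (realTrace_mul_comm _ _))
  rw [h0', ← neg_add]
  rfl

/-- The Hamiltonian as a function of the residues. -/
theorem hamiltonian_lax {q : Config m N} (hq : D.IsResidues (D.residues q)) (p : ℕ) (r : Pt N) :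
    D.hamiltonian p r (D.expand (D.lax q)) = D.hamLin p r
      ((D.expand (monoBlock 0 D.Λinf) r + D.poleExpand r (D.residues q)) ^ (p + 1)) := by
  rw [hamiltonian_eq, lax_eq hq, expand_add, add_comm]
  rfl

/-- The Lax matrix is affine in its residues, so moving the residues in the direction η moves L in
the direction `poleMap η`, along which the defining property of the gradient applies. -/
theorem hasDerivAt_hamLin {q : Config m N} (hq : D.IsResidues (D.residues q)) {p : ℕ} {r : Pt N}
    {X : Tuple m N} (hX : D.IsGradient (D.hamiltonian p r) (D.expand (D.lax q)) X)
    {η : Residues m N} (hη : D.IsResidues η) :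
    HasDerivAt (fun ε : ℂ => D.hamLin p r ((D.expand (monoBlock 0 D.Λinf) r +
      D.poleExpand r (D.residues q + ε • η)) ^ (p + 1)))
      (pairing T (D.expand (D.poleMap η)) X) 0 := by
  have h := hX.2 _ hη.poleMap_isEquivariant.isLoop
  refine h.congr_of_eventuallyEq (Filter.Eventually.of_forall fun ε => ?_)
  have e : D.expand (monoBlock 0 D.Λinf) r + D.poleExpand r (D.residues q + ε • η) =
      D.expand (D.lax q) r + ε • D.expand (D.poleMap η) r := by
    rw [LinearMap.map_add, LinearMap.map_smul, lax_eq hq, expand_add, ← add_assoc]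
    exact congrArg (· + _) (add_comm _ _)
  exact congrArg (fun Z => D.hamLin p r (Z ^ (p + 1))) e

theorem differentiable_hamLin (p : ℕ) (r : Pt N) : Differentiable ℂ fun B => D.hamLin p r
    ((D.expand (monoBlock 0 D.Λinf) r + D.poleExpand r B) ^ (p + 1)) :=
  (contDiff_pow (D.hamLin p r) (D.poleExpand r) (D.expand (monoBlock 0 D.Λinf) r) (p + 1)
    (k := 1)).differentiable (by norm_num)

/-- The derivative of the Hamiltonians along a field. -/
theorem IsSmoothField.fderiv_hamiltonian (hΦ : D.IsSmoothField U Φ) (hU : IsOpen U) (hx : x ∈ U)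
    {p : ℕ} {r : Pt N} {X : Tuple m N}
    (hX : D.IsGradient (D.hamiltonian p r) (D.expand (D.lax (Φ x))) X) (u : E) :
    DifferentiableAt ℝ (fun y => D.hamiltonian p r (D.expand (D.lax (Φ y)))) x ∧
    fderiv ℝ (fun y => D.hamiltonian p r (D.expand (D.lax (Φ y)))) x u =
      pairing T (D.expand (D.poleMap (fderiv ℝ (fun y => D.residues (Φ y)) x u))) X := by
  have hq := (hΦ.2 x hx).1.residues
  have he : (fun y => D.hamiltonian p r (D.expand (D.lax (Φ y)))) =ᶠ[nhds x] fun y =>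
      D.hamLin p r
        ((D.expand (monoBlock 0 D.Λinf) r + D.poleExpand r (D.residues (Φ y))) ^ (p + 1)) := by
    filter_upwards [hU.mem_nhds hx] with y hy
    exact hamiltonian_lax (hΦ.2 y hy).1.residues p r
  obtain ⟨dB, eB, -⟩ := hΦ.fderiv_residues hU hx u
  have hηR : D.IsResidues (fderiv ℝ (fun y => D.residues (Φ y)) x u) := by
    rw [eB]
    exact hq.lieRes_mem (hΦ.angular_mem hU hx u)
  have h := fderiv_comp_of_hasDerivAt (B := fun y => D.residues (Φ y))
    (differentiable_hamLin p r _) dB (hasDerivAt_hamLin hq hX hηR)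
  exact ⟨he.differentiableAt_iff.2 h.1, by rw [he.fderiv_eq]; exact h.2⟩

/-- The derivative of the Lax matrix at a regular point. -/
theorem IsSmoothField.fderiv_lax (hΦ : D.IsSmoothField U Φ) (hU : IsOpen U) (hx : x ∈ U) {z : ℂ}
    (hz : z ∉ D.finitePoles) (u : E) :
    fderiv ℝ (fun y => evalAt z (D.lax (Φ y))) x u =
      evalAt z (D.poleMap (fderiv ℝ (fun y => D.residues (Φ y)) x u)) := by
  have he : (fun y => evalAt z (D.lax (Φ y))) =ᶠ[nhds x] fun y =>
      D.poleEval hz (D.residues (Φ y)) + evalAt z (monoBlock 0 D.Λinf) := by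
    filter_upwards [hU.mem_nhds hx] with y hy
    rw [lax_eq (hΦ.2 y hy).1.residues, evalAt_add (D.poleMap_regM hz _)
      (monoBlock_regM (D.ne_zero_of_not_mem hz) _ _)]
    rfl
  have h := fderiv_comp_linear ((D.poleEval hz).restrictScalars ℝ)
    (hΦ.fderiv_residues hU hx u).1 u
  exact (fderiv_congr_add_const he u).trans h.2

end GaudinData

/-! ### Corner equations, Euler–Lagrange equations and the closure relation -/

section slices

variable {W V : Type} [NormedAddCommGroup W] [NormedSpace ℝ W] [NormedAddCommGroup V]
  [NormedSpace ℝ V] {F : ℝ × W → V} {a : ℝ} {t : W}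

theorem deriv_slice (h : DifferentiableAt ℝ F (a, t)) :
    deriv (fun ε => F (ε, t)) a = fderiv ℝ F (a, t) (1, 0) := by
  have h1 : HasDerivAt (fun ε : ℝ => (ε, t)) (1, 0) a :=
    (hasDerivAt_id a).prodMk (hasDerivAt_const a t)
  exact (h.hasFDerivAt.comp_hasDerivAt a h1).deriv

theorem fderiv_slice (h : DifferentiableAt ℝ F (a, t)) (w : W) :
    fderiv ℝ (fun t' => F (a, t')) t w = fderiv ℝ F (a, t) (0, w) := by
  have h1 : HasFDerivAt (fun t' : W => (a, t')) (ContinuousLinearMap.inr ℝ ℝ W) t :=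
    (hasFDerivAt_const a t).prodMk (hasFDerivAt_id t)
  have h2 : HasFDerivAt (fun t' => F (a, t')) _ t := h.hasFDerivAt.comp t h1
  rw [h2.fderiv]
  rfl

theorem fderiv_apply_sub_const {ι : Type} [Fintype ι] [FiniteDimensional ℝ V]
    (ℓ : V →ₗ[ℝ] ℂ) (c : ℂ) (i : ι) (v w : ι → V) :
    DifferentiableAt ℝ (fun v' : ι → V => ℓ (v' i) - c) v ∧
      fderiv ℝ (fun v' : ι → V => ℓ (v' i) - c) v w = ℓ (w i) := by
  have h1 : HasFDerivAt (fun v' : ι → V => v' i) (ContinuousLinearMap.proj i) v :=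
    (ContinuousLinearMap.proj (R := ℝ) (φ := fun _ : ι => V) i).hasFDerivAt
  obtain ⟨d, e⟩ := fderiv_comp_linear ℓ h1.differentiableAt w
  refine ⟨d.sub_const c, ?_⟩
  rw [fderiv_sub_const, e, h1.fderiv]
  rfl

end slices

namespace GaudinData

variable {m N T : ℕ} (D : GaudinData m N T)

/-- The momentum one-form as a linear map. -/
noncomputable def momentumLin (q : Config m N) : Config m N →ₗ[ℝ] ℂ where
  toFun := D.momentum q
  map_add' v w := by
    simp only [momentum, Prod.fst_add, Prod.snd_add, Pi.add_apply, add_mul, mul_add,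
      Matrix.trace_add, Finset.sum_add_distrib]
    ring
  map_smul' c v := by
    simp only [momentum, Prod.smul_fst, Prod.smul_snd, Pi.smul_apply, Matrix.smul_mul,
      Matrix.mul_smul, Matrix.trace_smul, RingHom.id_apply, smul_add, Finset.smul_sum]

variable {I : Finset (ℕ × Pt N)}

theorem velocityDeriv_eq (i j : I) (q : Config m N) (v : I → Config m N) (w : Config m N) :
    DifferentiableAt ℝ (fun v' => D.lagrangian i q v') v ∧
    D.velocityDeriv i j q v w =
      D.momentum q ((Pi.single j w : I → Config m N) i) :=
  fderiv_apply_sub_const (D.momentumLin q) _ i v _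

/-- ℒ_i is affine in the i-th velocity alone, and its linear part is the momentum form, which does
not depend on i. -/
theorem cornerEquations : D.CornerEquations I := by
  refine fun q _ v _ => ⟨fun i => (D.velocityDeriv_eq i i q v 0).1, fun i j hij w _ => ?_,
    fun i j w _ => ?_⟩
  · rw [(D.velocityDeriv_eq i j q v w).2, Pi.single_eq_of_ne hij]
    exact (D.momentumLin q).map_zero
  · rw [(D.velocityDeriv_eq i i q v w).2, (D.velocityDeriv_eq j j q v w).2, Pi.single_eq_same,
      Pi.single_eq_same]

variable {D} {E : Type} [NormedAddCommGroup E] [NormedSpace ℝ E] {U : Set E} {Φ : E → Config m N}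
  {x : E}

/-- The Lax equation in terms of residues. -/
theorem IsSmoothField.lax_iff (hΦ : D.IsSmoothField U Φ) (hU : IsOpen U) (hx : x ∈ U) {p : ℕ}
    {r : Pt N} {h : RatMat m} {X : Tuple m N} (hh : D.IsEquivariant 0 h)
    (hX : D.IsGradient (D.hamiltonian p r) (D.expand (D.lax (Φ x))) X)
    (hN : D.IsLoopPlus 0 (X - D.expand h)) (u : E) :
    ((∀ z ∉ D.finitePoles, fderiv ℝ (fun y => evalAt z (D.lax (Φ y))) x u =
        -⁅evalAt z h, evalAt z (D.lax (Φ x))⁆) ↔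
      fderiv ℝ (fun y => D.residues (Φ y)) x u =
        lieRes (truncation (X - D.expand h)) (D.residues (Φ x))) ∧
    (fderiv ℝ (fun y => D.residues (Φ y)) x u =
        lieRes (truncation (X - D.expand h)) (D.residues (Φ x)) →
      D.expand (D.poleMap (fderiv ℝ (fun y => D.residues (Φ y)) x u)) =
        (X - D.expand h) * D.expand (D.lax (Φ x)) -
          D.expand (D.lax (Φ x)) * (X - D.expand h)) := by
  have hq := (hΦ.2 x hx).1.residues
  have hB : D.IsResidues (fderiv ℝ (fun y => D.residues (Φ y)) x u) := by
    rw [(hΦ.fderiv_residues hU hx u).2.1]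
    exact hq.lieRes_mem (hΦ.angular_mem hU hx u)
  have h1 := lax_iff_lieRes hq hh hX hN hB
  refine ⟨Iff.trans (forall₂_congr fun z hz => ?_) h1.1, h1.2⟩
  rw [hΦ.fderiv_lax hU hx hz]

/-- The derivative of a Hamiltonian, paired with its regularized gradient. -/
theorem IsSmoothField.fderiv_hamiltonian_eq (hΦ : D.IsSmoothField U Φ) (hU : IsOpen U) (hx : x ∈ U)
    {p : ℕ} {r : Pt N} {h : RatMat m} {X : Tuple m N} (hh : D.IsEquivariant 0 h)
    (hX : D.IsGradient (D.hamiltonian p r) (D.expand (D.lax (Φ x))) X)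
    (hN : D.IsLoopPlus 0 (X - D.expand h)) (u : E) :
    fderiv ℝ (fun y => D.hamiltonian p r (D.expand (D.lax (Φ y)))) x u =
      resPair (fderiv ℝ (fun y => D.residues (Φ y)) x u) (truncation (X - D.expand h)) := by
  have hq := (hΦ.2 x hx).1.residues
  have hB : D.IsResidues (fderiv ℝ (fun y => D.residues (Φ y)) x u) := by
    rw [(hΦ.fderiv_residues hU hx u).2.1]
    exact hq.lieRes_mem (hΦ.angular_mem hU hx u)
  -- The gradient may be replaced by its Taylor part: the generator pairs to zero with equivariant
  -- one-forms by the residue theorem.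
  rw [(hΦ.fderiv_hamiltonian hU hx hX u).2, ← pairing_poleMap hB hN, pairing_sub_right,
    pairing_expand_expand D hB.poleMap_isEquivariant hh, sub_zero]

/-- The Lagrangian coefficient along a field, for the velocity in the direction `v`. -/
theorem IsSmoothField.fderiv_lagrangian (hΦ : D.IsSmoothField U Φ) (hU : IsOpen U) (hx : x ∈ U)
    (p : ℕ) (r : Pt N) (v : E) :
    DifferentiableAt ℝ (fun y => D.momentum (Φ y) (fderiv ℝ Φ y v) -
      D.hamiltonian p r (D.expand (D.lax (Φ y)))) x ∧
    ∀ u, fderiv ℝ (fun y => D.momentum (Φ y) (fderiv ℝ Φ y v) -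
      D.hamiltonian p r (D.expand (D.lax (Φ y)))) x u =
      fderiv ℝ (fun y => D.momentum (Φ y) (fderiv ℝ Φ y v)) x u -
        fderiv ℝ (fun y => D.hamiltonian p r (D.expand (D.lax (Φ y)))) x u := by
  obtain ⟨X, hX⟩ := D.exists_isGradient p r (D.expand (D.lax (Φ x)))
  have h1 := (hΦ.differentiableAt_momentum hU hx v).1
  have h2 := (hΦ.fderiv_hamiltonian hU hx hX v).1
  refine ⟨h1.sub h2, fun u => ?_⟩
  rw [fderiv_fun_sub h1 h2]
  rfl

/-- Hamiltonians are in involution along solutions of the Lax equations. -/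
theorem IsSmoothField.fderiv_hamiltonian_eq_zero (hΦ : D.IsSmoothField U Φ) (hU : IsOpen U)
    (hx : x ∈ U) {p p' : ℕ} {r r' : Pt N} {h : RatMat m} {X X' : Tuple m N}
    (hh : D.IsEquivariant 0 h)
    (hX : D.IsGradient (D.hamiltonian p r) (D.expand (D.lax (Φ x))) X)
    (hN : D.IsLoopPlus 0 (X - D.expand h))
    (hX' : D.IsGradient (D.hamiltonian p' r') (D.expand (D.lax (Φ x))) X') {u : E}
    (hlax : fderiv ℝ (fun y => D.residues (Φ y)) x u =
      lieRes (truncation (X - D.expand h)) (D.residues (Φ x))) :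
    fderiv ℝ (fun y => D.hamiltonian p' r' (D.expand (D.lax (Φ y)))) x u = 0 := by
  have hq := (hΦ.2 x hx).1.residues
  have hL := (lax_isEquivariant hq).isLoop
  -- By invariance of the pairing ⟨[N, L], ∇H'⟩ = ⟨N, [L, ∇H']⟩, and ∇H' commutes with L.
  rw [(hΦ.fderiv_hamiltonian hU hx hX' u).2, (hΦ.lax_iff hU hx hh hX hN u).2 hlax, pairing_lie,
    hX'.commute hL, sub_self, ← sub_self (0 : Tuple m N), pairing_sub_right, sub_self]

/-- The difference is dθ(∂_j, ∂_i) - ∂_j H_i + ∂_i H_j. Both derivatives of Hamiltonians vanish on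
solutions, and on shell dθ(∂_j, ∂_i) reduces to ∂_j H_i, hence vanishes too. -/
theorem closure_relation {U : Set (I → ℝ)} (hU : IsOpen U) {φ : (I → ℝ) → Config m N}
    (hφ : D.IsSmoothField U φ) (i j : I) (hi : D.LaxEquation i U φ) (hj : D.LaxEquation j U φ)
    {t : I → ℝ} (ht : t ∈ U) :
    pd j (fun t' => D.lagrangian i (φ t') (jet φ t')) t
      - pd i (fun t' => D.lagrangian j (φ t') (jet φ t')) t = 0 := by
  obtain ⟨h, ⟨hh, X, hX, hN⟩, hz⟩ := hi t ht
  obtain ⟨h', ⟨hh', X', hX', hN'⟩, hz'⟩ := hj t ht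
  have l := (hφ.lax_iff hU ht hh hX hN (Pi.single i 1)).1.1 hz
  have l' := (hφ.lax_iff hU ht hh' hX' hN' (Pi.single j 1)).1.1 hz'
  have e1 := (hφ.fderiv_lagrangian hU ht i.1.1 i.1.2 (Pi.single i 1)).2 (Pi.single j 1)
  have e2 := (hφ.fderiv_lagrangian hU ht j.1.1 j.1.2 (Pi.single j 1)).2 (Pi.single i 1)
  have e3 := hφ.exterior_momentum hU ht (Pi.single j 1) (Pi.single i 1)
  have z1 := hφ.fderiv_hamiltonian_eq_zero hU ht hh' hX' hN' hX l'
  have z2 := hφ.fderiv_hamiltonian_eq_zero hU ht hh hX hN hX' l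
  have z3 := hφ.fderiv_hamiltonian_eq hU ht hh hX hN (Pi.single j 1)
  -- Substituting the Lax flow for ∂_i B and using antisymmetry, dθ(∂_j, ∂_i) becomes ∂_j B paired
  -- with N_i, that is ∂_j H_i.
  rw [l, resPair_lieRes, neg_neg, ← (hφ.fderiv_residues hU ht (Pi.single j 1)).2.1, ← z3, z1] at e3
  rw [z1, sub_zero] at e1
  rw [z2, sub_zero] at e2
  exact (congrArg₂ (· - ·) e1 e2).trans e3

/-- The Euler–Lagrange equation, tested against one variation. -/
theorem eulerLagrange_at {U : Set (I → ℝ)} (hU : IsOpen U) {φ : (I → ℝ) → Config m N}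
    (i : I) {Φ : ℝ × (I → ℝ) → Config m N}
    (hΦ : D.IsSmoothField (Set.univ ×ˢ U) Φ) (h0 : ∀ t ∈ U, Φ (0, t) = φ t) {t : I → ℝ}
    (ht : t ∈ U) {h : RatMat m} {X : Tuple m N} (hh : D.IsEquivariant 0 h)
    (hX : D.IsGradient (D.hamiltonian i.1.1 i.1.2) (D.expand (D.lax (φ t))) X)
    (hN : D.IsLoopPlus 0 (X - D.expand h)) :
    deriv (fun ε : ℝ => D.lagrangian i (Φ (ε, t)) (jet (fun t' => Φ (ε, t')) t)) 0
        = pd i (fun t' => D.velocityDeriv i i (φ t') (jet φ t')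
            (deriv (fun ε : ℝ => Φ (ε, t')) 0)) t ↔
      resPair (fderiv ℝ (fun y => D.residues (φ y)) t (Pi.single i 1) -
        lieRes (truncation (X - D.expand h)) (D.residues (φ t)))
        (angular Φ (1, 0) (0, t)) = 0 := by
  have hV : IsOpen ((Set.univ : Set ℝ) ×ˢ U) := isOpen_univ.prod hU
  have hmem : ∀ ε, ∀ t' ∈ U, (ε, t') ∈ (Set.univ : Set ℝ) ×ˢ U := fun ε t' ht' => ⟨trivial, ht'⟩
  have two : (2 : WithTop ℕ∞) ≠ 0 := by norm_num
  have hd : ∀ ε, ∀ t' ∈ U, DifferentiableAt ℝ Φ (ε, t') := fun ε t' ht' =>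
    (hΦ.contDiffAt hV (hmem ε t' ht')).differentiableAt two
  have hx := hmem 0 t ht
  -- The variation is treated as one more time: both sides become derivatives of the momentum form
  -- on ℝ × U, in the directions (1, 0) and (0, e_i).
  have hl : deriv (fun ε : ℝ => D.lagrangian i (Φ (ε, t)) (jet (fun t' => Φ (ε, t')) t)) 0 =
      fderiv ℝ (fun y => D.momentum (Φ y) (fderiv ℝ Φ y (0, Pi.single i 1)) -
        D.hamiltonian i.1.1 i.1.2 (D.expand (D.lax (Φ y)))) (0, t) (1, 0) := by
    rw [← deriv_slice (hΦ.fderiv_lagrangian hV hx _ _ _).1]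
    congr 1
    funext ε
    exact congrArg (fun w => D.momentum (Φ (ε, t)) w - _) (fderiv_slice (hd ε t ht) _)
  have hr : pd i (fun t' => D.velocityDeriv i i (φ t') (jet φ t')
      (deriv (fun ε : ℝ => Φ (ε, t')) 0)) t =
      fderiv ℝ (fun y => D.momentum (Φ y) (fderiv ℝ Φ y (1, 0))) (0, t) (0, Pi.single i 1) := by
    rw [← fderiv_slice (hΦ.differentiableAt_momentum hV hx _).1]
    refine pd_congr ?_
    filter_upwards [hU.mem_nhds ht] with t' ht'
    rw [(D.velocityDeriv_eq i i _ _ _).2, Pi.single_eq_same, ← h0 t' ht']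
    exact congrArg (D.momentum _) (deriv_slice (hd 0 t' ht'))
  have hres : fderiv ℝ (fun y => D.residues (φ y)) t (Pi.single i 1) =
      fderiv ℝ (fun y => D.residues (Φ y)) (0, t) (0, Pi.single i 1) := by
    refine Eq.trans ?_ (fderiv_slice (F := fun y => D.residues (Φ y))
      (hΦ.fderiv_residues hV hx (1, 0)).1 (Pi.single i 1))
    refine pd_congr (i := i) ?_
    filter_upwards [hU.mem_nhds ht] with t' ht'
    rw [h0 t' ht']
  rw [← h0 t ht] at hX ⊢
  rw [hl, hr, hres, (hΦ.fderiv_lagrangian hV hx _ _ _).2, resPair_sub]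
  -- The difference of the two kinetic terms is the exterior derivative of the momentum form;
  -- antisymmetry puts the derivative of H in the same shape.
  have e1 := hΦ.exterior_momentum hV hx (1, 0) (0, Pi.single i 1)
  have e2 := hΦ.fderiv_hamiltonian_eq hV hx hh hX hN (1, 0)
  rw [(hΦ.fderiv_residues hV hx (1, 0)).2.1, resPair_lieRes] at e2
  constructor
  · intro h
    linear_combination -h + e1 - e2
  · intro h
    linear_combination -h + e1 - e2

end GaudinData

/-! ### Variations of a field and the Euler–Lagrange equations -/

section variation

variable {𝔸 : Type} [NormedRing 𝔸] [NormedAlgebra ℝ 𝔸] [CompleteSpace 𝔸]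
  {W : Type} [NormedAddCommGroup W] [NormedSpace ℝ W] {f : W → 𝔸} {p : ℝ × W}

theorem contDiffAt_exp_mul {n : WithTop ℕ∞} (hf : ContDiffAt ℝ n f p.2) (x : 𝔸) :
    ContDiffAt ℝ n (fun y : ℝ × W => NormedSpace.exp (y.1 • x) * f y.2) p := by
  have h1 : ContDiffAt ℝ n (fun y : ℝ × W => y.1 • x) p := contDiffAt_fst.smul contDiffAt_const
  have h2 : ContDiffAt ℝ n (NormedSpace.exp : 𝔸 → 𝔸) (p.1 • x) :=
    (NormedSpace.exp_analytic (𝕂 := ℝ) (p.1 • x)).contDiffAt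
  exact (h2.comp p h1).mul (hf.comp p contDiffAt_snd)

theorem fderiv_exp_mul (hf : DifferentiableAt ℝ f p.2) (x : 𝔸) (w : ℝ × W) :
    fderiv ℝ (fun y : ℝ × W => NormedSpace.exp (y.1 • x) * f y.2) p w =
      w.1 • (x * (NormedSpace.exp (p.1 • x) * f p.2)) +
        NormedSpace.exp (p.1 • x) * fderiv ℝ f p.2 w.2 := by
  have h1 : HasFDerivAt (fun y : ℝ × W => NormedSpace.exp (y.1 • x))
      ((ContinuousLinearMap.toSpanSingleton ℝ (x * NormedSpace.exp (p.1 • x))).comp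
        (ContinuousLinearMap.fst ℝ ℝ W)) p :=
    (hasDerivAt_exp_smul_const' x p.1).hasFDerivAt.comp p hasFDerivAt_fst
  have h2 : HasFDerivAt (fun y : ℝ × W => f y.2)
      ((fderiv ℝ f p.2).comp (ContinuousLinearMap.snd ℝ ℝ W)) p :=
    hf.hasFDerivAt.comp p hasFDerivAt_snd
  have h := fderiv_mul_apply' h1.differentiableAt h2.differentiableAt w
  rw [h1.fderiv, h2.fderiv] at h
  refine h.trans ?_
  simp [mul_assoc]

theorem contDiffAt_mul_inverse {n : WithTop ℕ∞} {g : W → 𝔸} {t : W} (hf : ContDiffAt ℝ n f t)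
    (hg : ContDiffAt ℝ n g t) (hu : IsUnit (g t)) :
    ContDiffAt ℝ n (fun y => f y * Ring.inverse (g y)) t := by
  obtain ⟨u, hu⟩ := hu
  have h := contDiffAt_ringInverse ℝ (n := n) u
  rw [hu] at h
  exact hf.mul (h.comp t hg)

theorem fderiv_add_smul_const {V : Type} [NormedAddCommGroup V] [NormedSpace ℝ V] {g : W → V}
    (hg : DifferentiableAt ℝ g p.2) (y : V) (w : ℝ × W) :
    fderiv ℝ (fun z : ℝ × W => g z.2 + z.1 • y) p w = fderiv ℝ g p.2 w.2 + w.1 • y := by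
  have h1 : HasFDerivAt (fun z : ℝ × W => g z.2)
      ((fderiv ℝ g p.2).comp (ContinuousLinearMap.snd ℝ ℝ W)) p :=
    hg.hasFDerivAt.comp p hasFDerivAt_snd
  have h2 : HasFDerivAt (fun z : ℝ × W => z.1 • y)
      ((ContinuousLinearMap.fst ℝ ℝ W).smulRight y) p := hasFDerivAt_fst.smul_const y
  have h3 : HasFDerivAt (fun z : ℝ × W => g z.2 + z.1 • y) _ p := h1.add h2
  rw [h3.fderiv]
  rfl

end variation

namespace GaudinData

variable {m N T : ℕ} (D : GaudinData m N T)

theorem gmat_injective {𝔤 : LieSubalgebra ℂ (Mat m)} {g h : matrixGroup 𝔤}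
    (e : gmat g = gmat h) : g = h := Subtype.ext (Units.ext e)

theorem real_smul_mem (ε : ℝ) {S : Submodule ℂ (Mat m)} {X : Mat m} (hX : X ∈ S) : ε • X ∈ S := by
  rw [RCLike.real_smul_eq_coe_smul (K := ℂ)]
  exact S.smul_mem _ hX

theorem exists_exp_smul {X : Mat m} (hX : X ∈ D.𝔤) (ε : ℝ) :
    ∃ g : matrixGroup D.𝔤, gmat g = NormedSpace.exp (ε • X) := by
  obtain ⟨g, hg, -⟩ := D.exists_exp (real_smul_mem (S := D.𝔤.toSubmodule) ε hX)
  exact ⟨g, hg⟩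

/-- The integrated automorphism sends exp X to exp σX, so it fixes the exponential of a σ-fixed
element. This keeps variations of φ₀^{(0)} σ-invariant. -/
theorem exists_exp_smul_grade {X : Mat m} (hX : X ∈ D.grade 0) (ε : ℝ) :
    ∃ g : matrixGroup D.𝔤, D.σG g = g ∧ gmat g = NormedSpace.exp (ε • X) := by
  have h : ε • X ∈ D.grade 0 := real_smul_mem (S := D.gradeSub 0) ε hX
  obtain ⟨h1, h2⟩ := D.mem_grade_iff.1 h
  obtain ⟨g, hg, hg'⟩ := D.exists_exp h1
  rw [zpow_zero, one_smul] at h2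
  rw [h2] at hg'
  exact ⟨g, gmat_injective (hg'.trans hg.symm), hg⟩

/-- The right-invariant velocity of exp(εX)φ: the generator plus the conjugated velocity of φ. Both
stay in the required eigenspace. -/
theorem exp_velocity {a b : Mat m} (ha : a * a⁻¹ = 1) (hb : b * b⁻¹ = 1) (c : ℝ) (X d : Mat m) :
    (c • (X * (a * b)) + a * d) * (a * b)⁻¹ = c • X + a * (d * b⁻¹) * a⁻¹ := by
  rw [Matrix.mul_inv_rev, add_mul, smul_mul_assoc]
  have e : X * (a * b) * (b⁻¹ * a⁻¹) = X * (a * (b * b⁻¹) * a⁻¹) := by simp only [mul_assoc]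
  rw [e, hb, mul_one, ha, mul_one]
  simp only [mul_assoc]

variable {W : Type}

/-- The variation of a field generated by an element of the truncated Lie algebra. -/
noncomputable def vary (φ : W → Config m N) (x₀ y : Mat m) (x : Fin N → Mat m) (p : ℝ × W) :
    Config m N :=
  ((fun s => NormedSpace.exp (p.1 • x s) * (φ p.2).1 s),
    NormedSpace.exp (p.1 • x₀) * (φ p.2).2.1,
    (unipotent (φ p.2) + p.1 • y) * (NormedSpace.exp (p.1 • x₀) * (φ p.2).2.1))

theorem isUnit_exp_mul (x a : Mat m) (ha : IsUnit a) : IsUnit (NormedSpace.exp x * a) :=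
  (Matrix.isUnit_exp x).mul ha

/-- The third component of `vary` is chosen so that the nilpotent part moves along a straight line
in the eigenspace of degree 1. -/
theorem unipotent_vary {φ : W → Config m N} {p : ℝ × W} (hu : IsUnit (φ p.2).2.1) (x₀ y : Mat m)
    (x : Fin N → Mat m) : unipotent (vary φ x₀ y x p) = unipotent (φ p.2) + p.1 • y := by
  have := Ring.mul_inverse_cancel _ (isUnit_exp_mul (p.1 • x₀) _ hu)
  rw [unipotent, vary, mul_assoc, this, mul_one]

theorem vary_zero {φ : W → Config m N} {t : W} (hu : IsUnit (φ t).2.1) (x₀ y : Mat m)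
    (x : Fin N → Mat m) : vary φ x₀ y x (0, t) = φ t := by
  have := Ring.inverse_mul_cancel _ hu
  simp [vary, unipotent, mul_assoc, this]

variable {D} [NormedAddCommGroup W] [NormedSpace ℝ W] {U : Set W} {φ : W → Config m N}

theorem IsSmoothField.contDiffAt_vary (hφ : D.IsSmoothField U φ) (hU : IsOpen U) {p : ℝ × W}
    (hp : p.2 ∈ U) (x₀ y : Mat m) (x : Fin N → Mat m) :
    ContDiffAt ℝ ((⊤ : ℕ∞) : WithTop ℕ∞) (vary φ x₀ y x) p := by
  obtain ⟨h1, h2, h3⟩ := contDiffAt_triple_iff.1 (hφ.1.contDiffAt (hU.mem_nhds hp))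
  have hu := (hφ.2 _ hp).1.isUnit.2
  have e0 := contDiffAt_exp_mul h2 x₀
  have hy : ContDiffAt ℝ ((⊤ : ℕ∞) : WithTop ℕ∞)
      (fun p : ℝ × W => unipotent (φ p.2) + p.1 • y) p :=
    ((contDiffAt_mul_inverse h3 h2 hu).comp p contDiffAt_snd).add
      (contDiffAt_fst.smul contDiffAt_const)
  exact contDiffAt_triple_iff.2 ⟨fun s => contDiffAt_exp_mul (h1 s) (x s), e0, hy.mul e0⟩

theorem IsSmoothField.fderiv_unipotent_vary (hφ : D.IsSmoothField U φ) (hU : IsOpen U) {p : ℝ × W}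
    (hp : p.2 ∈ U) (x₀ y : Mat m) (x : Fin N → Mat m) (w : ℝ × W) :
    fderiv ℝ (fun z => unipotent (GaudinData.vary φ x₀ y x z)) p w =
      fderiv ℝ (fun z => unipotent (φ z)) p.2 w.2 + w.1 • y := by
  have two : (2 : WithTop ℕ∞) ≠ 0 := by norm_num
  obtain ⟨-, h2, h3⟩ := hφ.components hU hp
  have hd := (fderiv_unipotent (h2.differentiableAt two) (h3.differentiableAt two)
    (hφ.2 _ hp).1.isUnit.2 w.2).1
  have he : (fun z => unipotent (GaudinData.vary φ x₀ y x z)) =ᶠ[nhds p] fun z =>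
      unipotent (φ z.2) + z.1 • y := by
    filter_upwards [(isOpen_univ.prod hU).mem_nhds ⟨Set.mem_univ p.1, hp⟩] with z hz
    exact unipotent_vary (hφ.2 _ hz.2).1.isUnit.2 _ _ _
  exact (congrArg (fun L => L w) (he.fderiv_eq (𝕜 := ℝ))).trans (fderiv_add_smul_const hd y w)

theorem IsSmoothField.vary (hφ : D.IsSmoothField U φ) (hU : IsOpen U) {x₀ y : Mat m}
    {x : Fin N → Mat m} (h0 : x₀ ∈ D.grade 0) (hy : y ∈ D.grade 1) (hx : ∀ s, x s ∈ D.𝔤) :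
    D.IsSmoothField (Set.univ ×ˢ U) (GaudinData.vary φ x₀ y x) := by
  have two : (2 : WithTop ℕ∞) ≠ 0 := by norm_num
  refine ⟨fun p hp => (hφ.contDiffAt_vary hU hp.2 x₀ y x).contDiffWithinAt, fun p hp => ?_⟩
  have ht : p.2 ∈ U := hp.2
  obtain ⟨hc, htan⟩ := hφ.2 _ ht
  have hu := hc.isUnit
  have hvu : IsUnit (GaudinData.vary φ x₀ y x p).2.1 := isUnit_exp_mul _ _ hu.2
  obtain ⟨c1, ⟨g0, hg0, hgq⟩, c3⟩ := hc
  obtain ⟨e0, he0, heq⟩ := D.exists_exp_smul_grade h0 p.1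
  obtain ⟨h1, h2, h3⟩ := hφ.components hU ht
  have hun := unipotent_vary (p := p) hu.2 x₀ y x
  have hd := (hφ.contDiffAt_vary hU ht x₀ y x).differentiableAt (by simp)
  have hcancel : ∀ {a : Mat m}, IsUnit a → a * a⁻¹ = 1 := fun h =>
    Matrix.mul_nonsing_inv _ ((Matrix.isUnit_iff_isUnit_det _).1 h)
  refine ⟨⟨fun s => ?_, ⟨e0 * g0, by rw [map_mul, he0, hg0], ?_⟩, ?_⟩, fun w => ⟨fun s => ?_, ?_, ?_⟩⟩
  · obtain ⟨g, hg⟩ := c1 s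
    obtain ⟨e, he⟩ := D.exists_exp_smul (hx s) p.1
    refine ⟨e * g, (gmat_mul e g).trans ?_⟩
    rw [he]
    exact congrArg (_ * ·) hg
  · refine (gmat_mul e0 g0).trans ?_
    rw [heq]
    exact congrArg (_ * ·) hgq
  · rw [Matrix.nonsing_inv_eq_ringInverse]
    change unipotent _ ∈ _
    rw [hun]
    refine (D.gradeSub 1).add_mem ?_ (real_smul_mem (S := D.gradeSub 1) _ hy)
    rw [Matrix.nonsing_inv_eq_ringInverse] at c3
    exact c3
  · rw [(fderiv_config hd w).1]
    have e1 := fderiv_exp_mul ((h1 s).differentiableAt two) (x s) w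
    obtain ⟨e, he⟩ := D.exists_exp_smul (hx s) p.1
    have ht1 := (htan w.2).1 s
    rw [(fderiv_config ((hφ.contDiffAt hU ht).differentiableAt two) w.2).1] at ht1
    have e2 := exp_velocity (hcancel (Matrix.isUnit_exp (p.1 • x s))) (hcancel (hu.1 s)) w.1 (x s)
      (fderiv ℝ (fun y => (φ y).1 s) p.2 w.2)
    have e3 : fderiv ℝ (fun z => (GaudinData.vary φ x₀ y x z).1 s) p w *
        ((GaudinData.vary φ x₀ y x p).1 s)⁻¹ = _ := (congrArg (· * _) e1).trans e2
    rw [e3, ← he]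
    exact D.𝔤.add_mem (real_smul_mem (S := D.𝔤.toSubmodule) _ (hx s)) (D.conj_mem e ht1)
  · rw [(fderiv_config hd w).2.1]
    have e1 := fderiv_exp_mul (h2.differentiableAt two) x₀ w
    have ht1 := (htan w.2).2.1
    rw [(fderiv_config ((hφ.contDiffAt hU ht).differentiableAt two) w.2).2.1] at ht1
    have e2 := exp_velocity (hcancel (Matrix.isUnit_exp (p.1 • x₀))) (hcancel hu.2) w.1 x₀
      (fderiv ℝ (fun y => (φ y).2.1) p.2 w.2)
    have e3 : fderiv ℝ (fun z => (GaudinData.vary φ x₀ y x z).2.1) p w *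
        (GaudinData.vary φ x₀ y x p).2.1⁻¹ = _ := (congrArg (· * _) e1).trans e2
    rw [e3, ← heq]
    exact (D.gradeSub 0).add_mem (real_smul_mem (S := D.gradeSub 0) _ h0)
      (D.conj_mem_grade he0 ht1)
  · obtain ⟨d1, d2, d3⟩ := differentiableAt_triple_iff.1 hd
    have e := (hφ.fderiv_unipotent_vary hU ht x₀ y x) w
    rw [(fderiv_unipotent d2 d3 hvu w).2] at e
    rw [(fderiv_config hd w).2.1, (fderiv_config hd w).2.2, e]
    have ht1 := (htan w.2).2.2
    have hφd := (hφ.contDiffAt hU ht).differentiableAt two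
    rw [(fderiv_config hφd w.2).2.1, (fderiv_config hφd w.2).2.2,
      ← (fderiv_unipotent (h2.differentiableAt two) (h3.differentiableAt two) hu.2 w.2).2] at ht1
    exact (D.gradeSub 1).add_mem ht1 (real_smul_mem (S := D.gradeSub 1) _ hy)

/-- Every element of the truncated Lie algebra is the velocity of a variation. -/
theorem IsSmoothField.exists_variation (hφ : D.IsSmoothField U φ) (hU : IsOpen U) {t : W}
    (ht : t ∈ U) {ξ : Truncated m N} (hξ : D.IsTruncated ξ) :
    ∃ Φ : ℝ × W → Config m N, D.IsSmoothField (Set.univ ×ˢ U) Φ ∧ (∀ t ∈ U, Φ (0, t) = φ t) ∧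
      angular Φ (1, 0) (0, t) = ξ := by
  have two : (2 : WithTop ℕ∞) ≠ 0 := by norm_num
  obtain ⟨hc, -⟩ := hφ.2 t ht
  have hu := hc.isUnit
  have hun : unipotent (φ t) ∈ D.grade 1 := by
    have := hc.2.2
    rw [Matrix.nonsing_inv_eq_ringInverse] at this
    exact this
  -- The bracket is added because `angular` subtracts [x₀, c] from the derivative of the nilpotent
  -- part c.
  have hy : ξ.2.1 + ⁅ξ.1, unipotent (φ t)⁆ ∈ D.grade 1 := by
    have := D.lie_mem_grade hξ.1 hun
    rw [zero_add] at this
    exact (D.gradeSub 1).add_mem hξ.2.1 this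
  have h0 : ∀ t ∈ U, GaudinData.vary φ ξ.1 (ξ.2.1 + ⁅ξ.1, unipotent (φ t)⁆) ξ.2.2 (0, t) = φ t :=
    fun t ht => vary_zero (hφ.2 t ht).1.isUnit.2 _ _ _
  refine ⟨GaudinData.vary φ ξ.1 (ξ.2.1 + ⁅ξ.1, unipotent (φ t)⁆) ξ.2.2, hφ.vary hU hξ.1 hy hξ.2.2,
    fun t ht => vary_zero (hφ.2 t ht).1.isUnit.2 _ _ _, ?_⟩
  obtain ⟨h1, h2, h3⟩ := hφ.components hU ht
  have key : ∀ {f : W → Mat m} (_ : DifferentiableAt ℝ f t) (_ : IsUnit (f t)) (x : Mat m),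
      logDer (fun z : ℝ × W => NormedSpace.exp (z.1 • x) * f z.2) (1, 0) (0, t) = x := by
    intro f hf huf x
    have e := fderiv_exp_mul (p := (0, t)) hf x (1, 0)
    simp only [zero_smul, NormedSpace.exp_zero, one_mul, one_smul, map_zero, add_zero] at e
    have hx : x * f t * Ring.inverse (f t) = x := by
      rw [mul_assoc, Ring.mul_inverse_cancel _ huf, mul_one]
    refine Eq.trans ?_ hx
    refine (congrArg (· * _) e).trans ?_
    simp only [zero_smul, NormedSpace.exp_zero, one_mul]
  have k0 := key (h2.differentiableAt two) hu.2 ξ.1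
  have ks := fun s => key ((h1 s).differentiableAt two) (hu.1 s) (ξ.2.2 s)
  have ku := hφ.fderiv_unipotent_vary (p := (0, t)) hU ht ξ.1 (ξ.2.1 + ⁅ξ.1, unipotent (φ t)⁆) ξ.2.2
    (1, 0)
  refine Prod.ext k0 (Prod.ext ?_ (funext ks))
  change fderiv ℝ (fun z => unipotent (GaudinData.vary φ ξ.1 _ ξ.2.2 z)) (0, t) (1, 0) -
    ⁅logDer (fun z : ℝ × W => NormedSpace.exp (z.1 • ξ.1) * (φ z.2).2.1) (1, 0) (0, t),
      unipotent (GaudinData.vary φ ξ.1 _ ξ.2.2 (0, t))⁆ = ξ.2.1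
  rw [ku, h0 t ht, k0, map_zero, zero_add, one_smul, add_sub_cancel_right]

variable {I : Finset (ℕ × Pt N)}

/-- The Euler–Lagrange equations are the Lax equations. -/
theorem eulerLagrange_iff {U : Set (I → ℝ)} (hU : IsOpen U) {φ : (I → ℝ) → Config m N}
    (hφ : D.IsSmoothField U φ) (i : I) : D.EulerLagrange i U φ ↔ D.LaxEquation i U φ := by
  constructor
  · intro hEL t ht
    obtain ⟨h, ⟨hh, X, hX, hN⟩, -⟩ := D.existsUnique_isLaxGenerator i.1.1 i.1.2 (φ t)
    refine ⟨h, ⟨hh, X, hX, hN⟩, ?_⟩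
    refine (hφ.lax_iff hU ht hh hX hN (Pi.single i 1)).1.2 (sub_eq_zero.1 ?_)
    have hq := (hφ.2 t ht).1.residues
    have hR : D.IsResidues (fderiv ℝ (fun y => D.residues (φ y)) t (Pi.single i 1)) := by
      rw [(hφ.fderiv_residues hU ht _).2.1]
      exact hq.lieRes_mem (hφ.angular_mem hU ht _)
    -- Nondegeneracy replaces the fundamental lemma of the calculus of variations: the equation is
    -- imposed pointwise in t, so no cutoff is needed and each ξ is tested at the given t.
    refine (hR.sub (hq.lieRes_mem hN.1.truncation_mem)).eq_zero fun ξ hξ => ?_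
    obtain ⟨Φ, hΦ, h0, hang⟩ := hφ.exists_variation hU ht hξ
    rw [← hang]
    exact (eulerLagrange_at hU i hΦ h0 ht hh hX hN).1 (hEL Φ hΦ h0 t ht)
  · intro hL Φ hΦ h0 t ht
    obtain ⟨h, ⟨hh, X, hX, hN⟩, hz⟩ := hL t ht
    refine (eulerLagrange_at hU i hΦ h0 ht hh hX hN).2 ?_
    rw [(hφ.lax_iff hU ht hh hX hN (Pi.single i 1)).1.1 hz, sub_self]
    simp [resPair]

end GaudinData

end CyclotomicGaudin

theorem theorem4p1 {m N T : ℕ} (D : GaudinData m N T) :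
    -- the Lax matrix `L` is the general point of the coadjoint orbit of `Λ`
    (∀ φ : TaylorTuple m N, D.IsLoopGroupPlus φ →
      ∀ g : RatMat m,
        D.IsMinusPart (coadjoint φ (D.expand D.ratLambda)) g ↔
          g = D.lax (components φ)) ∧
    -- the geometric one-form has the stated coefficients, up to an exact one-form `d (F (φ₊))`
    (∃ F : TaylorTuple m N → ℂ,
      ∀ (I : Finset (ℕ × Pt N)) (U : Set (I → ℝ)), IsOpen U →
      ∀ φ : (I → ℝ) → TaylorTuple m N,
        (∀ t ∈ U, D.IsLoopGroupPlus (φ t)) →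
        (∀ r k, ContDiffOn ℝ ((⊤ : ℕ∞) : WithTop ℕ∞) (fun t => pcoeff (φ t r) k) U) →
        ∀ t ∈ U, DifferentiableAt ℝ (fun t' => F (φ t')) t ∧
          ∀ (i : I) (f : RatMat m), D.IsEquivariant 0 f →
            D.geometricLagrangian i φ f t (D.lax (components (φ t))) =
              D.lagrangian i (components (φ t)) (jet (fun t' => components (φ t')) t)
                + pd i (fun t' => F (φ t')) t) ∧
    -- the generators of the Lax equations are well defined
    (∀ (p : ℕ) (r : Pt N), 1 ≤ p → ∀ q : Config m N,
      D.IsConfig q → ∃! h, D.IsLaxGenerator p r q h) ∧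
    ∀ I : Finset (ℕ × Pt N), (∀ i ∈ I, 1 ≤ i.1) →
      -- corner equations
      D.CornerEquations I ∧
      ∀ U : Set (I → ℝ), IsOpen U →
      ∀ φ : (I → ℝ) → Config m N, D.IsSmoothField U φ →
        (∀ (i : I), ∀ t ∈ U,
          DifferentiableAt ℝ (fun t' => D.lagrangian i (φ t') (jet φ t')) t) ∧
        -- the Euler-Lagrange equations are the Lax equations
        (∀ i : I, D.EulerLagrange i U φ ↔ D.LaxEquation i U φ) ∧
        -- closure relation on solutions
        (∀ i j : I, D.LaxEquation i U φ → D.LaxEquation j U φ → ∀ t ∈ U,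
          pd j (fun t' => D.lagrangian i (φ t') (jet φ t')) t
            - pd i (fun t' => D.lagrangian j (φ t') (jet φ t')) t = 0) := by
  refine ⟨fun φ hφ g => GaudinData.isMinusPart_iff hφ g,
    ⟨D.potential, fun I U hU φ hφ hs t ht => ⟨?_, fun i f hf =>
      GaudinData.geometricLagrangian_eq hU hφ hs ht i hf⟩⟩,
    fun p r _ q _ => D.existsUnique_isLaxGenerator p r q,
    fun I _ => ⟨D.cornerEquations, fun U hU φ hφ => ⟨fun i t ht => ?_,
      fun i => GaudinData.eulerLagrange_iff hU hφ i,
      fun i j hi hj t ht => GaudinData.closure_relation hU hφ i j hi hj ht⟩⟩⟩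
  · exact (D.fderiv_potential ((hφ t ht).component .zero).1 (fun r k =>
      ((hs r k).contDiffAt (hU.mem_nhds ht)).differentiableAt (by simp)) 0).1
  · exact (hφ.fderiv_lagrangian hU ht i.1.1 i.1.2 (Pi.single i 1)).1
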